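/- Let $\mathrm{Nil}_3=\mathbb R^3$ with the multiplication $(x_1,x_2,x_3)\cdot(\tilde x_1,\tilde x_2,\tilde x_3)=(x_1+\tilde x_1,\,x_2+\tilde x_2,\,x_3+\tilde x_3+\tfrac12(x_1\tilde x_2-\tilde x_1x_2))$ and the left-invariant Riemannian metric for which the natural basis $e_1,e_2,e_3$ of the Lie algebra is orthonormal and positively oriented. Let $\mathbb D\subset\mathbb C$ be a simply connected domain with coordinate $z=x+iy$ and let $f:\mathbb D\to\mathrm{Nil}_3$ be a smooth conformal immersion. Write $e^{u}=2\langle f_z,f_{\bar z}\rangle$ for the conformal factor, $N$ for the positive unit normal (the direction of $f_x\times f_y$), $H$ for the mean curvature with respect to $N$, $h=e^{u/2}\langle f^{-1}N,e_3\rangle$ for the support function, $\phi_3=\langle f^{-1}f_z,e_3\rangle$, $A=\langle\nabla^f_{\partial_z}f_z,N\rangle$ for the coefficient of the Hopf differential, and $$B=\tfrac14(2H+i)\Big(A+\frac{\phi_3^2}{2H+i}\Big).$$ Assume that the Dirac potential $-\tfrac H2e^{u/2}+\tfrac i4h$ has no zero on $\mathbb D$, and let $w:\mathbb D\to\mathbb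 C$ be a smooth function with $e^{w/2}=-\tfrac H2e^{u/2}+\tfrac i4h$. For $\lambda\in\mathbb C^\times$ put $\alpha^\lambda=U^\lambda dz+V^\lambda d\bar z$, where $$U^\lambda=\begin{pmatrix}\tfrac14w_z+\tfrac12H_ze^{-w/2+u/2}&-\lambda^{-1}e^{w/2}\\ \lambda^{-1}Be^{-w/2}&-\tfrac14w_z\end{pmatrix},\qquad V^\lambda=\begin{pmatrix}-\tfrac14w_{\bar z}&-\lambda\bar Be^{-w/2}\\ \lambda e^{w/2}&\tfrac14w_{\bar z}+\tfrac12H_{\bar z}e^{-w/2+u/2}\end{pmatrix}.$$ By a fundamental solution we mean a smooth map $F:\mathbb D\to\mathrm{GL}_2\mathbb C$ with $F_z=FU^{1}$ and $F_{\bar z}=FV^{1}$. Let $\sigma_3=\operatorname{diag}(1,-1)$ and identify the semi-Riemannian symmetric space $\mathrm{GL}_2\mathbb C/\operatorname{diag}$ with the orbit $\{\operatorname{Ad}(g)\sigma_3=g\sigma_3g^{-1}: g\in\mathrm{GL}_2\mathbb C\}$, with the metric induced by $\langle X,Y\rangle=\operatorname{Re}\operatorname{tr}(XY)$; a smooth map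 $n$ from $\mathbb D$ into it is harmonic if it is a critical point of the energy $\int\tfrac12(\langle n_x,n_x\rangle+\langle n_y,n_y\rangle)\,dx\,dy$ under all smooth compactly supported variations in this space. Then the following statements are equivalent: 1. $f$ has constant mean curvature, i.e. $H$ is constant on $\mathbb D$. 2. For every $\lambda\in\mathbb C^\times$ the connection $d+\alpha^\lambda$ on $\mathbb D\times\mathrm{GL}_2\mathbb C$ is flat, i.e. $d\alpha^\lambda+\alpha^\lambda\wedge\alpha^\lambda=0$. 3. There is a fundamental solution $F$ for which $\operatorname{Ad}(F)\sigma_3:\mathbb D\to\mathrm{GL}_2\mathbb C/\operatorname{diag}$ is harmonic. Moreover, for every fundamental solution $F$, $f$ has constant mean curvature if and only if $\operatorname{Ad}(F)\sigma_3$ is harmonic. -/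

import Mathlib

open scoped ContDiff Matrix

/-- The underlying space `ℝ³` of the Heisenberg group.  The same type serves as its Lie algebra
(the tangent space at the identity `0`); the Euclidean inner product on it is the inner product of
the Lie algebra that makes the natural basis `e₁, e₂, e₃` orthonormal. -/
abbrev Nil3 : Type := EuclideanSpace ℝ (Fin 3)

namespace Nil3

/-- The group multiplication of `Nil₃ = Nil₃(1/2)`. -/
noncomputable def mul (p q : Nil3) : Nil3 :=
  !₂[p 0 + q 0, p 1 + q 1, p 2 + q 2 + (1 / 2) * (p 0 * q 1 - q 0 * p 1)]

/-- The inverse in `Nil₃`; the identity is `0`. -/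
noncomputable def inv (p : Nil3) : Nil3 := -p

theorem mul_assoc' (p q r : Nil3) : mul (mul p q) r = mul p (mul q r) := by
  ext i; fin_cases i <;> simp [mul] <;> ring

theorem zero_mul' (p : Nil3) : mul 0 p = p := by
  ext i; fin_cases i <;> simp [mul]

theorem inv_mul' (p : Nil3) : mul (inv p) p = 0 := by
  ext i; fin_cases i <;> simp [mul, inv]

/-- The Lie bracket of left-invariant vector fields: `[e₁, e₂] = e₃`, with `e₃` central. -/
noncomputable def bracket (X Y : Nil3) : Nil3 := !₂[0, 0, X 0 * Y 1 - X 1 * Y 0]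

/-- The Levi-Civita connection of the left-invariant metric, on left-invariant vector fields:
`nabla X Y = ∇_X Y`. -/
noncomputable def nabla (X Y : Nil3) : Nil3 :=
  !₂[(1 / 2) * (X 1 * Y 2 + X 2 * Y 1), -(1 / 2) * (X 0 * Y 2 + X 2 * Y 0),
    (1 / 2) * (X 0 * Y 1 - X 1 * Y 0)]

/-- The connection is torsion free. -/
theorem nabla_sub_nabla (X Y : Nil3) : nabla X Y - nabla Y X = bracket X Y := by
  ext i; fin_cases i <;> simp [nabla, bracket] <;> ring

/-- The connection is metric. -/
theorem inner_nabla_add (X Y Z : Nil3) :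
    inner ℝ (nabla X Y) Z + inner ℝ Y (nabla X Z) = 0 := by
  simp [nabla, PiLp.inner_apply, Fin.sum_univ_three]; ring

/-! ### Surface theory in `Nil₃` -/

/-- The Maurer-Cartan form `f⁻¹ df` of a map `f` into `Nil₃`, at the point `z` on the vector `v`:
the derivative of `f` left translated to the Lie algebra. -/
noncomputable def maurerCartan (f : ℂ → Nil3) (z v : ℂ) : Nil3 :=
  fderiv ℝ (fun ζ => mul (inv (f z)) (f ζ)) z v

/-- `f` is a smooth conformal immersion of `D`: `f_x` and `f_y` have the same nonzero length and
are orthogonal, in the left-invariant metric. -/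
def IsConformalImmersionOn (D : Set ℂ) (f : ℂ → Nil3) : Prop :=
  ContDiffOn ℝ ∞ f D ∧ ∀ z ∈ D,
    maurerCartan f z 1 ≠ 0 ∧
    ‖maurerCartan f z 1‖ = ‖maurerCartan f z Complex.I‖ ∧
    inner ℝ (maurerCartan f z 1) (maurerCartan f z Complex.I) = 0

/-- The conformal factor `e^u = 2 ⟨f_z, f_{\bar z}⟩ = (|f_x|² + |f_y|²) / 2`. -/
noncomputable def expU (f : ℂ → Nil3) (z : ℂ) : ℝ :=
  (‖maurerCartan f z 1‖ ^ 2 + ‖maurerCartan f z Complex.I‖ ^ 2) / 2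

/-- `e^{u/2}`. -/
noncomputable def expHalfU (f : ℂ → Nil3) (z : ℂ) : ℝ := Real.sqrt (expU f z)

/-- The left translated positive unit normal `f⁻¹ N`, the normalization of `f_x × f_y`. -/
noncomputable def unitNormal (f : ℂ → Nil3) (z : ℂ) : Nil3 :=
  let c : Nil3 := WithLp.toLp 2
    ((maurerCartan f z 1).ofLp ⨯₃ (maurerCartan f z Complex.I).ofLp)
  ‖c‖⁻¹ • c

/-- The support function `h = ⟨f⁻¹ L, e₃⟩` with `L = e^{u/2} N`. -/
noncomputable def support (f : ℂ → Nil3) (z : ℂ) : ℝ := expHalfU f z * unitNormal f z 2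

/-- The left translation of `∇^f_v (df(v'))`, for constant vectors `v`, `v'` of the domain. -/
noncomputable def covDeriv (f : ℂ → Nil3) (z v v' : ℂ) : Nil3 :=
  fderiv ℝ (fun ζ => maurerCartan f ζ v') z v
    + nabla (maurerCartan f z v) (maurerCartan f z v')

/-- The second fundamental form `⟨∇^f_v (df(v')), N⟩`. -/
noncomputable def secondFundForm (f : ℂ → Nil3) (z v v' : ℂ) : ℝ :=
  inner ℝ (covDeriv f z v v') (unitNormal f z)

/-- The mean curvature `H`: half of the trace of the second fundamental form with respect to the
induced metric `e^u dz d\bar z`. -/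
noncomputable def meanCurvature (f : ℂ → Nil3) (z : ℂ) : ℝ :=
  (secondFundForm f z 1 1 + secondFundForm f z Complex.I Complex.I) / (2 * expU f z)

/-- The mean curvature is constant on `D`. -/
def HasConstantMeanCurvatureOn (D : Set ℂ) (f : ℂ → Nil3) : Prop :=
  ∃ c : ℝ, ∀ z ∈ D, meanCurvature f z = c

/-- The coefficient `A = ⟨∇^f_{∂_z} f_z, N⟩` of the Hopf differential, where
`∂_z = (∂_x - i ∂_y) / 2`. -/
noncomputable def hopf (f : ℂ → Nil3) (z : ℂ) : ℂ :=
  ((secondFundForm f z 1 1 - secondFundForm f z Complex.I Complex.I : ℝ)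
    - Complex.I * (secondFundForm f z 1 Complex.I + secondFundForm f z Complex.I 1 : ℝ)) / 4

/-- The `e₃`-component `φ₃` of `f⁻¹ f_z`. -/
noncomputable def phi3 (f : ℂ → Nil3) (z : ℂ) : ℂ :=
  ((maurerCartan f z 1 2 : ℝ) - Complex.I * (maurerCartan f z Complex.I 2 : ℝ)) / 2

/-- `B = (2H + i) Ã / 4` with `Ã = A + φ₃² / (2H + i)`; `4 B dz²` is the Abresch-Rosenberg
differential. -/
noncomputable def abreschRosenberg (f : ℂ → Nil3) (z : ℂ) : ℂ :=
  (2 * (meanCurvature f z : ℂ) + Complex.I) / 4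
    * (hopf f z + phi3 f z ^ 2 / (2 * (meanCurvature f z : ℂ) + Complex.I))

/-- The Dirac potential `-(H/2) e^{u/2} + (i/4) h`. -/
noncomputable def diracPotential (f : ℂ → Nil3) (z : ℂ) : ℂ :=
  -((meanCurvature f z : ℂ) / 2) * (expHalfU f z : ℂ) + Complex.I / 4 * (support f z : ℂ)

/-! ### The gauged Berdinsky system and its family of connections -/

/-- The Wirtinger derivative `∂_z = (∂_x - i ∂_y) / 2`. -/
noncomputable def dz (g : ℂ → ℂ) (z : ℂ) : ℂ :=
  (fderiv ℝ g z 1 - Complex.I * fderiv ℝ g z Complex.I) / 2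

/-- The Wirtinger derivative `∂_{\bar z} = (∂_x + i ∂_y) / 2`. -/
noncomputable def dzbar (g : ℂ → ℂ) (z : ℂ) : ℂ :=
  (fderiv ℝ g z 1 + Complex.I * fderiv ℝ g z Complex.I) / 2

/-- The coefficient `U^λ` of `dz`; `w` is a function with `e^{w/2}` the Dirac potential of `f`. -/
noncomputable def matU (f : ℂ → Nil3) (w : ℂ → ℂ) (l z : ℂ) : Matrix (Fin 2) (Fin 2) ℂ :=
  !![dz w z / 4 + dz (fun ζ => (meanCurvature f ζ : ℂ)) z / 2
        * (Complex.exp (-w z / 2) * (expHalfU f z : ℂ)),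
      -(l⁻¹ * Complex.exp (w z / 2));
    l⁻¹ * (abreschRosenberg f z * Complex.exp (-w z / 2)),
      -(dz w z / 4)]

/-- The coefficient `V^λ` of `d\bar z`. -/
noncomputable def matV (f : ℂ → Nil3) (w : ℂ → ℂ) (l z : ℂ) : Matrix (Fin 2) (Fin 2) ℂ :=
  !![-(dzbar w z / 4),
      -(l * (starRingEnd ℂ (abreschRosenberg f z) * Complex.exp (-w z / 2)));
    l * Complex.exp (w z / 2),
      dzbar w z / 4 + dzbar (fun ζ => (meanCurvature f ζ : ℂ)) z / 2
        * (Complex.exp (-w z / 2) * (expHalfU f z : ℂ))]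

/-- The matrix valued 1-form `α^λ = U^λ dz + V^λ d\bar z`, at the point `z` on the vector `v`. -/
noncomputable def alpha (f : ℂ → Nil3) (w : ℂ → ℂ) (l z v : ℂ) : Matrix (Fin 2) (Fin 2) ℂ :=
  v • matU f w l z + starRingEnd ℂ v • matV f w l z

/-- The directional derivative of a matrix valued function, entry by entry. -/
noncomputable def matDeriv (M : ℂ → Matrix (Fin 2) (Fin 2) ℂ) (z v : ℂ) :
    Matrix (Fin 2) (Fin 2) ℂ :=
  Matrix.of fun i j => fderiv ℝ (fun ζ => M ζ i j) z v

/-- The connection `d + a` on the trivial `GL₂ℂ`-bundle over `D` is flat: its curvature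
`da + a ∧ a` vanishes.  Here `a z v` is the value of the `gl₂ℂ`-valued 1-form at `z` on `v`. -/
def IsFlatConnectionOn (D : Set ℂ) (a : ℂ → ℂ → Matrix (Fin 2) (Fin 2) ℂ) : Prop :=
  ∀ z ∈ D, ∀ v v' : ℂ,
    matDeriv (fun ζ => a ζ v') z v - matDeriv (fun ζ => a ζ v) z v'
      + (a z v * a z v' - a z v' * a z v) = 0

/-- `F` is a smooth fundamental solution on `D` of the gauged Berdinsky system
`F_z = F U`, `F_{\bar z} = F V`, that is of `dF = F α^λ` at `λ = 1`. -/
def IsFundamentalSolutionOn (D : Set ℂ) (f : ℂ → Nil3) (w : ℂ → ℂ)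
    (F : ℂ → GL (Fin 2) ℂ) : Prop :=
  (∀ i j, ContDiffOn ℝ ∞ (fun z => (F z : Matrix (Fin 2) (Fin 2) ℂ) i j) D) ∧
  ∀ z ∈ D,
    (∀ i j, dz (fun ζ => (F ζ : Matrix (Fin 2) (Fin 2) ℂ) i j) z
      = ((F z : Matrix (Fin 2) (Fin 2) ℂ) * matU f w 1 z) i j) ∧
    (∀ i j, dzbar (fun ζ => (F ζ : Matrix (Fin 2) (Fin 2) ℂ) i j) z
      = ((F z : Matrix (Fin 2) (Fin 2) ℂ) * matV f w 1 z) i j)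

/-! ### Harmonic maps into `GL₂ℂ / diag` -/

/-- `σ₃ = diag (1, -1)`. -/
def sigma3 : Matrix (Fin 2) (Fin 2) ℂ := !![1, 0; 0, -1]

/-- `Ad (g) σ₃ = g σ₃ g⁻¹`. -/
noncomputable def adSigma3 (g : GL (Fin 2) ℂ) : Matrix (Fin 2) (Fin 2) ℂ :=
  (g : Matrix (Fin 2) (Fin 2) ℂ) * sigma3 * ((g⁻¹ : GL (Fin 2) ℂ) : Matrix (Fin 2) (Fin 2) ℂ)

/-- The symmetric space `GL₂ℂ / diag`, realized as the adjoint orbit of `σ₃`, whose stabilizer is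
the diagonal subgroup. -/
def symmetricSpace : Set (Matrix (Fin 2) (Fin 2) ℂ) := Set.range adSigma3

/-- The stabilizer of `σ₃` is the diagonal subgroup. -/
theorem adSigma3_eq_iff (g : GL (Fin 2) ℂ) :
    adSigma3 g = sigma3 ↔
      (g : Matrix (Fin 2) (Fin 2) ℂ) 0 1 = 0 ∧ (g : Matrix (Fin 2) (Fin 2) ℂ) 1 0 = 0 := by
  have h : adSigma3 g = sigma3 ↔ (g : Matrix (Fin 2) (Fin 2) ℂ) * sigma3
      = sigma3 * (g : Matrix (Fin 2) (Fin 2) ℂ) := by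
    unfold adSigma3
    rw [← Units.mul_inv_eq_iff_eq_mul]
  rw [h]
  constructor
  · intro e
    have e1 := congrFun (congrFun e 0) 1
    have e2 := congrFun (congrFun e 1) 0
    simp [sigma3, Matrix.mul_apply, Fin.sum_univ_two] at e1 e2
    exact ⟨neg_eq_self.mp e1, self_eq_neg.mp e2⟩
  · rintro ⟨e1, e2⟩
    ext i j
    fin_cases i <;> fin_cases j <;>
      simp [sigma3, Matrix.mul_apply, Fin.sum_univ_two, e1, e2]

/-- The energy density `(⟨n_x, n_x⟩ + ⟨n_y, n_y⟩) / 2` for the semi-Riemannian metric that the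
`Ad`-invariant form `⟨X, Y⟩ = Re tr (X Y)` induces on the orbit. -/
noncomputable def energyDensity (n : ℂ → Matrix (Fin 2) (Fin 2) ℂ) (z : ℂ) : ℝ :=
  ((matDeriv n z 1 * matDeriv n z 1).trace.re
    + (matDeriv n z Complex.I * matDeriv n z Complex.I).trace.re) / 2

/-- `Φ t`, `t ∈ ℝ`, is a smooth variation of `n = Φ 0` on `D` through maps into the symmetric
space, constant in `t` outside the compact subset `K` of `D`. -/
def IsVariationOn (D K : Set ℂ) (n : ℂ → Matrix (Fin 2) (Fin 2) ℂ)
    (Φ : ℝ → ℂ → Matrix (Fin 2) (Fin 2) ℂ) : Prop :=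
  IsCompact K ∧ K ⊆ D ∧
  (∀ i j, ContDiffOn ℝ ∞ (fun p : ℝ × ℂ => Φ p.1 p.2 i j) (Set.univ ×ˢ D)) ∧
  (∀ t, ∀ z ∈ D, Φ t z ∈ symmetricSpace) ∧
  (∀ z ∈ D, Φ 0 z = n z) ∧
  (∀ t, ∀ z ∈ D \ K, Φ t z = n z)

/-- `n` is a harmonic map from `D` to `GL₂ℂ / diag`: a smooth map that is a critical point of the
energy under all compactly supported variations. -/
def IsHarmonicOn (D : Set ℂ) (n : ℂ → Matrix (Fin 2) (Fin 2) ℂ) : Prop :=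
  (∀ i j, ContDiffOn ℝ ∞ (fun z => n z i j) D) ∧
  (∀ z ∈ D, n z ∈ symmetricSpace) ∧
  ∀ (K : Set ℂ) (Φ : ℝ → ℂ → Matrix (Fin 2) (Fin 2) ℂ), IsVariationOn D K n Φ →
    HasDerivAt (fun t => ∫ z in K, energyDensity (Φ t) z) 0 0

end Nil3

/-! Near each point the null vector f⁻¹f_z is parametrized by two spinors s and t. The tension field
of a conformal immersion is normal, and this fact together with the Maurer-Cartan equation becomes
the nonlinear Dirac equation with potential e^{w/2} (`IsSpinorOn.dirac`). If H is constant,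
differentiating the expression of the potential in s and t yields the missing derivatives
(`IsSpinorOn.exp_mul_dz`), and the row e^{-w/4}(s, \bar t) solves dr = rα at λ = 1. Its mixed
derivatives commute, so the curvature of α at λ = 1 kills this nowhere vanishing row. A reality
argument then shows that the curvature itself vanishes, which gives the Gauss equation and B_{\bar
z} = 0 (`IsSpinorOn.gauss_codazzi`).

For constant H these two equations make α flat for every λ. Conversely, the upper right entry of the
curvature has the form λX - λ⁻¹ H_{\bar z} e^{u/2}/2, so flatness at two values of λ already forces
H_{\bar z} = 0; since H is real and D is connected, H is constant.

For n = Ad(F)σ₃, the relation n² = 1 says that tangent vectors anticommute with n, and the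
Euler-Lagrange equation is [n, Δn] = 0. In the frame F this becomes two scalar equations in the
entries of U and V (`isHarmonicOn_adSigma3_iff`), obtained from dF = Fα alone. The first says
H_{\bar z} = 0; for constant H the second is B_{\bar z} = 0.

A fundamental solution for constant H is found without a general existence theorem for flat
connections. The spinor row is a first row, a second row is supplied by one scalar primitive
(`exists_frame_of_row`), and the local frames, which differ by locally constant factors, are glued
by lifting the identity of D to a covering space (`exists_global_frame`). -/

namespace Nil3

/-! ### Wirtinger calculus -/

/-- The real linear map `v ↦ v a + \bar v b`. -/
noncomputable def wirtingerCLM (a b : ℂ) : ℂ →L[ℝ] ℂ :=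
  a • ContinuousLinearMap.id ℝ ℂ + b • (Complex.conjCLE : ℂ →L[ℝ] ℂ)

@[simp] theorem wirtingerCLM_apply (a b v : ℂ) :
    wirtingerCLM a b v = v * a + starRingEnd ℂ v * b := by
  simp [wirtingerCLM, mul_comm]

/-- `g` is real differentiable at `z` with `g_z = a` and `g_{\bar z} = b`. -/
def HasWirtingerAt (g : ℂ → ℂ) (a b z : ℂ) : Prop := HasFDerivAt g (wirtingerCLM a b) z

/-- The two Wirtinger coefficients are the complex linear and antilinear parts of a real linear map.
Derivatives are carried as such pairs in `HasWirtingerAt`, which reduces the later calculus to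
polynomial identities. -/
theorem clm_eq_wirtingerCLM (L : ℂ →L[ℝ] ℂ) :
    L = wirtingerCLM ((L 1 - Complex.I * L Complex.I) / 2) ((L 1 + Complex.I * L Complex.I) / 2) := by
  refine ContinuousLinearMap.ext fun v => ?_
  have hv : L v = v.re * L 1 + v.im * L Complex.I := by
    have e : v = v.re • (1 : ℂ) + v.im • Complex.I := by
      simp [Complex.re_add_im]
    conv_lhs => rw [e, map_add, map_smul, map_smul]
    simp
  rw [hv, wirtingerCLM_apply]
  conv_rhs => rw [← Complex.re_add_im v]
  simp only [map_add, map_mul, Complex.conj_ofReal, Complex.conj_I]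
  linear_combination (v.im * L Complex.I) * Complex.I_sq

theorem hasWirtingerAt_of_differentiableAt {g : ℂ → ℂ} {z : ℂ} (h : DifferentiableAt ℝ g z) :
    HasWirtingerAt g (dz g z) (dzbar g z) z := by
  have := h.hasFDerivAt
  rw [clm_eq_wirtingerCLM (fderiv ℝ g z)] at this
  exact this

namespace HasWirtingerAt

variable {g k : ℂ → ℂ} {a b c d z : ℂ}

theorem fderiv_apply (h : HasWirtingerAt g a b z) (v : ℂ) :
    fderiv ℝ g z v = v * a + starRingEnd ℂ v * b := by
  rw [HasFDerivAt.fderiv h, wirtingerCLM_apply]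

theorem dz_eq (h : HasWirtingerAt g a b z) : dz g z = a := by
  rw [dz, h.fderiv_apply, h.fderiv_apply]
  simp
  linear_combination ((b - a) / 2) * Complex.I_sq

theorem dzbar_eq (h : HasWirtingerAt g a b z) : dzbar g z = b := by
  rw [dzbar, h.fderiv_apply, h.fderiv_apply]
  simp
  linear_combination ((a - b) / 2) * Complex.I_sq

theorem congr_of_eventuallyEq (h : HasWirtingerAt g a b z) (e : k =ᶠ[nhds z] g) :
    HasWirtingerAt k a b z :=
  HasFDerivAt.congr_of_eventuallyEq h e

theorem congr_coeff (h : HasWirtingerAt g a b z) (e₁ : a = c) (e₂ : b = d) :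
    HasWirtingerAt g c d z := e₁ ▸ e₂ ▸ h

theorem const (c z : ℂ) : HasWirtingerAt (fun _ => c) 0 0 z := by
  exact (hasFDerivAt_const (𝕜 := ℝ) c z).congr_fderiv
    (ContinuousLinearMap.ext fun v => by simp)

theorem add (h : HasWirtingerAt g a b z) (h' : HasWirtingerAt k c d z) :
    HasWirtingerAt (fun ζ => g ζ + k ζ) (a + c) (b + d) z := by
  exact (HasFDerivAt.add h h').congr_fderiv
    (ContinuousLinearMap.ext fun v => by simp; try ring)

theorem neg (h : HasWirtingerAt g a b z) : HasWirtingerAt (fun ζ => -g ζ) (-a) (-b) z := by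
  exact (HasFDerivAt.neg h).congr_fderiv
    (ContinuousLinearMap.ext fun v => by simp; try ring)

theorem sub (h : HasWirtingerAt g a b z) (h' : HasWirtingerAt k c d z) :
    HasWirtingerAt (fun ζ => g ζ - k ζ) (a - c) (b - d) z := by
  simpa [sub_eq_add_neg] using h.add h'.neg

theorem mul (h : HasWirtingerAt g a b z) (h' : HasWirtingerAt k c d z) :
    HasWirtingerAt (fun ζ => g ζ * k ζ) (a * k z + g z * c) (b * k z + g z * d) z := by
  exact (HasFDerivAt.mul h h').congr_fderiv
    (ContinuousLinearMap.ext fun v => by simp; try ring)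

theorem const_mul (h : HasWirtingerAt g a b z) (c : ℂ) :
    HasWirtingerAt (fun ζ => c * g ζ) (c * a) (c * b) z := by
  simpa using (const c z).mul h

theorem conj (h : HasWirtingerAt g a b z) :
    HasWirtingerAt (fun ζ => starRingEnd ℂ (g ζ)) (starRingEnd ℂ b) (starRingEnd ℂ a) z := by
  exact ((Complex.conjCLE : ℂ →L[ℝ] ℂ).hasFDerivAt.comp z h).congr_fderiv
    (ContinuousLinearMap.ext fun v => by simp; try ring)

theorem cexp (h : HasWirtingerAt g a b z) :
    HasWirtingerAt (fun ζ => Complex.exp (g ζ)) (Complex.exp (g z) * a)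
      (Complex.exp (g z) * b) z := by
  exact (HasFDerivAt.cexp h).congr_fderiv
    (ContinuousLinearMap.ext fun v => by simp; try ring)

theorem unique (h : HasWirtingerAt g a b z) (h' : HasWirtingerAt g c d z) : a = c ∧ b = d :=
  ⟨h.dz_eq.symm.trans h'.dz_eq, h.dzbar_eq.symm.trans h'.dzbar_eq⟩

end HasWirtingerAt

section Smooth

variable {M E : Type*} [NormedAddCommGroup M] [NormedSpace ℝ M] [NormedAddCommGroup E]
  [NormedSpace ℝ E] {Ω : Set M} {x : M} {D : Set ℂ} {g : ℂ → ℂ} {z : ℂ}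

theorem differentiableAt_of_contDiffOn {G : M → E} (hΩ : IsOpen Ω)
    (hG : ContDiffOn ℝ ∞ G Ω) (hx : x ∈ Ω) : DifferentiableAt ℝ G x :=
  (hG.contDiffAt (hΩ.mem_nhds hx)).differentiableAt (by simp)

theorem hasWirtingerAt_of_contDiffOn (hD : IsOpen D) (hg : ContDiffOn ℝ ∞ g D) (hz : z ∈ D) :
    HasWirtingerAt g (dz g z) (dzbar g z) z :=
  hasWirtingerAt_of_differentiableAt (differentiableAt_of_contDiffOn hD hg hz)

theorem contDiffOn_fderiv_apply {G : M → E} (hΩ : IsOpen Ω) (hG : ContDiffOn ℝ ∞ G Ω) (v : M) :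
    ContDiffOn ℝ ∞ (fun y => fderiv ℝ G y v) Ω :=
  (hG.fderiv_of_isOpen hΩ (by simp)).clm_apply contDiffOn_const

theorem contDiffOn_dz (hD : IsOpen D) (hg : ContDiffOn ℝ ∞ g D) : ContDiffOn ℝ ∞ (dz g) D := by
  unfold Nil3.dz
  exact ((contDiffOn_fderiv_apply hD hg 1).sub
    (contDiffOn_const.mul (contDiffOn_fderiv_apply hD hg Complex.I))).div_const 2

theorem contDiffOn_dzbar (hD : IsOpen D) (hg : ContDiffOn ℝ ∞ g D) :
    ContDiffOn ℝ ∞ (dzbar g) D := by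
  unfold Nil3.dzbar
  exact ((contDiffOn_fderiv_apply hD hg 1).add
    (contDiffOn_const.mul (contDiffOn_fderiv_apply hD hg Complex.I))).div_const 2

theorem contDiffOn_conj (hg : ContDiffOn ℝ ∞ g D) :
    ContDiffOn ℝ ∞ (fun z => starRingEnd ℂ (g z)) D :=
  (Complex.conjCLE : ℂ →L[ℝ] ℂ).contDiff.comp_contDiffOn hg

theorem contDiffOn_ofReal {r : ℂ → ℝ} (hr : ContDiffOn ℝ ∞ r D) :
    ContDiffOn ℝ ∞ (fun z => (r z : ℂ)) D :=
  Complex.ofRealCLM.contDiff.comp_contDiffOn hr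

theorem fderiv_fderiv_comm {G : M → E} (hΩ : IsOpen Ω) (hG : ContDiffOn ℝ ∞ G Ω) (hx : x ∈ Ω)
    (v v' : M) : fderiv ℝ (fun y => fderiv ℝ G y v') x v
      = fderiv ℝ (fun y => fderiv ℝ G y v) x v' := by
  have h1 : ContDiffAt ℝ ∞ G x := hG.contDiffAt (hΩ.mem_nhds hx)
  have h2 : DifferentiableAt ℝ (fderiv ℝ G) x :=
    differentiableAt_of_contDiffOn hΩ (hG.fderiv_of_isOpen hΩ (by simp)) hx
  have e : ∀ u y : M, fderiv ℝ (fun y => fderiv ℝ G y u) x y = fderiv ℝ (fderiv ℝ G) x y u := by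
    intro u y
    rw [fderiv_clm_apply h2 (differentiableAt_const _)]
    simp
  rw [e, e]
  exact (h1.isSymmSndFDerivAt (by simp; exact WithTop.coe_le_coe.2 le_top)).eq v v'

theorem dz_dzbar_comm (hD : IsOpen D) (hg : ContDiffOn ℝ ∞ g D) (hz : z ∈ D) :
    Nil3.dz (Nil3.dzbar g) z = Nil3.dzbar (Nil3.dz g) z := by
  have h1 := differentiableAt_of_contDiffOn hD (contDiffOn_fderiv_apply hD hg 1) hz
  have h2 := differentiableAt_of_contDiffOn hD (contDiffOn_fderiv_apply hD hg Complex.I) hz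
  have k1 := hasWirtingerAt_of_differentiableAt h1
  have k2 := hasWirtingerAt_of_differentiableAt h2
  have a1 := ((k1.add (k2.const_mul Complex.I)).const_mul (1 / 2)).dz_eq
  have a2 := ((k1.sub (k2.const_mul Complex.I)).const_mul (1 / 2)).dzbar_eq
  have e1 : Nil3.dzbar g = fun ζ => 1 / 2 * (fderiv ℝ g ζ 1 + Complex.I * fderiv ℝ g ζ Complex.I) := by
    ext; simp only [Nil3.dzbar]; ring
  have e2 : Nil3.dz g = fun ζ => 1 / 2 * (fderiv ℝ g ζ 1 - Complex.I * fderiv ℝ g ζ Complex.I) := by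
    ext; simp only [Nil3.dz]; ring
  rw [e1, e2, a1, a2]
  have := fderiv_fderiv_comm hD hg hz 1 Complex.I
  simp only [Nil3.dz, Nil3.dzbar]
  rw [this]
  ring

end Smooth

end Nil3

namespace Nil3

/-! ### Structure equations of a conformal immersion -/

section Structure

variable {D : Set ℂ} {f : ℂ → Nil3} {z : ℂ}

theorem hasFDerivAt_coord {E : Type*} [NormedAddCommGroup E] [NormedSpace ℝ E] {g : E → Nil3}
    {g' : E →L[ℝ] Nil3} {x : E} (h : HasFDerivAt g g' x) (k : Fin 3) :
    HasFDerivAt (fun y => g y k) ((EuclideanSpace.proj k : Nil3 →L[ℝ] ℝ).comp g') x :=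
  (EuclideanSpace.proj k : Nil3 →L[ℝ] ℝ).hasFDerivAt.comp x h

theorem fderiv_coord {g : ℂ → Nil3} (h : DifferentiableAt ℝ g z) (k : Fin 3) (v : ℂ) :
    fderiv ℝ (fun ζ => g ζ k) z v = fderiv ℝ g z v k := by
  rw [(hasFDerivAt_coord h.hasFDerivAt k).fderiv]; rfl

/-- For fixed `z` the left translation by f(z)⁻¹ is affine in the coordinates of `f ζ`, so it only
adds the commutator term to the third component. -/
theorem maurerCartan_apply (h : DifferentiableAt ℝ f z) (v : ℂ) :
    maurerCartan f z v = !₂[fderiv ℝ f z v 0, fderiv ℝ f z v 1,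
      fderiv ℝ f z v 2 + (1 / 2) * (fderiv ℝ f z v 0 * f z 1 - f z 0 * fderiv ℝ f z v 1)] := by
  have h0 := hasFDerivAt_coord h.hasFDerivAt 0
  have h1 := hasFDerivAt_coord h.hasFDerivAt 1
  have hd : DifferentiableAt ℝ (fun ζ => mul (inv (f z)) (f ζ)) z := by
    rw [differentiableAt_euclidean]
    have h2 := (hasFDerivAt_coord h.hasFDerivAt 2).differentiableAt
    have h0 := h0.differentiableAt
    have h1 := h1.differentiableAt
    intro i
    fin_cases i <;> simp [mul, inv] <;> fun_prop
  ext i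
  rw [maurerCartan, ← fderiv_coord hd]
  have h2 := hasFDerivAt_coord h.hasFDerivAt 2
  fin_cases i
  · have := h0.const_add (inv (f z) 0)
    simp only [mul]
    simpa using congrArg (fun L => L v) this.fderiv
  · have := h1.const_add (inv (f z) 1)
    simp only [mul]
    simpa using congrArg (fun L => L v) this.fderiv
  · have := (h2.const_add (inv (f z) 2)).add
      (((h1.const_mul (inv (f z) 0)).sub (h0.mul_const (inv (f z) 1))).const_mul (1 / 2))
    have e := congrArg (fun L => L v) this.fderiv
    simp only [mul]
    refine Eq.trans e ?_
    simp [inv]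
    ring

theorem contDiffOn_maurerCartan (hD : IsOpen D) (hf : ContDiffOn ℝ ∞ f D) (v : ℂ) :
    ContDiffOn ℝ ∞ (fun z => maurerCartan f z v) D := by
  have hG := contDiffOn_fderiv_apply hD hf v
  have hf' := contDiffOn_euclidean.1 hf
  have hG' := contDiffOn_euclidean.1 hG
  have : ContDiffOn ℝ ∞ (fun z => (!₂[fderiv ℝ f z v 0, fderiv ℝ f z v 1,
      fderiv ℝ f z v 2 + (1 / 2) * (fderiv ℝ f z v 0 * f z 1 - f z 0 * fderiv ℝ f z v 1)] : Nil3))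
      D := by
    rw [contDiffOn_euclidean]
    intro i
    fin_cases i
    · exact hG' 0
    · exact hG' 1
    · exact (hG' 2).add (contDiffOn_const.mul (((hG' 0).mul (hf' 1)).sub ((hf' 0).mul (hG' 1))))
  exact this.congr fun z hz => maurerCartan_apply (differentiableAt_of_contDiffOn hD hf hz) v

/-- The Maurer-Cartan equation. -/
theorem fderiv_maurerCartan_sub (hD : IsOpen D) (hf : ContDiffOn ℝ ∞ f D) (hz : z ∈ D) (v v' : ℂ) :
    fderiv ℝ (fun ζ => maurerCartan f ζ v') z v - fderiv ℝ (fun ζ => maurerCartan f ζ v) z v'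
      = -bracket (maurerCartan f z v) (maurerCartan f z v') := by
  have hfz := differentiableAt_of_contDiffOn hD hf hz
  have hG := fun u => (differentiableAt_of_contDiffOn hD (contDiffOn_fderiv_apply hD hf u)
    hz).hasFDerivAt
  have hsym := fderiv_fderiv_comm hD hf hz v v'
  have key : ∀ u x, fderiv ℝ (fun ζ => maurerCartan f ζ u) z x =
      !₂[fderiv ℝ (fun ζ => fderiv ℝ f ζ u) z x 0, fderiv ℝ (fun ζ => fderiv ℝ f ζ u) z x 1,
        fderiv ℝ (fun ζ => fderiv ℝ f ζ u) z x 2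
        + (1 / 2) * (fderiv ℝ (fun ζ => fderiv ℝ f ζ u) z x 0 * f z 1
          + fderiv ℝ f z u 0 * fderiv ℝ f z x 1
          - fderiv ℝ f z x 0 * fderiv ℝ f z u 1
          - f z 0 * fderiv ℝ (fun ζ => fderiv ℝ f ζ u) z x 1)] := by
    intro u x
    have hd := differentiableAt_of_contDiffOn hD (contDiffOn_maurerCartan hD hf u) hz
    have hev : ∀ᶠ ζ in nhds z, maurerCartan f ζ u = !₂[fderiv ℝ f ζ u 0, fderiv ℝ f ζ u 1,
      fderiv ℝ f ζ u 2 + (1 / 2) * (fderiv ℝ f ζ u 0 * f ζ 1 - f ζ 0 * fderiv ℝ f ζ u 1)] := by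
      filter_upwards [hD.mem_nhds hz] with ζ hζ
      exact maurerCartan_apply (differentiableAt_of_contDiffOn hD hf hζ) u
    have g0 := hasFDerivAt_coord (hG u) 0
    have g1 := hasFDerivAt_coord (hG u) 1
    have g2 := hasFDerivAt_coord (hG u) 2
    have f0 := hasFDerivAt_coord hfz.hasFDerivAt 0
    have f1 := hasFDerivAt_coord hfz.hasFDerivAt 1
    ext i
    rw [← fderiv_coord hd]
    fin_cases i
    · rw [Filter.EventuallyEq.fderiv_eq (f₁ := fun ζ => maurerCartan f ζ u _)
        (f := fun ζ => fderiv ℝ f ζ u 0) (by filter_upwards [hev] with ζ h; rw [h]; rfl), g0.fderiv]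
      rfl
    · rw [Filter.EventuallyEq.fderiv_eq (f₁ := fun ζ => maurerCartan f ζ u _)
        (f := fun ζ => fderiv ℝ f ζ u 1) (by filter_upwards [hev] with ζ h; rw [h]; rfl), g1.fderiv]
      rfl
    · have := g2.add (((g0.mul f1).sub (f0.mul g1)).const_mul (1 / 2))
      rw [Filter.EventuallyEq.fderiv_eq (f₁ := fun ζ => maurerCartan f ζ u _)
        (by filter_upwards [hev] with ζ h; rw [h])]
      refine Eq.trans (congrArg (fun L => L x) this.fderiv) ?_
      simp
      ring
  -- Symmetry of the second derivative removes all second order terms; the products of first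
  -- derivatives that remain form the bracket.
  rw [key, key, hsym, maurerCartan_apply hfz, maurerCartan_apply hfz]
  ext i
  fin_cases i <;> (simp [bracket]; try ring)

/-- The cross product of the left translated coordinate tangent vectors. -/
noncomputable def normalVec (f : ℂ → Nil3) (z : ℂ) : Nil3 :=
  WithLp.toLp 2 ((maurerCartan f z 1).ofLp ⨯₃ (maurerCartan f z Complex.I).ofLp)

theorem inner_nil3 (X Y : Nil3) : inner ℝ X Y = X 0 * Y 0 + X 1 * Y 1 + X 2 * Y 2 := by
  simp [PiLp.inner_apply, Fin.sum_univ_three]; ring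

theorem norm_sq_nil3 (X : Nil3) : ‖X‖ ^ 2 = X 0 ^ 2 + X 1 ^ 2 + X 2 ^ 2 := by
  rw [← real_inner_self_eq_norm_sq, inner_nil3]; ring

theorem normalVec_apply (f : ℂ → Nil3) (z : ℂ) : normalVec f z =
    !₂[maurerCartan f z 1 1 * maurerCartan f z Complex.I 2
        - maurerCartan f z 1 2 * maurerCartan f z Complex.I 1,
      maurerCartan f z 1 2 * maurerCartan f z Complex.I 0
        - maurerCartan f z 1 0 * maurerCartan f z Complex.I 2,
      maurerCartan f z 1 0 * maurerCartan f z Complex.I 1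
        - maurerCartan f z 1 1 * maurerCartan f z Complex.I 0] := by
  ext i; fin_cases i <;> simp [normalVec, crossProduct]

section Conformal

variable (hf : IsConformalImmersionOn D f)
include hf

theorem conformal_sq (hz : z ∈ D) : maurerCartan f z 1 0 ^ 2 + maurerCartan f z 1 1 ^ 2
    + maurerCartan f z 1 2 ^ 2 = maurerCartan f z Complex.I 0 ^ 2
    + maurerCartan f z Complex.I 1 ^ 2 + maurerCartan f z Complex.I 2 ^ 2 := by
  rw [← norm_sq_nil3, ← norm_sq_nil3, (hf.2 z hz).2.1]

theorem conformal_inner (hz : z ∈ D) : maurerCartan f z 1 0 * maurerCartan f z Complex.I 0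
    + maurerCartan f z 1 1 * maurerCartan f z Complex.I 1
    + maurerCartan f z 1 2 * maurerCartan f z Complex.I 2 = 0 := by
  rw [← inner_nil3, (hf.2 z hz).2.2]

theorem expU_eq (hz : z ∈ D) : expU f z = ‖maurerCartan f z 1‖ ^ 2 := by
  rw [expU, ← (hf.2 z hz).2.1]; ring

theorem expU_pos (hz : z ∈ D) : 0 < expU f z := by
  rw [expU_eq hf hz]
  have := norm_pos_iff.2 (hf.2 z hz).1
  positivity

/-- Lagrange's identity |X × Y|² = |X|²|Y|² - ⟨X, Y⟩², with conformality. -/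
theorem norm_normalVec (hz : z ∈ D) : ‖normalVec f z‖ = expU f z := by
  have h1 := conformal_sq hf hz
  have h2 := conformal_inner hf hz
  have : ‖normalVec f z‖ ^ 2 = expU f z ^ 2 := by
    rw [norm_sq_nil3, expU_eq hf hz, norm_sq_nil3, normalVec_apply]
    simp
    linear_combination (-(maurerCartan f z 1 0 ^ 2 + maurerCartan f z 1 1 ^ 2
    + maurerCartan f z 1 2 ^ 2)) * h1 - (maurerCartan f z 1 0 * maurerCartan f z Complex.I 0
    + maurerCartan f z 1 1 * maurerCartan f z Complex.I 1
    + maurerCartan f z 1 2 * maurerCartan f z Complex.I 2) * h2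
  exact (sq_eq_sq₀ (norm_nonneg _) (expU_pos hf hz).le).1 this

theorem unitNormal_eq (hz : z ∈ D) : unitNormal f z = (expU f z)⁻¹ • normalVec f z := by
  rw [← norm_normalVec hf hz]; rfl

theorem secondFundForm_eq (hz : z ∈ D) (v v' : ℂ) :
    secondFundForm f z v v' = (expU f z)⁻¹ * inner ℝ (covDeriv f z v v') (normalVec f z) := by
  rw [secondFundForm, unitNormal_eq hf hz, inner_smul_right]

end Conformal

end Structure

end Nil3

namespace Nil3

section Structure

variable {D : Set ℂ} {f : ℂ → Nil3} {z : ℂ}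

/-- The components `φ_k` of `f⁻¹ f_z`. -/
noncomputable def phi (f : ℂ → Nil3) (k : Fin 3) (z : ℂ) : ℂ :=
  ((maurerCartan f z 1 k : ℝ) - Complex.I * (maurerCartan f z Complex.I k : ℝ)) / 2

/-- The complex bilinear cross product `-2 i φ × \bar φ`, which is the complexification of
`f_x × f_y`. -/
theorem normalVec_ofReal (f : ℂ → Nil3) (z : ℂ) :
    ((normalVec f z 0 : ℝ) : ℂ) = 2 * Complex.I * (starRingEnd ℂ (phi f 1 z) * phi f 2 z
      - phi f 1 z * starRingEnd ℂ (phi f 2 z)) ∧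
    ((normalVec f z 1 : ℝ) : ℂ) = 2 * Complex.I * (starRingEnd ℂ (phi f 2 z) * phi f 0 z
      - phi f 2 z * starRingEnd ℂ (phi f 0 z)) ∧
    ((normalVec f z 2 : ℝ) : ℂ) = 2 * Complex.I * (starRingEnd ℂ (phi f 0 z) * phi f 1 z
      - phi f 0 z * starRingEnd ℂ (phi f 1 z)) := by
  have h := Complex.I_sq
  refine ⟨?_, ?_, ?_⟩ <;>
  · simp [normalVec_apply, phi]
    ring_nf
    simp [h, map_ofNat]
    ring

section

variable (hD : IsOpen D) (hf : IsConformalImmersionOn D f) (hz : z ∈ D)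
include hD hf hz

/-- The derivative of |f_x|² = |f_y|². With the derivative of ⟨f_x, f_y⟩ = 0 below, this is how
conformality enters the tangential part of the tension field. -/
theorem inner_fderiv_maurerCartan_same (v : ℂ) :
    inner ℝ (fderiv ℝ (fun ζ => maurerCartan f ζ 1) z v) (maurerCartan f z 1)
      = inner ℝ (fderiv ℝ (fun ζ => maurerCartan f ζ Complex.I) z v)
        (maurerCartan f z Complex.I) := by
  have h1 := differentiableAt_of_contDiffOn hD (contDiffOn_maurerCartan hD hf.1 1) hz
  have h2 := differentiableAt_of_contDiffOn hD (contDiffOn_maurerCartan hD hf.1 Complex.I) hz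
  have e : (fun ζ => inner ℝ (maurerCartan f ζ 1) (maurerCartan f ζ 1)) =ᶠ[nhds z]
      fun ζ => inner ℝ (maurerCartan f ζ Complex.I) (maurerCartan f ζ Complex.I) := by
    filter_upwards [hD.mem_nhds hz] with ζ hζ
    rw [real_inner_self_eq_norm_sq, real_inner_self_eq_norm_sq, (hf.2 ζ hζ).2.1]
  have e' := DFunLike.congr_fun (e.fderiv_eq (𝕜 := ℝ)) v
  simp only [fderiv_inner_apply ℝ h1 h1, fderiv_inner_apply ℝ h2 h2] at e'
  have k1 := real_inner_comm (maurerCartan f z 1) (fderiv ℝ (fun ζ => maurerCartan f ζ 1) z v)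
  have k2 := real_inner_comm (maurerCartan f z Complex.I)
    (fderiv ℝ (fun ζ => maurerCartan f ζ Complex.I) z v)
  linarith

theorem inner_fderiv_maurerCartan_cross (v : ℂ) :
    inner ℝ (fderiv ℝ (fun ζ => maurerCartan f ζ 1) z v) (maurerCartan f z Complex.I)
      + inner ℝ (fderiv ℝ (fun ζ => maurerCartan f ζ Complex.I) z v) (maurerCartan f z 1) = 0 := by
  have h1 := differentiableAt_of_contDiffOn hD (contDiffOn_maurerCartan hD hf.1 1) hz
  have h2 := differentiableAt_of_contDiffOn hD (contDiffOn_maurerCartan hD hf.1 Complex.I) hz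
  have e : (fun ζ => inner ℝ (maurerCartan f ζ 1) (maurerCartan f ζ Complex.I)) =ᶠ[nhds z]
      fun ζ => 0 := by
    filter_upwards [hD.mem_nhds hz] with ζ hζ
    exact (hf.2 ζ hζ).2.2
  have e' := DFunLike.congr_fun (e.fderiv_eq (𝕜 := ℝ)) v
  simp only [fderiv_inner_apply ℝ h1 h2] at e'
  rw [real_inner_comm] at e'
  simp at e'
  linarith

/-- The tension field of a conformal immersion is normal. -/
theorem covDeriv_add_covDeriv : covDeriv f z 1 1 + covDeriv f z Complex.I Complex.I
    = (2 * meanCurvature f z) • normalVec f z := by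
  have hr := (expU_pos hf hz).ne'
  have hH : meanCurvature f z = inner ℝ (covDeriv f z 1 1 + covDeriv f z Complex.I Complex.I)
      (normalVec f z) / (2 * expU f z ^ 2) := by
    rw [meanCurvature, secondFundForm_eq hf hz, secondFundForm_eq hf hz, inner_add_left]
    field_simp
  rw [hH, expU_eq hf hz, norm_sq_nil3]
  rw [expU_eq hf hz, norm_sq_nil3] at hr
  have c1 := conformal_sq hf hz
  have c2 := conformal_inner hf hz
  have s1 := inner_fderiv_maurerCartan_same hD hf hz 1
  have s2 := inner_fderiv_maurerCartan_same hD hf hz Complex.I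
  have t1 := inner_fderiv_maurerCartan_cross hD hf hz 1
  have t2 := inner_fderiv_maurerCartan_cross hD hf hz Complex.I
  have mc := fderiv_maurerCartan_sub hD hf.1 hz 1 Complex.I
  have m0 := congrArg (fun X : Nil3 => X 0) mc
  have m1 := congrArg (fun X : Nil3 => X 1) mc
  have m2 := congrArg (fun X : Nil3 => X 2) mc
  simp only [inner_nil3] at s1 s2 t1 t2
  simp [bracket] at m0 m1 m2
  set X := maurerCartan f z 1
  set Y := maurerCartan f z Complex.I
  set Xx := fderiv ℝ (fun ζ => maurerCartan f ζ 1) z 1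
  set Xy := fderiv ℝ (fun ζ => maurerCartan f ζ 1) z Complex.I
  set Yx := fderiv ℝ (fun ζ => maurerCartan f ζ Complex.I) z 1
  set Yy := fderiv ℝ (fun ζ => maurerCartan f ζ Complex.I) z Complex.I
  have hT : covDeriv f z 1 1 + covDeriv f z Complex.I Complex.I
      = !₂[Xx 0 + Yy 0 + X 1 * X 2 + Y 1 * Y 2, Xx 1 + Yy 1 - X 0 * X 2 - Y 0 * Y 2,
        Xx 2 + Yy 2] := by
    ext i
    fin_cases i <;> simp [covDeriv, nabla, X, Y, Xx, Yy] <;> ring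
  obtain ⟨T, hTdef⟩ : ∃ T, T = covDeriv f z 1 1 + covDeriv f z Complex.I Complex.I := ⟨_, rfl⟩
  rw [← hTdef] at hT ⊢
  have T0 : T 0 = Xx 0 + Yy 0 + X 1 * X 2 + Y 1 * Y 2 := by rw [hT]; rfl
  have T1 : T 1 = Xx 1 + Yy 1 - X 0 * X 2 - Y 0 * Y 2 := by rw [hT]; rfl
  have T2 : T 2 = Xx 2 + Yy 2 := by rw [hT]; rfl
  -- The usual cancellation: ⟨∇_x f_x, f_x⟩ = ⟨∇_x f_y, f_y⟩ by conformality, this is ⟨∇_y f_x, f_y⟩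
  -- by torsion freeness, and it equals -⟨f_x, ∇_y f_y⟩ because ⟨f_x, f_y⟩ = 0.
  have hX : T 0 * X 0 + T 1 * X 1 + T 2 * X 2 = 0 := by
    rw [T0, T1, T2]
    linear_combination s1 + t2 + Y 0 * m0 + Y 1 * m1 + Y 2 * m2
  have hY : T 0 * Y 0 + T 1 * Y 1 + T 2 * Y 2 = 0 := by
    rw [T0, T1, T2]
    linear_combination t1 - s2 - X 0 * m0 - X 1 * m1 - X 2 * m2
  have n := normalVec_apply f z
  have n0 : normalVec f z 0 = X 1 * Y 2 - X 2 * Y 1 := by rw [n]; rfl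
  have n1 : normalVec f z 1 = X 2 * Y 0 - X 0 * Y 2 := by rw [n]; rfl
  have n2 : normalVec f z 2 = X 0 * Y 1 - X 1 * Y 0 := by rw [n]; rfl
  rw [inner_nil3, n0, n1, n2]
  obtain ⟨r, hrdef⟩ : ∃ r, r = X 0 ^ 2 + X 1 ^ 2 + X 2 ^ 2 := ⟨_, rfl⟩
  rw [← hrdef] at hr ⊢
  have hr2 : r ^ 2 = (X 1 * Y 2 - X 2 * Y 1) ^ 2 + (X 2 * Y 0 - X 0 * Y 2) ^ 2
      + (X 0 * Y 1 - X 1 * Y 0) ^ 2 := by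
    rw [hrdef]
    linear_combination (X 0 ^ 2 + X 1 ^ 2 + X 2 ^ 2) * c1 + (X 0 * Y 0 + X 1 * Y 1 + X 2 * Y 2) * c2
  -- |X × Y|² T is ⟨T, X × Y⟩ X × Y plus a combination of X and Y whose coefficients are linear in
  -- ⟨T, X⟩ and ⟨T, Y⟩, which vanish.
  have gen : ∀ k, T k * r ^ 2 = (T 0 * (X 1 * Y 2 - X 2 * Y 1) + T 1 * (X 2 * Y 0 - X 0 * Y 2)
      + T 2 * (X 0 * Y 1 - X 1 * Y 0)) * normalVec f z k := by
    intro k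
    fin_cases k
    · simp only [Fin.zero_eta, n0]
      rw [hr2]
      linear_combination
        ((Y 0 ^ 2 + Y 1 ^ 2 + Y 2 ^ 2) * X 0 - (X 0 * Y 0 + X 1 * Y 1 + X 2 * Y 2) * Y 0) * hX
        + ((X 0 ^ 2 + X 1 ^ 2 + X 2 ^ 2) * Y 0 - (X 0 * Y 0 + X 1 * Y 1 + X 2 * Y 2) * X 0) * hY
    · simp only [Fin.mk_one, n1]
      rw [hr2]
      linear_combination
        ((Y 0 ^ 2 + Y 1 ^ 2 + Y 2 ^ 2) * X 1 - (X 0 * Y 0 + X 1 * Y 1 + X 2 * Y 2) * Y 1) * hX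
        + ((X 0 ^ 2 + X 1 ^ 2 + X 2 ^ 2) * Y 1 - (X 0 * Y 0 + X 1 * Y 1 + X 2 * Y 2) * X 1) * hY
    · simp only [Fin.reduceFinMk, n2]
      rw [hr2]
      linear_combination
        ((Y 0 ^ 2 + Y 1 ^ 2 + Y 2 ^ 2) * X 2 - (X 0 * Y 0 + X 1 * Y 1 + X 2 * Y 2) * Y 2) * hX
        + ((X 0 ^ 2 + X 1 ^ 2 + X 2 ^ 2) * Y 2 - (X 0 * Y 0 + X 1 * Y 1 + X 2 * Y 2) * X 2) * hY
  ext k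
  have := gen k
  simp only [PiLp.smul_apply, smul_eq_mul]
  field_simp
  linarith

theorem hasWirtingerAt_phi (k : Fin 3) : HasWirtingerAt (phi f k)
    (((fderiv ℝ (fun ζ => maurerCartan f ζ 1) z 1 k
        - fderiv ℝ (fun ζ => maurerCartan f ζ Complex.I) z Complex.I k : ℝ)
      - Complex.I * (fderiv ℝ (fun ζ => maurerCartan f ζ 1) z Complex.I k
        + fderiv ℝ (fun ζ => maurerCartan f ζ Complex.I) z 1 k : ℝ)) / 4)
    (((fderiv ℝ (fun ζ => maurerCartan f ζ 1) z 1 k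
        + fderiv ℝ (fun ζ => maurerCartan f ζ Complex.I) z Complex.I k : ℝ)
      + Complex.I * (fderiv ℝ (fun ζ => maurerCartan f ζ 1) z Complex.I k
        - fderiv ℝ (fun ζ => maurerCartan f ζ Complex.I) z 1 k : ℝ)) / 4) z := by
  have h1 := differentiableAt_of_contDiffOn hD (contDiffOn_maurerCartan hD hf.1 1) hz
  have h2 := differentiableAt_of_contDiffOn hD (contDiffOn_maurerCartan hD hf.1 Complex.I) hz
  have g : ∀ u : ℂ, DifferentiableAt ℝ (fun ζ => maurerCartan f ζ u) z →
      HasFDerivAt (fun ζ => ((maurerCartan f ζ u k : ℝ) : ℂ)) (Complex.ofRealCLM.comp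
        ((EuclideanSpace.proj k : Nil3 →L[ℝ] ℝ).comp (fderiv ℝ (fun ζ => maurerCartan f ζ u) z)))
        z := fun u hu => Complex.ofRealCLM.hasFDerivAt.comp z (hasFDerivAt_coord hu.hasFDerivAt k)
  have w1 := hasWirtingerAt_of_differentiableAt (g 1 h1).differentiableAt
  have w2 := hasWirtingerAt_of_differentiableAt (g Complex.I h2).differentiableAt
  have := (w1.sub (w2.const_mul Complex.I)).const_mul (1 / 2)
  simp only [dz, dzbar, (g 1 h1).fderiv, (g Complex.I h2).fderiv] at this
  refine (this.congr_of_eventuallyEq (Filter.Eventually.of_forall fun ζ => ?_)).congr_coeff ?_ ?_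
  · simp only [phi]; ring
  · simp
    linear_combination (fderiv ℝ (fun ζ => maurerCartan f ζ Complex.I) z Complex.I k : ℂ) / 4
      * Complex.I_sq
  · simp
    linear_combination (-(fderiv ℝ (fun ζ => maurerCartan f ζ Complex.I) z Complex.I k : ℂ) / 4)
      * Complex.I_sq

end

end Structure

end Nil3

/-! ### The structure equations in complex components. -/

namespace Nil3

section Spinor

variable {D : Set ℂ} {f : ℂ → Nil3} {z : ℂ}

theorem maurerCartan_one_ofReal (f : ℂ → Nil3) (z : ℂ) (k : Fin 3) :
    ((maurerCartan f z 1 k : ℝ) : ℂ) = phi f k z + starRingEnd ℂ (phi f k z) := by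
  simp [phi, map_ofNat]; ring

theorem maurerCartan_I_ofReal (f : ℂ → Nil3) (z : ℂ) (k : Fin 3) :
    ((maurerCartan f z Complex.I k : ℝ) : ℂ)
      = Complex.I * (phi f k z - starRingEnd ℂ (phi f k z)) := by
  simp [phi, map_ofNat]
  linear_combination (maurerCartan f z Complex.I k : ℂ) * Complex.I_sq

section

variable (hf : IsConformalImmersionOn D f) (hz : z ∈ D)
include hf hz

theorem phi_sq_sum : phi f 0 z ^ 2 + phi f 1 z ^ 2 + phi f 2 z ^ 2 = 0 := by
  have c1 := congrArg ((↑) : ℝ → ℂ) (conformal_sq hf hz)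
  have c2 := congrArg ((↑) : ℝ → ℂ) (conformal_inner hf hz)
  push_cast at c1 c2
  simp only [phi]
  linear_combination (1 / 4) * c1 - (1 / 2) * Complex.I * c2
    + (1 / 4) * ((maurerCartan f z Complex.I 0 : ℂ) ^ 2 + (maurerCartan f z Complex.I 1 : ℂ) ^ 2
      + (maurerCartan f z Complex.I 2 : ℂ) ^ 2) * Complex.I_sq

theorem expU_ofReal : (expU f z : ℂ) = 2 * (phi f 0 z * starRingEnd ℂ (phi f 0 z)
    + phi f 1 z * starRingEnd ℂ (phi f 1 z) + phi f 2 z * starRingEnd ℂ (phi f 2 z)) := by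
  have c1 := congrArg ((↑) : ℝ → ℂ) (conformal_sq hf hz)
  have c3 := congrArg ((↑) : ℝ → ℂ) ((expU_eq hf hz).trans (norm_sq_nil3 _))
  push_cast at c1 c3
  rw [c3]
  simp only [phi, map_sub, map_mul, map_div₀, Complex.conj_ofReal, Complex.conj_I, map_ofNat]
  linear_combination (1 / 2) * c1
    + (1 / 2) * ((maurerCartan f z Complex.I 0 : ℂ) ^ 2 + (maurerCartan f z Complex.I 1 : ℂ) ^ 2
      + (maurerCartan f z Complex.I 2 : ℂ) ^ 2) * Complex.I_sq

theorem expHalfU_pos : 0 < expHalfU f z := Real.sqrt_pos.2 (expU_pos hf hz)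

theorem expHalfU_sq : expHalfU f z ^ 2 = expU f z := Real.sq_sqrt (expU_pos hf hz).le

theorem support_mul_expHalfU : support f z * expHalfU f z = normalVec f z 2 := by
  have := (expU_pos hf hz).ne'
  rw [support, unitNormal_eq hf hz]
  simp only [PiLp.smul_apply, smul_eq_mul]
  rw [mul_right_comm, ← sq, expHalfU_sq hf hz]
  field_simp

variable (hD : IsOpen D)
include hD

/-- 4φ_{\bar z} is the sum of (f_x)_x + (f_y)_y, known from the tension field once the connection
terms are moved across, and of i((f_x)_y - (f_y)_x), known from the Maurer-Cartan equation. -/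
theorem dzbar_phi : 
    dzbar (phi f 0) z = (meanCurvature f z : ℂ) * Complex.I * (starRingEnd ℂ (phi f 1 z) * phi f 2 z
        - phi f 1 z * starRingEnd ℂ (phi f 2 z))
      - (1 / 2) * (phi f 1 z * starRingEnd ℂ (phi f 2 z) + starRingEnd ℂ (phi f 1 z) * phi f 2 z) ∧
    dzbar (phi f 1) z = (meanCurvature f z : ℂ) * Complex.I * (starRingEnd ℂ (phi f 2 z) * phi f 0 z
        - phi f 2 z * starRingEnd ℂ (phi f 0 z))
      + (1 / 2) * (phi f 0 z * starRingEnd ℂ (phi f 2 z) + starRingEnd ℂ (phi f 0 z) * phi f 2 z) ∧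
    dzbar (phi f 2) z = ((meanCurvature f z : ℂ) + Complex.I / 2) * Complex.I
      * (starRingEnd ℂ (phi f 0 z) * phi f 1 z - phi f 0 z * starRingEnd ℂ (phi f 1 z)) := by
  obtain ⟨n0, n1, n2⟩ := normalVec_ofReal f z
  have T := covDeriv_add_covDeriv hD hf hz
  have T0 := congrArg ((↑) : ℝ → ℂ) (congrArg (fun X : Nil3 => X 0) T)
  have T1 := congrArg ((↑) : ℝ → ℂ) (congrArg (fun X : Nil3 => X 1) T)
  have T2 := congrArg ((↑) : ℝ → ℂ) (congrArg (fun X : Nil3 => X 2) T)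
  have mc := fderiv_maurerCartan_sub hD hf.1 hz 1 Complex.I
  have m0 := congrArg ((↑) : ℝ → ℂ) (congrArg (fun X : Nil3 => X 0) mc)
  have m1 := congrArg ((↑) : ℝ → ℂ) (congrArg (fun X : Nil3 => X 1) mc)
  have m2 := congrArg ((↑) : ℝ → ℂ) (congrArg (fun X : Nil3 => X 2) mc)
  simp [bracket] at m0 m1 m2
  simp [covDeriv, nabla, n0, n1, n2] at T0 T1 T2
  rw [(hasWirtingerAt_phi hD hf hz 0).dzbar_eq, (hasWirtingerAt_phi hD hf hz 1).dzbar_eq,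
    (hasWirtingerAt_phi hD hf hz 2).dzbar_eq]
  simp only [maurerCartan_one_ofReal, maurerCartan_I_ofReal] at m0 m1 m2 T0 T1 T2
  push_cast
  have hI := Complex.I_sq
  have hI3 : Complex.I ^ 3 = -Complex.I := by rw [pow_succ, hI]; ring
  refine ⟨?_, ?_, ?_⟩
  · linear_combination (1 / 4) * T0 - (Complex.I / 4) * m0 - (1 / 4) * (phi f 1 z - starRingEnd ℂ (phi f 1 z)) * (phi f 2 z - starRingEnd ℂ (phi f 2 z)) * hI
  · linear_combination (1 / 4) * T1 - (Complex.I / 4) * m1 + (1 / 4) * (phi f 0 z - starRingEnd ℂ (phi f 0 z)) * (phi f 2 z - starRingEnd ℂ (phi f 2 z)) * hI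
  · linear_combination (1 / 4) * T2 - (Complex.I / 4) * m2

/-- e^u N is the cross product of f_x and f_y, so the factor e^u clears the normalization of N. The
terms quadratic in φ come from `nabla`. -/
theorem expU_mul_hopf : (expU f z : ℂ) * hopf f z =
    (dz (phi f 0) z + phi f 1 z * phi f 2 z) * (2 * Complex.I * (starRingEnd ℂ (phi f 1 z) * phi f 2 z
        - phi f 1 z * starRingEnd ℂ (phi f 2 z)))
    + (dz (phi f 1) z - phi f 0 z * phi f 2 z) * (2 * Complex.I * (starRingEnd ℂ (phi f 2 z) * phi f 0 z
        - phi f 2 z * starRingEnd ℂ (phi f 0 z)))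
    + dz (phi f 2) z * (2 * Complex.I * (starRingEnd ℂ (phi f 0 z) * phi f 1 z
        - phi f 0 z * starRingEnd ℂ (phi f 1 z))) := by
  obtain ⟨n0, n1, n2⟩ := normalVec_ofReal f z
  have hr : (expU f z : ℂ) ≠ 0 := Complex.ofReal_ne_zero.2 (expU_pos hf hz).ne'
  rw [(hasWirtingerAt_phi hD hf hz 0).dz_eq, (hasWirtingerAt_phi hD hf hz 1).dz_eq,
    (hasWirtingerAt_phi hD hf hz 2).dz_eq, ← n0, ← n1, ← n2, hopf]
  simp only [secondFundForm_eq hf hz, inner_nil3]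
  push_cast
  simp [covDeriv, nabla]
  field_simp
  simp only [phi]
  linear_combination 2 * ((maurerCartan f z Complex.I 0 : ℂ) * maurerCartan f z Complex.I 2
    * normalVec f z 1 - (maurerCartan f z Complex.I 1 : ℂ) * maurerCartan f z Complex.I 2
    * normalVec f z 0) * Complex.I_sq

end

end Spinor

end Nil3

/-! ### Generating spinors and the nonlinear Dirac equation. -/

namespace Nil3

/-- Generating spinors of `f` on `U`: smooth functions `s = ψ₁`, `t = \bar ψ₂` that parametrize the
null vector `(φ₁, φ₂, φ₃)`. -/
structure IsSpinorOn (U : Set ℂ) (f : ℂ → Nil3) (s t : ℂ → ℂ) : Prop where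
  smooth_fst : ContDiffOn ℝ ∞ s U
  smooth_snd : ContDiffOn ℝ ∞ t U
  phi_zero : ∀ z ∈ U, phi f 0 z = t z ^ 2 - s z ^ 2
  phi_one : ∀ z ∈ U, phi f 1 z = Complex.I * (t z ^ 2 + s z ^ 2)
  phi_two : ∀ z ∈ U, phi f 2 z = 2 * s z * t z

namespace IsSpinorOn

variable {D U : Set ℂ} {f : ℂ → Nil3} {s t : ℂ → ℂ} {z : ℂ}
  (h : IsSpinorOn U f s t) (hU : IsOpen U) (hf : IsConformalImmersionOn U f) (hz : z ∈ U)
include h hf hz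

/-- Both sides are nonnegative reals with the same square: 2 Σ|φ_k|² = 4(|s|² + |t|²)². -/
theorem expHalfU_eq : (expHalfU f z : ℂ)
    = 2 * (s z * starRingEnd ℂ (s z) + t z * starRingEnd ℂ (t z)) := by
  have e : expHalfU f z = 2 * (Complex.normSq (s z) + Complex.normSq (t z)) := by
    have h1 := expHalfU_sq hf hz
    have h2 := expU_ofReal hf hz
    have h3 : expHalfU f z ^ 2 = (2 * (Complex.normSq (s z) + Complex.normSq (t z))) ^ 2 := by
      rw [h1, ← Complex.ofReal_inj, h2, h.phi_zero z hz, h.phi_one z hz, h.phi_two z hz]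
      push_cast
      rw [← Complex.mul_conj, ← Complex.mul_conj]
      simp only [map_sub, map_add, map_mul, map_pow, Complex.conj_I, map_ofNat]
      linear_combination (-2 * (t z ^ 2 + s z ^ 2)
        * (starRingEnd ℂ (t z) ^ 2 + starRingEnd ℂ (s z) ^ 2)) * Complex.I_sq
    have h4 := Complex.normSq_nonneg (s z)
    have h5 := Complex.normSq_nonneg (t z)
    exact (sq_eq_sq₀ (expHalfU_pos hf hz).le (by positivity)).1 h3
  rw [e]
  push_cast
  rw [← Complex.mul_conj, ← Complex.mul_conj]

theorem density_ne_zero : s z * starRingEnd ℂ (s z) + t z * starRingEnd ℂ (t z) ≠ 0 := by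
  have h1 := h.expHalfU_eq hf hz
  intro h0
  rw [h0, mul_zero, Complex.ofReal_eq_zero] at h1
  exact (expHalfU_pos hf hz).ne' h1

theorem ne_zero_or_ne_zero : s z ≠ 0 ∨ t z ≠ 0 := by
  by_contra! hc
  exact h.density_ne_zero hf hz (by simp [hc.1, hc.2])

theorem support_eq : (support f z : ℂ)
    = 2 * (s z * starRingEnd ℂ (s z) - t z * starRingEnd ℂ (t z)) := by
  have h1 := congrArg ((↑) : ℝ → ℂ) (support_mul_expHalfU hf hz)
  have h2 := (normalVec_ofReal f z).2.2
  rw [h2] at h1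
  push_cast at h1
  rw [h.expHalfU_eq hf hz, h.phi_zero z hz, h.phi_one z hz] at h1
  simp only [map_sub, map_add, map_mul, map_pow, Complex.conj_I] at h1
  refine mul_right_cancel₀ (mul_ne_zero two_ne_zero (h.density_ne_zero hf hz)) ?_
  rw [h1]
  linear_combination (2 * (t z ^ 2 + s z ^ 2) * (starRingEnd ℂ (t z) ^ 2 - starRingEnd ℂ (s z) ^ 2)
    + 2 * (starRingEnd ℂ (t z) ^ 2 + starRingEnd ℂ (s z) ^ 2) * (t z ^ 2 - s z ^ 2)) * Complex.I_sq

theorem diracPotential_eq : diracPotential f z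
    = -(meanCurvature f z : ℂ) * (s z * starRingEnd ℂ (s z) + t z * starRingEnd ℂ (t z))
      + Complex.I / 2 * (s z * starRingEnd ℂ (s z) - t z * starRingEnd ℂ (t z)) := by
  rw [diracPotential, h.expHalfU_eq hf hz, h.support_eq hf hz]
  ring

include hU

omit hf in
theorem hasWirtingerAt_fst : HasWirtingerAt s (dz s z) (dzbar s z) z :=
  hasWirtingerAt_of_contDiffOn hU h.smooth_fst hz

omit hf in
theorem hasWirtingerAt_snd : HasWirtingerAt t (dz t z) (dzbar t z) z :=
  hasWirtingerAt_of_contDiffOn hU h.smooth_snd hz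

omit hf in
theorem hasWirtingerAt_phi_zero : HasWirtingerAt (phi f 0)
    (2 * t z * dz t z - 2 * s z * dz s z) (2 * t z * dzbar t z - 2 * s z * dzbar s z) z := by
  have a := h.hasWirtingerAt_fst hU hz
  have b := h.hasWirtingerAt_snd hU hz
  refine (((b.mul b).sub (a.mul a)).congr_of_eventuallyEq ?_).congr_coeff (by ring) (by ring)
  filter_upwards [hU.mem_nhds hz] with ζ hζ
  rw [h.phi_zero ζ hζ]; ring

omit hf in
theorem hasWirtingerAt_phi_one : HasWirtingerAt (phi f 1)
    (Complex.I * (2 * t z * dz t z + 2 * s z * dz s z))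
    (Complex.I * (2 * t z * dzbar t z + 2 * s z * dzbar s z)) z := by
  have a := h.hasWirtingerAt_fst hU hz
  have b := h.hasWirtingerAt_snd hU hz
  refine ((((b.mul b).add (a.mul a)).const_mul Complex.I).congr_of_eventuallyEq ?_).congr_coeff
    (by ring) (by ring)
  filter_upwards [hU.mem_nhds hz] with ζ hζ
  rw [h.phi_one ζ hζ]; ring

omit hf in
theorem hasWirtingerAt_phi_two : HasWirtingerAt (phi f 2)
    (2 * (dz s z * t z + s z * dz t z)) (2 * (dzbar s z * t z + s z * dzbar t z)) z := by
  have a := h.hasWirtingerAt_fst hU hz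
  have b := h.hasWirtingerAt_snd hU hz
  refine (((a.mul b).const_mul 2).congr_of_eventuallyEq ?_).congr_coeff (by ring) (by ring)
  filter_upwards [hU.mem_nhds hz] with ζ hζ
  rw [h.phi_two ζ hζ]; ring

/-- The nonlinear Dirac equation. -/
theorem dirac : dzbar s z = diracPotential f z * starRingEnd ℂ (t z) ∧
    dzbar t z = -starRingEnd ℂ (diracPotential f z) * starRingEnd ℂ (s z) := by
  obtain ⟨d0, d1, d2⟩ := dzbar_phi hf hz hU
  rw [(h.hasWirtingerAt_phi_zero hU hz).dzbar_eq] at d0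
  rw [(h.hasWirtingerAt_phi_one hU hz).dzbar_eq] at d1
  rw [(h.hasWirtingerAt_phi_two hU hz).dzbar_eq] at d2
  simp only [h.phi_zero z hz, h.phi_one z hz, h.phi_two z hz] at d0 d1 d2
  have hE := h.diracPotential_eq hf hz
  have hE' := congrArg (starRingEnd ℂ) hE
  simp only [map_sub, map_add, map_mul, map_pow, map_neg, map_div₀, Complex.conj_I, map_ofNat,
    Complex.conj_conj, Complex.conj_ofReal] at d0 d1 d2 hE'
  rw [hE', hE]
  have hI := Complex.I_sq
  have hI3 : Complex.I ^ 3 = -Complex.I := by rw [pow_succ, hI]; ring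
  have hne := h.ne_zero_or_ne_zero hf hz
  clear hE hE'
  generalize starRingEnd ℂ (s z) = a at d0 d1 d2 ⊢
  generalize starRingEnd ℂ (t z) = b at d0 d1 d2 ⊢
  generalize (meanCurvature f z : ℂ) = H at d0 d1 d2 ⊢
  generalize s z = S at *
  generalize t z = T at *
  generalize dzbar s z = P at *
  generalize dzbar t z = Q at *
  -- `e₁` and `e₂` are the defects of the two Dirac equations. The three formulas for φ_{\bar z}
  -- become S e₁ = 0, T e₂ = 0 and T e₁ + S e₂ = 0, and S, T are not both zero.
  set e₁ := P - (-H * (S * a + T * b) + Complex.I / 2 * (S * a - T * b)) * b with he₁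
  set e₂ := Q - -(-H * (a * S + b * T) + -Complex.I / 2 * (a * S - b * T)) * a with he₂
  have r1 : S * e₁ = 0 := by
    rw [he₁]
    linear_combination (norm := (ring_nf; simp only [hI]; ring)) (-1 / 4) * d0 - (Complex.I / 4) * d1
  have r2 : T * e₂ = 0 := by
    rw [he₂]
    linear_combination (norm := (ring_nf; simp only [hI]; ring)) (1 / 4) * d0 - (Complex.I / 4) * d1
  have r3 : T * e₁ + S * e₂ = 0 := by
    rw [he₁, he₂]
    linear_combination (norm := (ring_nf; simp only [hI, hI3]; ring)) (1 / 2) * d2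
  have : e₁ = 0 ∧ e₂ = 0 := by
    rcases hne with hS | hT
    · have h1 := (mul_eq_zero.1 r1).resolve_left hS
      rw [h1, mul_zero, zero_add] at r3
      exact ⟨h1, (mul_eq_zero.1 r3).resolve_left hS⟩
    · have h1 := (mul_eq_zero.1 r2).resolve_left hT
      rw [h1, mul_zero, add_zero] at r3
      exact ⟨(mul_eq_zero.1 r3).resolve_left hT, h1⟩
  exact ⟨sub_eq_zero.1 this.1, sub_eq_zero.1 this.2⟩

/-- In spinors the right side of `expU_mul_hopf` is divisible by e^u = 4(|s|² + |t|²)², and this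
factor is cancelled. -/
theorem hopf_eq : hopf f z = 2 * (s z * dz t z - t z * dz s z)
    + 4 * Complex.I * s z ^ 2 * t z ^ 2 := by
  have key := expU_mul_hopf hf hz hU
  have hr : (expU f z : ℂ) = 4 * (s z * starRingEnd ℂ (s z) + t z * starRingEnd ℂ (t z)) ^ 2 := by
    rw [← expHalfU_sq hf hz]; push_cast; rw [h.expHalfU_eq hf hz]; ring
  have hne := h.density_ne_zero hf hz
  rw [(h.hasWirtingerAt_phi_zero hU hz).dz_eq, (h.hasWirtingerAt_phi_one hU hz).dz_eq,
    (h.hasWirtingerAt_phi_two hU hz).dz_eq, h.phi_zero z hz, h.phi_one z hz, h.phi_two z hz,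
    hr] at key
  simp only [map_sub, map_add, map_mul, map_pow, Complex.conj_I, map_ofNat] at key
  refine mul_left_cancel₀ (mul_ne_zero (by norm_num : (4 : ℂ) ≠ 0) (pow_ne_zero 2 hne)) (key.trans ?_)
  generalize starRingEnd ℂ (s z) = a
  generalize starRingEnd ℂ (t z) = b
  generalize s z = S
  generalize t z = T
  generalize dz s z = P
  generalize dz t z = Q
  have hI := Complex.I_sq
  have hI3 : Complex.I ^ 3 = -Complex.I := by rw [pow_succ, hI]; ring
  ring_nf
  simp only [hI, hI3]
  ring

end IsSpinorOn

end Nil3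

/-! ### Local existence of spinors, and their derivatives for constant mean curvature. -/

namespace Nil3

section LocalSpinor

variable {D : Set ℂ} {f : ℂ → Nil3} {z₀ : ℂ}

theorem contDiffOn_div {U : Set ℂ} {g k : ℂ → ℂ} (hg : ContDiffOn ℝ ∞ g U)
    (hk : ContDiffOn ℝ ∞ k U) (h0 : ∀ z ∈ U, k z ≠ 0) :
    ContDiffOn ℝ ∞ (fun z => g z / k z) U := by
  simp only [div_eq_mul_inv]
  exact hg.mul (hk.inv h0)

/-- Division by `g z₀` moves the value to 1, where the principal logarithm is smooth; a root `c` of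
`g z₀` restores the scale. -/
theorem exists_local_sqrt {g : ℂ → ℂ} (hD : IsOpen D) (hg : ContDiffOn ℝ ∞ g D) (hz : z₀ ∈ D)
    (h0 : g z₀ ≠ 0) : ∃ r > 0, Metric.ball z₀ r ⊆ D ∧ ∃ s : ℂ → ℂ,
      ContDiffOn ℝ ∞ s (Metric.ball z₀ r) ∧ ∀ z ∈ Metric.ball z₀ r, s z ≠ 0 ∧ s z ^ 2 = g z := by
  obtain ⟨c, hc⟩ := IsAlgClosed.exists_pow_nat_eq (g z₀) (n := 2) (by norm_num)
  have hcont : ContinuousAt (fun z => g z / g z₀) z₀ :=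
    ((hg.contDiffAt (hD.mem_nhds hz)).continuousAt).div_const _
  have hev : ∀ᶠ z in nhds z₀, g z / g z₀ ∈ Complex.slitPlane := by
    refine hcont.eventually (Complex.isOpen_slitPlane.mem_nhds ?_)
    simp only [div_self h0]
    exact Complex.one_mem_slitPlane
  obtain ⟨r, hr, hball⟩ := Metric.eventually_nhds_iff_ball.1 (hev.and (hD.mem_nhds hz))
  have hc0 : c ≠ 0 := by rintro rfl; exact h0 (by rw [← hc]; simp)
  refine ⟨r, hr, fun z hz => (hball z hz).2,
    fun z => c * Complex.exp (Complex.log (g z / g z₀) / 2), ?_, fun z hz => ⟨?_, ?_⟩⟩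
  · intro z hz
    have h1 : ContDiffAt ℝ ∞ g z := hg.contDiffAt (hD.mem_nhds (hball z hz).2)
    have h2 : ContDiffAt ℝ ∞ (fun z => Complex.log (g z / g z₀)) z :=
      ContDiffAt.comp (g := Complex.log) z
        ((Complex.contDiffAt_log (n := ∞) (hball z hz).1).restrict_scalars ℝ) (h1.div_const _)
    exact (contDiffAt_const.mul (h2.div_const 2).cexp).contDiffWithinAt
  · exact mul_ne_zero hc0 (Complex.exp_ne_zero _)
  · rw [mul_pow, ← Complex.exp_nat_mul, hc]
    have : ((2 : ℕ) : ℂ) * (Complex.log (g z / g z₀) / 2) = Complex.log (g z / g z₀) := by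
      push_cast; ring
    rw [this, Complex.exp_log (Complex.slitPlane_ne_zero (hball z hz).1)]
    field_simp

theorem contDiffOn_phi (hD : IsOpen D) (hf : ContDiffOn ℝ ∞ f D) (k : Fin 3) :
    ContDiffOn ℝ ∞ (phi f k) D :=
  ((contDiffOn_ofReal (contDiffOn_euclidean.1 (contDiffOn_maurerCartan hD hf 1) k)).sub
    (contDiffOn_const.mul (contDiffOn_ofReal
      (contDiffOn_euclidean.1 (contDiffOn_maurerCartan hD hf Complex.I) k)))).div_const 2

/-- The spinors must satisfy s² = -(φ₀ + iφ₁)/2 and t² = (φ₀ - iφ₁)/2. These cannot both vanish, for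
then φ = 0 by nullity and f would not be immersed. The nonzero one gets a smooth root, and the other
spinor is φ₂ divided by twice that root; its square is right because φ is null. -/
theorem exists_local_spinor (hD : IsOpen D) (hf : IsConformalImmersionOn D f) (hz : z₀ ∈ D) :
    ∃ r > 0, Metric.ball z₀ r ⊆ D ∧ ∃ s t : ℂ → ℂ, IsSpinorOn (Metric.ball z₀ r) f s t := by
  have hp := contDiffOn_phi hD hf.1
  have hI := Complex.I_sq
  have hsum := fun z hz => phi_sq_sum (z := z) hf hz
  have hS : ContDiffOn ℝ ∞ (fun z => -(phi f 0 z + Complex.I * phi f 1 z) / 2) D :=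
    ((hp 0).add (contDiffOn_const.mul (hp 1))).neg.div_const 2
  have hT : ContDiffOn ℝ ∞ (fun z => (phi f 0 z - Complex.I * phi f 1 z) / 2) D :=
    ((hp 0).sub (contDiffOn_const.mul (hp 1))).div_const 2
  by_cases h0 : -(phi f 0 z₀ + Complex.I * phi f 1 z₀) / 2 = 0
  · by_cases h1 : (phi f 0 z₀ - Complex.I * phi f 1 z₀) / 2 = 0
    · exfalso
      have e0 : phi f 0 z₀ = 0 := by linear_combination h1 - h0
      have e1 : phi f 1 z₀ = 0 := by
        linear_combination Complex.I * (h1 + h0) + phi f 1 z₀ * hI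
      have e2 : phi f 2 z₀ = 0 := by
        have := hsum z₀ hz
        rw [e0, e1] at this
        simpa using this
      have := expU_ofReal hf hz
      rw [e0, e1, e2] at this
      simp at this
      exact (expU_pos hf hz).ne' this
    · obtain ⟨r, hr, hsub, t, ht, hts⟩ := exists_local_sqrt hD hT hz h1
      refine ⟨r, hr, hsub, fun z => phi f 2 z / (2 * t z), t, ?_, ht, ?_, ?_, ?_⟩
      · exact contDiffOn_div ((hp 2).mono hsub) (contDiffOn_const.mul ht)
          fun z hz => mul_ne_zero two_ne_zero (hts z hz).1
      all_goals
        intro z hz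
        obtain ⟨ht0, ht2⟩ := hts z hz
        have hs := hsum z (hsub hz)
        have e : (phi f 2 z / (2 * t z)) ^ 2 = -(phi f 0 z + Complex.I * phi f 1 z) / 2 := by
          field_simp
          linear_combination hs + 2 * (phi f 0 z + Complex.I * phi f 1 z) * ht2
            - (phi f 1 z) ^ 2 * hI
      · rw [e, ht2]; ring
      · rw [e, ht2]; linear_combination (phi f 1 z) * hI
      · field_simp
  · obtain ⟨r, hr, hsub, t, ht, hts⟩ := exists_local_sqrt hD hS hz h0
    refine ⟨r, hr, hsub, t, fun z => phi f 2 z / (2 * t z), ht, ?_, ?_, ?_, ?_⟩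
    · exact contDiffOn_div ((hp 2).mono hsub) (contDiffOn_const.mul ht)
        fun z hz => mul_ne_zero two_ne_zero (hts z hz).1
    all_goals
      intro z hz
      obtain ⟨ht0, ht2⟩ := hts z hz
      have hs := hsum z (hsub hz)
      have e : (phi f 2 z / (2 * t z)) ^ 2 = (phi f 0 z - Complex.I * phi f 1 z) / 2 := by
        field_simp
        linear_combination hs - 2 * (phi f 0 z - Complex.I * phi f 1 z) * ht2
          - (phi f 1 z) ^ 2 * hI
    · rw [e, ht2]; ring
    · rw [e, ht2]; linear_combination (phi f 1 z) * hI
    · field_simp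

end LocalSpinor

theorem hasWirtingerAt_exp {U : Set ℂ} {w : ℂ → ℂ} {z : ℂ} (hU : IsOpen U)
    (hw : ContDiffOn ℝ ∞ w U) (hz : z ∈ U) : HasWirtingerAt (fun z => Complex.exp (w z / 2))
    (Complex.exp (w z / 2) * (dz w z / 2)) (Complex.exp (w z / 2) * (dzbar w z / 2)) z := by
  have := ((hasWirtingerAt_of_contDiffOn hU hw hz).const_mul (1 / 2)).cexp
  refine (this.congr_of_eventuallyEq (Filter.Eventually.of_forall fun ζ => ?_)).congr_coeff ?_ ?_
  · simp only; congr 1; ring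
  · rw [show w z / 2 = 1 / 2 * w z by ring]; ring
  · rw [show w z / 2 = 1 / 2 * w z by ring]; ring

/-- The imaginary part of 2H + i is 1, so the quotient in the definition of B clears. -/
theorem abreschRosenberg_eq (f : ℂ → Nil3) (z : ℂ) : abreschRosenberg f z
    = ((2 * (meanCurvature f z : ℂ) + Complex.I) * hopf f z + phi f 2 z ^ 2) / 4 := by
  have : (2 * (meanCurvature f z : ℂ) + Complex.I) ≠ 0 := by
    intro h
    simpa using congrArg Complex.im h
  rw [abreschRosenberg]
  change _ * (_ + phi f 2 z ^ 2 / _) = _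
  field_simp

namespace IsSpinorOn

variable {U : Set ℂ} {f : ℂ → Nil3} {s t w : ℂ → ℂ} {z : ℂ} {c : ℝ}
  (h : IsSpinorOn U f s t) (hU : IsOpen U) (hf : IsConformalImmersionOn U f)
  (hw : ContDiffOn ℝ ∞ w U) (hwf : ∀ z ∈ U, Complex.exp (w z / 2) = diracPotential f z)
  (hc : ∀ z ∈ U, meanCurvature f z = c)
include h hU hf hw hwf hc

omit hw hwf in
theorem abreschRosenberg_eq (hz : z ∈ U) : abreschRosenberg f z
    = ((2 * c + Complex.I) * (2 * (s z * dz t z - t z * dz s z)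
      + 4 * Complex.I * s z ^ 2 * t z ^ 2) + (2 * s z * t z) ^ 2) / 4 := by
  rw [Nil3.abreschRosenberg_eq, h.hopf_eq hU hf hz, h.phi_two z hz, hc z hz]

omit hU hw in
theorem exp_eq (hz : z ∈ U) : Complex.exp (w z / 2)
    = -(c : ℂ) * (s z * starRingEnd ℂ (s z) + t z * starRingEnd ℂ (t z))
      + Complex.I / 2 * (s z * starRingEnd ℂ (s z) - t z * starRingEnd ℂ (t z)) := by
  rw [hwf z hz, h.diracPotential_eq hf hz, hc z hz]

omit hw hc in
theorem dirac_exp (hz : z ∈ U) :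
    dzbar s z = Complex.exp (w z / 2) * starRingEnd ℂ (t z) ∧
    dzbar t z = -starRingEnd ℂ (Complex.exp (w z / 2)) * starRingEnd ℂ (s z) := by
  rw [hwf z hz]
  exact h.dirac hU hf hz

theorem dz_exp (hz : z ∈ U) :
    Complex.exp (w z / 2) * (dz w z / 2)
      = (-(c : ℂ) + Complex.I / 2) * (dz s z * starRingEnd ℂ (s z)
          + s z * starRingEnd ℂ (dzbar s z))
        + (-(c : ℂ) - Complex.I / 2) * (dz t z * starRingEnd ℂ (t z)
          + t z * starRingEnd ℂ (dzbar t z)) ∧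
    Complex.exp (w z / 2) * (dzbar w z / 2)
      = (-(c : ℂ) + Complex.I / 2) * (dzbar s z * starRingEnd ℂ (s z)
          + s z * starRingEnd ℂ (dz s z))
        + (-(c : ℂ) - Complex.I / 2) * (dzbar t z * starRingEnd ℂ (t z)
          + t z * starRingEnd ℂ (dz t z)) := by
  have hs := h.hasWirtingerAt_fst hU hz
  have ht := h.hasWirtingerAt_snd hU hz
  have k := ((hs.mul hs.conj).const_mul (-(c : ℂ) + Complex.I / 2)).add
    ((ht.mul ht.conj).const_mul (-(c : ℂ) - Complex.I / 2))
  refine (hasWirtingerAt_exp hU hw hz).unique (k.congr_of_eventuallyEq ?_)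
  filter_upwards [hU.mem_nhds hz] with ζ hζ
  rw [h.exp_eq hf hwf hc hζ]
  ring

/-- The equations for the derivatives of the spinors that the Dirac equation does not give. -/
theorem exp_mul_dz (hz : z ∈ U) :
    Complex.exp (w z / 2) * dz s z = Complex.exp (w z / 2) * (dz w z / 2) * s z
      + abreschRosenberg f z * starRingEnd ℂ (t z) ∧
    Complex.exp (w z / 2) * starRingEnd ℂ (dz t z)
      = -starRingEnd ℂ (abreschRosenberg f z) * s z
        + Complex.exp (w z / 2) * (dzbar w z / 2) * starRingEnd ℂ (t z) := by
  obtain ⟨e1, e2⟩ := h.dz_exp hU hf hw hwf hc hz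
  obtain ⟨d1, d2⟩ := h.dirac_exp hU hf hwf hz
  have hE := h.exp_eq hf hwf hc hz
  have hE' := congrArg (starRingEnd ℂ) hE
  have hB := h.abreschRosenberg_eq hU hf hc hz
  have hB' := congrArg (starRingEnd ℂ) hB
  rw [e1, e2, d1, d2, hB']
  rw [hB]
  simp only [map_sub, map_add, map_mul, map_pow, map_neg, map_div₀, Complex.conj_I, map_ofNat,
    Complex.conj_conj, Complex.conj_ofReal] at hE' ⊢
  rw [hE', hE]
  clear e1 e2 d1 d2 hE hE' hB hB'
  -- With the Dirac equation substituted, both claims are polynomial identities in s, t, their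
  -- z-derivatives and the conjugates, treated from here on as independent variables.
  generalize starRingEnd ℂ (s z) = a
  generalize starRingEnd ℂ (t z) = b
  generalize starRingEnd ℂ (dz s z) = P'
  generalize starRingEnd ℂ (dz t z) = Q'
  generalize s z = S
  generalize t z = T
  generalize dz s z = P
  generalize dz t z = Q
  generalize (c : ℂ) = H
  have hI := Complex.I_sq
  constructor
  · ring_nf; simp only [hI]; ring
  · ring_nf; simp only [hI]; ring

end IsSpinorOn

end Nil3

/-! ### Gauged spinors and the Gauss-Codazzi equations. -/

namespace Nil3

/-- The first gauged spinor `e^{-w/4} ψ₁`. -/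
noncomputable def gaugedFst (w s : ℂ → ℂ) (z : ℂ) : ℂ := Complex.exp (-w z / 4) * s z

/-- The second gauged spinor `e^{-w/4} \bar ψ₂`. -/
noncomputable def gaugedSnd (w t : ℂ → ℂ) (z : ℂ) : ℂ :=
  Complex.exp (-w z / 4) * starRingEnd ℂ (t z)

theorem exp_mul_exp_neg (a : ℂ) : Complex.exp (a / 2) * Complex.exp (-a / 2) = 1 := by
  rw [← Complex.exp_add, show a / 2 + -a / 2 = 0 by ring, Complex.exp_zero]

theorem hasWirtingerAt_exp_div {U : Set ℂ} {w : ℂ → ℂ} {z : ℂ} (hU : IsOpen U)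
    (hw : ContDiffOn ℝ ∞ w U) (hz : z ∈ U) (c : ℂ) :
    HasWirtingerAt (fun z => Complex.exp (-w z / c))
    (Complex.exp (-w z / c) * (-dz w z / c)) (Complex.exp (-w z / c) * (-dzbar w z / c)) z := by
  have := ((hasWirtingerAt_of_contDiffOn hU hw hz).const_mul (-1 / c)).cexp
  have e : ∀ ζ, -w ζ / c = -1 / c * w ζ := fun ζ => by ring
  refine (this.congr_of_eventuallyEq (Filter.Eventually.of_forall fun ζ => ?_)).congr_coeff ?_ ?_
  · simp only [e]
  · rw [e]; ring
  · rw [e]; ring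

theorem contDiffOn_gaugedFst {U : Set ℂ} {w s : ℂ → ℂ} (hw : ContDiffOn ℝ ∞ w U)
    (hs : ContDiffOn ℝ ∞ s U) : ContDiffOn ℝ ∞ (gaugedFst w s) U :=
  ((hw.neg.div_const 4).cexp).mul hs

theorem contDiffOn_gaugedSnd {U : Set ℂ} {w t : ℂ → ℂ} (hw : ContDiffOn ℝ ∞ w U)
    (ht : ContDiffOn ℝ ∞ t U) : ContDiffOn ℝ ∞ (gaugedSnd w t) U :=
  ((hw.neg.div_const 4).cexp).mul (contDiffOn_conj ht)

namespace IsSpinorOn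

variable {U : Set ℂ} {f : ℂ → Nil3} {s t w : ℂ → ℂ} {z : ℂ} {c : ℝ}
  (h : IsSpinorOn U f s t) (hU : IsOpen U) (hf : IsConformalImmersionOn U f)
  (hw : ContDiffOn ℝ ∞ w U) (hwf : ∀ z ∈ U, Complex.exp (w z / 2) = diracPotential f z)
  (hc : ∀ z ∈ U, meanCurvature f z = c)
include h hU hf hc

theorem contDiffOn_abreschRosenberg : ContDiffOn ℝ ∞ (abreschRosenberg f) U := by
  refine ContDiffOn.congr ?_ fun z hz => h.abreschRosenberg_eq hU hf hc hz
  have hs := h.smooth_fst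
  have ht := h.smooth_snd
  have hs' := contDiffOn_dz hU hs
  have ht' := contDiffOn_dz hU ht
  have k : ContDiffOn ℝ ∞ (fun _ : ℂ => (2 * c + Complex.I : ℂ)) U := contDiffOn_const
  have k2 : ContDiffOn ℝ ∞ (fun _ : ℂ => (2 : ℂ)) U := contDiffOn_const
  have k4 : ContDiffOn ℝ ∞ (fun _ : ℂ => (4 * Complex.I : ℂ)) U := contDiffOn_const
  exact ((k.mul ((k2.mul ((hs.mul ht').sub (ht.mul hs'))).add
    ((k4.mul (hs.pow 2)).mul (ht.pow 2)))).add (((k2.mul hs).mul ht).pow 2)).div_const 4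

include hw hwf

/-- With its companion below, this says that the row of gauged spinors is multiplied on the right by
U and V at λ = 1. The factor e^{-w/4} distributes the terms w_z/2 and w_{\bar z}/2 evenly over the
diagonals, which makes both matrices trace free. -/
theorem hasWirtingerAt_gaugedFst (hz : z ∈ U) : HasWirtingerAt (gaugedFst w s)
    (dz w z / 4 * gaugedFst w s z
      + abreschRosenberg f z * Complex.exp (-w z / 2) * gaugedSnd w t z)
    (-(dzbar w z / 4) * gaugedFst w s z + Complex.exp (w z / 2) * gaugedSnd w t z) z := by
  have hs := h.hasWirtingerAt_fst hU hz
  obtain ⟨d1, -⟩ := h.dirac_exp hU hf hwf hz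
  obtain ⟨e1, -⟩ := h.exp_mul_dz hU hf hw hwf hc hz
  refine ((hasWirtingerAt_exp_div hU hw hz 4).mul hs).congr_coeff ?_ ?_
  · simp only [gaugedFst, gaugedSnd]
    linear_combination (Complex.exp (-w z / 4) * Complex.exp (-w z / 2)) * e1
      + (Complex.exp (-w z / 4) * (dz w z / 2 * s z - dz s z)) * exp_mul_exp_neg (w z)
  · simp only [gaugedFst, gaugedSnd]
    rw [d1]; ring

theorem hasWirtingerAt_gaugedSnd (hz : z ∈ U) : HasWirtingerAt (gaugedSnd w t)
    (-(dz w z / 4) * gaugedSnd w t z - Complex.exp (w z / 2) * gaugedFst w s z)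
    (dzbar w z / 4 * gaugedSnd w t z
      - starRingEnd ℂ (abreschRosenberg f z) * Complex.exp (-w z / 2) * gaugedFst w s z) z := by
  have ht := (h.hasWirtingerAt_snd hU hz).conj
  obtain ⟨-, d1⟩ := h.dirac_exp hU hf hwf hz
  obtain ⟨-, e1⟩ := h.exp_mul_dz hU hf hw hwf hc hz
  refine ((hasWirtingerAt_exp_div hU hw hz 4).mul ht).congr_coeff ?_ ?_
  · simp only [gaugedFst, gaugedSnd]
    rw [d1, map_mul, map_neg, Complex.conj_conj, Complex.conj_conj]; ring
  · simp only [gaugedFst, gaugedSnd]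
    linear_combination (Complex.exp (-w z / 4) * Complex.exp (-w z / 2)) * e1
      + (Complex.exp (-w z / 4) * (dzbar w z / 2 * starRingEnd ℂ (t z)
        - starRingEnd ℂ (dz t z))) * exp_mul_exp_neg (w z)

/-- The curvature of the connection at `λ = 1` annihilates the gauged spinors. -/
theorem curvature_mul (hz : z ∈ U) :
    gaugedFst w s z * (dzbar (dz w) z / 2 + Complex.exp (w z / 2) ^ 2
        - abreschRosenberg f z * starRingEnd ℂ (abreschRosenberg f z) * Complex.exp (-w z / 2) ^ 2)
      + gaugedSnd w t z * (dzbar (abreschRosenberg f) z * Complex.exp (-w z / 2)) = 0 ∧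
    gaugedFst w s z * (starRingEnd ℂ (dzbar (abreschRosenberg f) z) * Complex.exp (-w z / 2))
      - gaugedSnd w t z * (dzbar (dz w) z / 2 + Complex.exp (w z / 2) ^ 2
        - abreschRosenberg f z * starRingEnd ℂ (abreschRosenberg f z)
          * Complex.exp (-w z / 2) ^ 2) = 0 := by
  have hB := hasWirtingerAt_of_contDiffOn hU (h.contDiffOn_abreschRosenberg hU hf hc) hz
  have h1 := h.hasWirtingerAt_gaugedFst hU hf hw hwf hc hz
  have h2 := h.hasWirtingerAt_gaugedSnd hU hf hw hwf hc hz
  have hE := hasWirtingerAt_exp hU hw hz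
  have hk := hasWirtingerAt_exp_div hU hw hz 2
  have hwz := hasWirtingerAt_of_contDiffOn hU (contDiffOn_dz hU hw) hz
  have hwb := hasWirtingerAt_of_contDiffOn hU (contDiffOn_dzbar hU hw) hz
  have hcomm := dz_dzbar_comm hU hw hz
  have c1 := dz_dzbar_comm hU (contDiffOn_gaugedFst hw h.smooth_fst) hz
  have c2 := dz_dzbar_comm hU (contDiffOn_gaugedSnd hw h.smooth_snd) hz
  have hU' := hU.mem_nhds hz
  have a1 := ((((hwz.const_mul (1 / 4)).mul h1).add ((hB.mul hk).mul h2)).congr_of_eventuallyEq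
    (k := dz (gaugedFst w s)) (by
      filter_upwards [hU'] with ζ hζ
      rw [(h.hasWirtingerAt_gaugedFst hU hf hw hwf hc hζ).dz_eq]; ring)).dzbar_eq
  have a2 := ((((hwb.const_mul (-1 / 4)).mul h1).add (hE.mul h2)).congr_of_eventuallyEq
    (k := dzbar (gaugedFst w s)) (by
      filter_upwards [hU'] with ζ hζ
      rw [(h.hasWirtingerAt_gaugedFst hU hf hw hwf hc hζ).dzbar_eq]; ring)).dz_eq
  have a3 := ((((hwz.const_mul (-1 / 4)).mul h2).sub (hE.mul h1)).congr_of_eventuallyEq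
    (k := dz (gaugedSnd w t)) (by
      filter_upwards [hU'] with ζ hζ
      rw [(h.hasWirtingerAt_gaugedSnd hU hf hw hwf hc hζ).dz_eq]; ring)).dzbar_eq
  have a4 := ((((hwb.const_mul (1 / 4)).mul h2).sub ((hB.conj.mul hk).mul h1)).congr_of_eventuallyEq
    (k := dzbar (gaugedSnd w t)) (by
      filter_upwards [hU'] with ζ hζ
      rw [(h.hasWirtingerAt_gaugedSnd hU hf hw hwf hc hζ).dzbar_eq]; ring)).dz_eq
  -- Equating both orders of differentiation, with first derivatives replaced through the system,
  -- leaves exactly the row times the curvature.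
  rw [a1, a2, hcomm] at c1
  rw [a3, a4, hcomm] at c2
  have hEk := exp_mul_exp_neg (w z)
  constructor
  · linear_combination -c1
  · linear_combination -c2

omit hU hw hwf hc in
theorem gauged_ne_zero (hz : z ∈ U) : gaugedFst w s z ≠ 0 ∨ gaugedSnd w t z ≠ 0 := by
  rcases h.ne_zero_or_ne_zero hf hz with h1 | h1
  · exact Or.inl (mul_ne_zero (Complex.exp_ne_zero _) h1)
  · exact Or.inr (mul_ne_zero (Complex.exp_ne_zero _) ((map_ne_zero _).2 h1))

/-- The Gauss and Codazzi equations of a surface of constant mean curvature. -/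
theorem gauss_codazzi (hz : z ∈ U) : dzbar (abreschRosenberg f) z = 0 ∧
    dzbar (dz w) z / 2 + Complex.exp (w z / 2) ^ 2
      - abreschRosenberg f z * starRingEnd ℂ (abreschRosenberg f z)
        * Complex.exp (-w z / 2) ^ 2 = 0 := by
  set R : ℂ → ℂ := fun z => dzbar (dz w) z / 2 + Complex.exp (w z / 2) ^ 2
      - abreschRosenberg f z * starRingEnd ℂ (abreschRosenberg f z)
        * Complex.exp (-w z / 2) ^ 2 with hR
  change _ ∧ R z = 0
  have hcurv : ∀ ζ ∈ U, _ := fun ζ hζ => h.curvature_mul hU hf hw hwf hc hζ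
  have hk : ∀ ζ, Complex.exp (-w ζ / 2) ≠ 0 := fun ζ => Complex.exp_ne_zero _
  have hsm : ContDiffOn ℝ ∞ R U := by
    have hB := h.contDiffOn_abreschRosenberg hU hf hc
    exact (((contDiffOn_dzbar hU (contDiffOn_dz hU hw)).div_const 2).add
      ((hw.div_const 2).cexp.pow 2)).sub ((hB.mul (contDiffOn_conj hB)).mul
        ((hw.neg.div_const 2).cexp.pow 2))
  -- The row annihilates the matrix with rows (R, m') and (m, -R), where m = B_{\bar z}e^{-w/2} and
  -- m' = \overline{B_{\bar z}}e^{-w/2}. Its determinant -R² - mm' may vanish for complex values, so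
  -- a pointwise argument does not suffice. If R ≠ 0 at z, absolute values give |s| = |t| near z, so
  -- the support function vanishes there and e^{w/2} is real. Then R is real, m' = \bar m, and R² +
  -- |m|² = 0, a contradiction.
  have hRz : R z = 0 := by
    by_contra hne
    have hUz : ∀ᶠ ζ in nhds z, ζ ∈ U := hU.mem_nhds hz
    have hev : ∀ᶠ ζ in nhds z, ζ ∈ U ∧ R ζ ≠ 0 :=
      hUz.and ((hsm.contDiffAt (hU.mem_nhds hz)).continuousAt.eventually_ne hne)
    have hreal : ∀ᶠ ζ in nhds z, ζ ∈ U ∧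
        starRingEnd ℂ (Complex.exp (w ζ / 2)) = Complex.exp (w ζ / 2) := by
      filter_upwards [hev] with ζ hζ
      refine ⟨hζ.1, ?_⟩
      obtain ⟨q1, q2⟩ := hcurv ζ hζ.1
      have n1 := congrArg norm (eq_neg_of_add_eq_zero_left q1)
      have n2 := congrArg norm (sub_eq_zero.1 q2)
      change ‖_ * R ζ‖ = _ at n1
      change _ = ‖_ * R ζ‖ at n2
      simp only [norm_mul, norm_neg, RCLike.norm_conj] at n1 n2
      have hr := norm_pos_iff.2 hζ.2
      have hxy : ‖gaugedFst w s ζ‖ = ‖gaugedSnd w t ζ‖ := by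
        have hx : ‖gaugedFst w s ζ‖ ≠ 0 := by
          intro h0
          rw [h0, zero_mul, eq_comm, mul_eq_zero, or_iff_left hr.ne'] at n2
          rcases h.gauged_ne_zero hf (w := w) hζ.1 with h1 | h1
          · exact h1 (norm_eq_zero.1 h0)
          · exact h1 (norm_eq_zero.1 n2)
        have hm : ‖R ζ‖ ^ 2 = (‖dzbar (abreschRosenberg f) ζ‖ * ‖Complex.exp (-w ζ / 2)‖) ^ 2 := by
          refine mul_left_cancel₀ hx ?_
          linear_combination ‖R ζ‖ * n1 -
            (‖dzbar (abreschRosenberg f) ζ‖ * ‖Complex.exp (-w ζ / 2)‖) * n2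
        have hm' := (sq_eq_sq₀ hr.le (by positivity)).1 hm
        rw [← hm'] at n1
        exact mul_right_cancel₀ hr.ne' n1
      simp only [gaugedFst, gaugedSnd, norm_mul, RCLike.norm_conj] at hxy
      have hst : ‖s ζ‖ = ‖t ζ‖ :=
        mul_left_cancel₀ (norm_ne_zero_iff.2 (Complex.exp_ne_zero _)) hxy
      rw [h.exp_eq hf hwf hc hζ.1, Complex.mul_conj', Complex.mul_conj', hst]
      simp
    -- Reality of e^{w/2} determines the imaginary part of w only modulo 2π, so the conclusion is
    -- drawn for the derivatives of w.
    have hwc : ∀ᶠ ζ in nhds z, dz w ζ = starRingEnd ℂ (dzbar w ζ) := by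
      filter_upwards [hreal.eventually_nhds] with ζ hζ
      have hζ' := hζ.self_of_nhds
      have e1 := hasWirtingerAt_exp hU hw hζ'.1
      have e2 := (e1.conj.congr_of_eventuallyEq (hζ.mono fun x hx => hx.2.symm)).unique e1
      have e3 := e2.1
      rw [map_mul, hζ'.2, map_div₀, map_ofNat] at e3
      have e4 := mul_left_cancel₀ (Complex.exp_ne_zero _) e3
      linear_combination -2 * e4
    have hwr : starRingEnd ℂ (dzbar (dz w) z) = dzbar (dz w) z := by
      have e1 := (hasWirtingerAt_of_contDiffOn hU (contDiffOn_dzbar hU hw) hz).conj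
      have e2 := (e1.congr_of_eventuallyEq hwc).dzbar_eq
      rw [dz_dzbar_comm hU hw hz] at e2
      exact e2.symm
    have hE := hreal.self_of_nhds.2
    have hEk := exp_mul_exp_neg (w z)
    have hkr : starRingEnd ℂ (Complex.exp (-w z / 2)) = Complex.exp (-w z / 2) := by
      have := congrArg (starRingEnd ℂ) hEk
      rw [map_mul, hE, map_one, ← hEk] at this
      exact mul_left_cancel₀ (Complex.exp_ne_zero _) this
    have hRr : starRingEnd ℂ (R z) = R z := by
      simp only [hR, map_sub, map_add, map_mul, map_pow, map_div₀, map_ofNat, hwr, hE, hkr,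
        Complex.conj_conj]
      ring
    obtain ⟨q1, q2⟩ := hcurv z hz
    change _ * R z + _ = 0 at q1
    change _ - _ * R z = 0 at q2
    set m := dzbar (abreschRosenberg f) z * Complex.exp (-w z / 2) with hm
    have hm' : starRingEnd ℂ (dzbar (abreschRosenberg f) z) * Complex.exp (-w z / 2)
        = starRingEnd ℂ m := by rw [hm, map_mul, hkr]
    rw [hm'] at q2
    -- Eliminating either entry of the row gives the other entry times R² + |m|².
    have hsum : R z * starRingEnd ℂ (R z) + m * starRingEnd ℂ m = 0 := by
      rw [hRr]
      rcases h.gauged_ne_zero hf (w := w) hz with h1 | h1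
      · refine (mul_eq_zero.1 (?_ : gaugedFst w s z * _ = 0)).resolve_left h1
        linear_combination R z * q1 + m * q2
      · refine (mul_eq_zero.1 (?_ : gaugedSnd w t z * _ = 0)).resolve_left h1
        linear_combination starRingEnd ℂ m * q1 - R z * q2
    rw [Complex.mul_conj', Complex.mul_conj'] at hsum
    norm_cast at hsum
    have := norm_pos_iff.2 hne
    nlinarith [sq_nonneg ‖m‖]
  obtain ⟨q1, q2⟩ := hcurv z hz
  change gaugedFst w s z * R z + _ = 0 at q1
  change _ - gaugedSnd w t z * R z = 0 at q2
  rw [hRz, mul_zero, zero_add] at q1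
  rw [hRz, mul_zero, sub_zero] at q2
  refine ⟨?_, hRz⟩
  rcases h.gauged_ne_zero hf (w := w) hz with h1 | h1
  · simpa [h1, hk z] using q2
  · simpa [h1, hk z] using q1

end IsSpinorOn

end Nil3

/-! ### Regularity of the data, and flatness of the family of connections. -/

namespace Nil3

section Regularity

variable {D : Set ℂ} {f : ℂ → Nil3} {w : ℂ → ℂ} {z : ℂ}
  (hD : IsOpen D) (hf : IsConformalImmersionOn D f)
include hD hf

theorem contDiffOn_expHalfU : ContDiffOn ℝ ∞ (expHalfU f) D := by
  have h1 : ContDiffOn ℝ ∞ (expU f) D :=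
    (((contDiffOn_maurerCartan hD hf.1 1).norm_sq ℝ).add
      ((contDiffOn_maurerCartan hD hf.1 Complex.I).norm_sq ℝ)).div_const 2
  exact h1.sqrt fun _ hz => (expU_pos hf hz).ne'

variable (hw : ContDiffOn ℝ ∞ w D) (hwf : ∀ z ∈ D, Complex.exp (w z / 2) = diracPotential f z)
include hw hwf

/-- The real part of the Dirac potential is -(H/2)e^{u/2}, so H inherits its smoothness from w and
e^{u/2}. -/
theorem contDiffOn_meanCurvature : ContDiffOn ℝ ∞ (meanCurvature f) D := by
  have h1 : ContDiffOn ℝ ∞ (fun z => (Complex.exp (w z / 2)).re) D :=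
    Complex.reCLM.contDiff.comp_contDiffOn (hw.div_const 2).cexp
  have h2 : ContDiffOn ℝ ∞ (fun z => -2 * (Complex.exp (w z / 2)).re * (expHalfU f z)⁻¹) D :=
    (contDiffOn_const.mul h1).mul
      ((contDiffOn_expHalfU hD hf).inv fun z hz => (expHalfU_pos hf hz).ne')
  refine h2.congr fun z hz => ?_
  have := (expHalfU_pos hf hz).ne'
  rw [hwf z hz, diracPotential]
  simp
  field_simp

theorem contDiffOn_abreschRosenberg : ContDiffOn ℝ ∞ (abreschRosenberg f) D := by
  intro z hz
  obtain ⟨r, hr, hsub, s, t, h⟩ := exists_local_spinor hD hf hz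
  have hU : IsOpen (Metric.ball z r) := Metric.isOpen_ball
  have hfU : IsConformalImmersionOn (Metric.ball z r) f :=
    ⟨hf.1.mono hsub, fun ζ hζ => hf.2 ζ (hsub hζ)⟩
  have hs := h.smooth_fst
  have ht := h.smooth_snd
  have hs' := contDiffOn_dz hU hs
  have ht' := contDiffOn_dz hU ht
  have k2 : ContDiffOn ℝ ∞ (fun _ : ℂ => (2 : ℂ)) (Metric.ball z r) := contDiffOn_const
  have k4 : ContDiffOn ℝ ∞ (fun _ : ℂ => (4 * Complex.I : ℂ)) (Metric.ball z r) := contDiffOn_const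
  have kI : ContDiffOn ℝ ∞ (fun _ : ℂ => Complex.I) (Metric.ball z r) := contDiffOn_const
  have hH := contDiffOn_ofReal ((contDiffOn_meanCurvature hD hf hw hwf).mono hsub)
  have key := ((((k2.mul hH).add kI).mul ((k2.mul ((hs.mul ht').sub (ht.mul hs'))).add
    ((k4.mul (hs.pow 2)).mul (ht.pow 2)))).add (((k2.mul hs).mul ht).pow 2)).div_const 4
  refine ((key.congr fun ζ hζ => ?_).contDiffAt
    (hU.mem_nhds (Metric.mem_ball_self hr))).contDiffWithinAt
  rw [abreschRosenberg_eq, h.hopf_eq hU hfU hζ, h.phi_two ζ hζ]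

end Regularity

/-- For real r the real and imaginary parts of r_{\bar z} are r_x/2 and r_y/2. -/
theorem fderiv_eq_zero_of_dzbar_ofReal {r : ℂ → ℝ} {z : ℂ} (h : DifferentiableAt ℝ r z)
    (h0 : dzbar (fun ζ => (r ζ : ℂ)) z = 0) : fderiv ℝ r z = 0 := by
  have e : fderiv ℝ (fun ζ => (r ζ : ℂ)) z = Complex.ofRealCLM.comp (fderiv ℝ r z) :=
    (Complex.ofRealCLM.hasFDerivAt.comp z h.hasFDerivAt).fderiv
  simp only [dzbar, e, ContinuousLinearMap.comp_apply, Complex.ofRealCLM_apply] at h0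
  have h1 := congrArg Complex.re h0
  have h2 := congrArg Complex.im h0
  simp at h1 h2
  refine ContinuousLinearMap.ext fun v => ?_
  have ev : v = v.re • (1 : ℂ) + v.im • Complex.I := by simp [Complex.re_add_im]
  rw [ev, map_add, map_smul, map_smul, h1, h2]
  simp

theorem hasConstantMeanCurvatureOn_of_dzbar {D : Set ℂ} {f : ℂ → Nil3} (hD : IsOpen D)
    (hDc : IsPreconnected D) (hH : ContDiffOn ℝ ∞ (meanCurvature f) D)
    (h0 : ∀ z ∈ D, dzbar (fun ζ => (meanCurvature f ζ : ℂ)) z = 0) :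
    HasConstantMeanCurvatureOn D f :=
  hD.exists_is_const_of_fderiv_eq_zero hDc
    (fun _ hz => (differentiableAt_of_contDiffOn hD hH hz).differentiableWithinAt)
    fun z hz => fderiv_eq_zero_of_dzbar_ofReal (differentiableAt_of_contDiffOn hD hH hz) (h0 z hz)

/-- Flatness in terms of the coefficients of `dz` and `d\bar z`. -/
theorem curvature_apply {U V : ℂ → Matrix (Fin 2) (Fin 2) ℂ} {z : ℂ}
    (hU : ∀ i j, DifferentiableAt ℝ (fun ζ => U ζ i j) z)
    (hV : ∀ i j, DifferentiableAt ℝ (fun ζ => V ζ i j) z) (v v' : ℂ) (i j : Fin 2) :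
    (matDeriv (fun ζ => v' • U ζ + starRingEnd ℂ v' • V ζ) z v
      - matDeriv (fun ζ => v • U ζ + starRingEnd ℂ v • V ζ) z v'
      + ((v • U z + starRingEnd ℂ v • V z) * (v' • U z + starRingEnd ℂ v' • V z)
        - (v' • U z + starRingEnd ℂ v' • V z) * (v • U z + starRingEnd ℂ v • V z))) i j
    = (v * starRingEnd ℂ v' - starRingEnd ℂ v * v') *
      (dz (fun ζ => V ζ i j) z - dzbar (fun ζ => U ζ i j) z + (U z * V z - V z * U z) i j) := by
  have k := fun u : ℂ => ((hasWirtingerAt_of_differentiableAt (hU i j)).const_mul u).add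
    ((hasWirtingerAt_of_differentiableAt (hV i j)).const_mul (starRingEnd ℂ u))
  have e := fun u : ℂ => (k u).fderiv_apply
  simp only [Matrix.add_apply, Matrix.sub_apply, matDeriv, Matrix.of_apply, Matrix.smul_apply,
    smul_eq_mul, e, Matrix.mul_apply, Fin.sum_univ_two]
  ring

section Flat

variable {D : Set ℂ} {f : ℂ → Nil3} {w : ℂ → ℂ} {z : ℂ}
  (hD : IsOpen D) (hf : IsConformalImmersionOn D f)
  (hw : ContDiffOn ℝ ∞ w D) (hwf : ∀ z ∈ D, Complex.exp (w z / 2) = diracPotential f z)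
include hD hf hw hwf

theorem contDiffOn_matU (l : ℂ) (i j : Fin 2) : ContDiffOn ℝ ∞ (fun z => matU f w l z i j) D := by
  have hk : ContDiffOn ℝ ∞ (fun z => Complex.exp (-w z / 2)) D := (hw.neg.div_const 2).cexp
  have hE : ContDiffOn ℝ ∞ (fun z => Complex.exp (w z / 2)) D := (hw.div_const 2).cexp
  have hu := contDiffOn_ofReal (contDiffOn_expHalfU hD hf)
  have hH := contDiffOn_ofReal (contDiffOn_meanCurvature hD hf hw hwf)
  have hB := contDiffOn_abreschRosenberg hD hf hw hwf
  have hw' := contDiffOn_dz hD hw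
  fin_cases i <;> fin_cases j
  · exact (hw'.div_const 4).add (((contDiffOn_dz hD hH).div_const 2).mul (hk.mul hu))
  · exact (contDiffOn_const.mul hE).neg
  · exact contDiffOn_const.mul (hB.mul hk)
  · exact (hw'.div_const 4).neg

theorem contDiffOn_matV (l : ℂ) (i j : Fin 2) : ContDiffOn ℝ ∞ (fun z => matV f w l z i j) D := by
  have hk : ContDiffOn ℝ ∞ (fun z => Complex.exp (-w z / 2)) D := (hw.neg.div_const 2).cexp
  have hE : ContDiffOn ℝ ∞ (fun z => Complex.exp (w z / 2)) D := (hw.div_const 2).cexp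
  have hu := contDiffOn_ofReal (contDiffOn_expHalfU hD hf)
  have hH := contDiffOn_ofReal (contDiffOn_meanCurvature hD hf hw hwf)
  have hB := contDiffOn_conj (contDiffOn_abreschRosenberg hD hf hw hwf)
  have hw' := contDiffOn_dzbar hD hw
  fin_cases i <;> fin_cases j
  · exact (hw'.div_const 4).neg
  · exact (contDiffOn_const.mul (hB.mul hk)).neg
  · exact contDiffOn_const.mul hE
  · exact (hw'.div_const 4).add (((contDiffOn_dzbar hD hH).div_const 2).mul (hk.mul hu))

/-- The curvature is a multiple of dz ∧ d\bar z, which takes the nonzero value -2i on (1, i); this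
pair of vectors detects the coefficient. -/
theorem isFlatConnectionOn_alpha_iff (l : ℂ) : IsFlatConnectionOn D (alpha f w l) ↔
    ∀ z ∈ D, ∀ i j, dz (fun ζ => matV f w l ζ i j) z - dzbar (fun ζ => matU f w l ζ i j) z
      + (matU f w l z * matV f w l z - matV f w l z * matU f w l z) i j = 0 := by
  have key := fun z (hz : z ∈ D) => curvature_apply (U := matU f w l) (V := matV f w l)
    (fun i j => differentiableAt_of_contDiffOn hD (contDiffOn_matU hD hf hw hwf l i j) hz)
    (fun i j => differentiableAt_of_contDiffOn hD (contDiffOn_matV hD hf hw hwf l i j) hz)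
  constructor
  · intro h z hz i j
    have h1 := congrFun (congrFun (h z hz 1 Complex.I) i) j
    have h2 := key z hz 1 Complex.I i j
    simp only [alpha] at h1
    rw [h1] at h2
    have h3 : (1 * starRingEnd ℂ Complex.I - starRingEnd ℂ 1 * Complex.I) ≠ 0 := by
      intro h4
      have := congrArg Complex.im h4
      norm_num at this
    exact (mul_eq_zero.1 h2.symm).resolve_left h3
  · intro h z hz v v'
    ext i j
    have h2 := key z hz v v' i j
    rw [h z hz i j, mul_zero] at h2
    exact h2

/-- Constant mean curvature from flatness at two values of the spectral parameter. -/
theorem hasConstantMeanCurvatureOn_of_flat (hDc : IsPreconnected D)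
    (h1 : IsFlatConnectionOn D (alpha f w 1)) (h2 : IsFlatConnectionOn D (alpha f w 2)) :
    HasConstantMeanCurvatureOn D f := by
  refine hasConstantMeanCurvatureOn_of_dzbar hD hDc (contDiffOn_meanCurvature hD hf hw hwf)
    fun z hz => ?_
  have e1 := (isFlatConnectionOn_alpha_iff hD hf hw hwf 1).1 h1 z hz 0 1
  have e2 := (isFlatConnectionOn_alpha_iff hD hf hw hwf 2).1 h2 z hz 0 1
  have hB := (hasWirtingerAt_of_contDiffOn hD (contDiffOn_abreschRosenberg hD hf hw hwf) hz).conj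
  have hE := hasWirtingerAt_exp hD hw hz
  have hk := hasWirtingerAt_exp_div hD hw hz 2
  have eV := fun l : ℂ => ((hB.mul hk).const_mul l).neg.dz_eq
  have eU := fun l : ℂ => (hE.const_mul l⁻¹).neg.dzbar_eq
  simp only [matU, matV, Matrix.sub_apply, Matrix.mul_apply, Fin.sum_univ_two, Matrix.of_apply,
    Matrix.cons_val', Matrix.cons_val_zero, Matrix.cons_val_one, Matrix.cons_val_fin_one,
    eV, eU] at e1 e2
  have hu : (expHalfU f z : ℂ) ≠ 0 := Complex.ofReal_ne_zero.2 (expHalfU_pos hf hz).ne'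
  -- The upper right entry is λX - λ⁻¹Y with 2Y = H_{\bar z}e^{u/2}. The values λ = 1 and λ = 2 give
  -- X - Y = 0 and 2X - Y/2 = 0, and the weights -8/3 and 4/3 eliminate X and leave 2Y.
  have hmul : dzbar (fun ζ => (meanCurvature f ζ : ℂ)) z
      * (Complex.exp (w z / 2) * Complex.exp (-w z / 2) * expHalfU f z) = 0 := by
    norm_num at e1 e2
    linear_combination (-8 / 3) * e1 + (4 / 3) * e2
  rw [exp_mul_exp_neg, one_mul] at hmul
  exact (mul_eq_zero.1 hmul).resolve_right hu

variable {c : ℝ} (hc : ∀ z ∈ D, meanCurvature f z = c)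
include hc

/-- B and w are globally defined and the equations are pointwise, so spinors on a small ball
suffice. -/
theorem gauss_codazzi (hz : z ∈ D) : dzbar (abreschRosenberg f) z = 0 ∧
    dzbar (dz w) z / 2 + Complex.exp (w z / 2) ^ 2
      - abreschRosenberg f z * starRingEnd ℂ (abreschRosenberg f z)
        * Complex.exp (-w z / 2) ^ 2 = 0 := by
  obtain ⟨r, hr, hsub, s, t, h⟩ := exists_local_spinor hD hf hz
  exact h.gauss_codazzi Metric.isOpen_ball ⟨hf.1.mono hsub, fun ζ hζ => hf.2 ζ (hsub hζ)⟩
    (hw.mono hsub) (fun z hz => hwf z (hsub hz)) (fun z hz => hc z (hsub hz))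
    (Metric.mem_ball_self hr)

omit hf hw hwf in
theorem dz_meanCurvature (hz : z ∈ D) : dz (fun ζ => (meanCurvature f ζ : ℂ)) z = 0 ∧
    dzbar (fun ζ => (meanCurvature f ζ : ℂ)) z = 0 := by
  have : HasWirtingerAt (fun ζ => (meanCurvature f ζ : ℂ)) 0 0 z :=
    (HasWirtingerAt.const (c : ℂ) z).congr_of_eventuallyEq (by
      filter_upwards [hD.mem_nhds hz] with ζ hζ
      rw [hc ζ hζ])
  exact ⟨this.dz_eq, this.dzbar_eq⟩

omit hf hw hwf in
theorem matU_eq (l : ℂ) (hz : z ∈ D) : matU f w l z =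
    !![dz w z / 4, -(l⁻¹ * Complex.exp (w z / 2));
      l⁻¹ * (abreschRosenberg f z * Complex.exp (-w z / 2)), -(dz w z / 4)] := by
  rw [matU, (dz_meanCurvature hD hc hz).1]; simp

omit hf hw hwf in
theorem matV_eq (l : ℂ) (hz : z ∈ D) : matV f w l z =
    !![-(dzbar w z / 4), -(l * (starRingEnd ℂ (abreschRosenberg f z) * Complex.exp (-w z / 2)));
      l * Complex.exp (w z / 2), dzbar w z / 4] := by
  rw [matV, (dz_meanCurvature hD hc hz).2]; simp

/-- The products on the diagonal pair λ⁻¹ with λ, so the diagonal is the Gauss equation for every λ.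
In the off-diagonal entries everything cancels except multiples of B_{\bar z} or its conjugate. -/
theorem isFlatConnectionOn_of_constant {l : ℂ} (hl : l ≠ 0) :
    IsFlatConnectionOn D (alpha f w l) := by
  rw [isFlatConnectionOn_alpha_iff hD hf hw hwf]
  intro z hz
  have hB := hasWirtingerAt_of_contDiffOn hD (contDiffOn_abreschRosenberg hD hf hw hwf) hz
  obtain ⟨g1, g2⟩ := gauss_codazzi hD hf hw hwf hc hz
  rw [g1] at hB
  have hE := hasWirtingerAt_exp hD hw hz
  have hk := hasWirtingerAt_exp_div hD hw hz 2
  have hwz := hasWirtingerAt_of_contDiffOn hD (contDiffOn_dz hD hw) hz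
  have hwb := hasWirtingerAt_of_contDiffOn hD (contDiffOn_dzbar hD hw) hz
  have hcomm := dz_dzbar_comm hD hw hz
  have eU : ∀ i j {g : ℂ → ℂ} {a b : ℂ}, HasWirtingerAt g a b z →
      (∀ ζ ∈ D, matU f w l ζ i j = g ζ) → dzbar (fun ζ => matU f w l ζ i j) z = b := by
    intro i j g a b h1 h2
    refine (h1.congr_of_eventuallyEq ?_).dzbar_eq
    filter_upwards [hD.mem_nhds hz] with ζ hζ using h2 ζ hζ
  have eV : ∀ i j {g : ℂ → ℂ} {a b : ℂ}, HasWirtingerAt g a b z →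
      (∀ ζ ∈ D, matV f w l ζ i j = g ζ) → dz (fun ζ => matV f w l ζ i j) z = a := by
    intro i j g a b h1 h2
    refine (h1.congr_of_eventuallyEq ?_).dz_eq
    filter_upwards [hD.mem_nhds hz] with ζ hζ using h2 ζ hζ
  have u00 := eU 0 0 (hwz.const_mul (1 / 4)) fun ζ hζ => by
    rw [matU_eq hD hc l hζ]; simp; ring
  have u01 := eU 0 1 (hE.const_mul l⁻¹).neg fun ζ hζ => by rw [matU_eq hD hc l hζ]; simp
  have u10 := eU 1 0 ((hB.mul hk).const_mul l⁻¹) fun ζ hζ => by rw [matU_eq hD hc l hζ]; simp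
  have u11 := eU 1 1 (hwz.const_mul (-1 / 4)) fun ζ hζ => by
    rw [matU_eq hD hc l hζ]; simp; ring
  have v00 := eV 0 0 (hwb.const_mul (-1 / 4)) fun ζ hζ => by
    rw [matV_eq hD hc l hζ]; simp; ring
  have v01 := eV 0 1 ((hB.conj.mul hk).const_mul l).neg fun ζ hζ => by
    rw [matV_eq hD hc l hζ]; simp
  have v10 := eV 1 0 (hE.const_mul l) fun ζ hζ => by rw [matV_eq hD hc l hζ]; simp
  have v11 := eV 1 1 (hwb.const_mul (1 / 4)) fun ζ hζ => by
    rw [matV_eq hD hc l hζ]; simp; ring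
  have hll : l⁻¹ * l = 1 := inv_mul_cancel₀ hl
  rw [map_zero] at v01
  rw [hcomm] at v00 v11
  intro i j
  rw [matU_eq hD hc l hz, matV_eq hD hc l hz]
  fin_cases i <;> fin_cases j
  · simp [u00, v00]
    linear_combination -g2 + (abreschRosenberg f z * starRingEnd ℂ (abreschRosenberg f z)
        * Complex.exp (-w z / 2) ^ 2 - Complex.exp (w z / 2) ^ 2) * hll
  · simp [u01, v01]
    ring
  · simp [u10, v10]
    ring
  · simp [u11, v11]
    linear_combination g2 - (abreschRosenberg f z * starRingEnd ℂ (abreschRosenberg f z)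
        * Complex.exp (-w z / 2) ^ 2 - Complex.exp (w z / 2) ^ 2) * hll

end Flat

end Nil3

namespace Nil3

open MeasureTheory

/-! ### The first variation of the energy -/

section Analysis

/-- A point outside `D` lies in the open complement of `K`, where the extension by zero is
identically zero. -/
theorem contDiff_indicator {E : Type*} [NormedAddCommGroup E] [NormedSpace ℝ E] {D K : Set ℂ}
    {g : ℂ → E} (hD : IsOpen D) (hK : IsCompact K) (hg : ContDiffOn ℝ ∞ g D)
    (h0 : ∀ z ∈ D \ K, g z = 0) (hKD : K ⊆ D) : ContDiff ℝ ∞ (D.indicator g) := by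
  rw [contDiff_iff_contDiffAt]
  intro z
  by_cases hz : z ∈ D
  · refine (hg.contDiffAt (hD.mem_nhds hz)).congr_of_eventuallyEq ?_
    filter_upwards [hD.mem_nhds hz] with ζ hζ
    exact Set.indicator_of_mem hζ g
  · refine (contDiffAt_const (c := (0 : E))).congr_of_eventuallyEq ?_
    filter_upwards [hK.isClosed.isOpen_compl.mem_nhds fun h => hz (hKD h)] with ζ hζ
    by_cases hζD : ζ ∈ D
    · rw [Set.indicator_of_mem hζD, h0 ζ ⟨hζD, hζ⟩]
    · exact Set.indicator_of_notMem hζD g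

/-- The divergence theorem for a function with support in a compact subset. -/
theorem setIntegral_fderiv_eq_zero {D K : Set ℂ} {g : ℂ → ℝ} (hD : IsOpen D) (hK : IsCompact K)
    (hKD : K ⊆ D) (hg : ContDiffOn ℝ ∞ g D) (h0 : ∀ z ∈ D \ K, g z = 0) (v : ℂ) :
    ∫ z in K, fderiv ℝ g z v = 0 := by
  have hG := contDiff_indicator hD hK hg h0 hKD
  set G := D.indicator g with hGdef
  have hsupp : Function.support G ⊆ K := by
    intro z hz
    by_contra hzK
    apply hz
    by_cases hzD : z ∈ D
    · rw [hGdef, Set.indicator_of_mem hzD, h0 z ⟨hzD, hzK⟩]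
    · exact Set.indicator_of_notMem hzD g
  have hcs : HasCompactSupport G := HasCompactSupport.of_support_subset_isCompact hK hsupp
  have hcd : Continuous fun z => fderiv ℝ G z v :=
    (hG.continuous_fderiv (by simp)).clm_apply continuous_const
  have hcs' : HasCompactSupport fun z => fderiv ℝ G z v := hcs.fderiv_apply (𝕜 := ℝ) v
  have hint := hcd.integrable_of_hasCompactSupport (μ := volume) hcs'
  -- Integration by parts over the plane against the constant function 1.
  have key : ∫ z, fderiv ℝ G z v = 0 := by
    have := integral_mul_fderiv_eq_neg_fderiv_mul_of_integrable (μ := (volume : Measure ℂ))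
      (𝕜 := ℝ) (f := fun _ => (1 : ℝ)) (g := G) (v := v) (by simp)
      (by simpa using hint) (by simpa using hG.continuous.integrable_of_hasCompactSupport hcs)
      (fun x _ => differentiableAt_const _) (fun x _ => hG.differentiable (by simp) x)
    simpa using this
  rw [← key]
  refine (setIntegral_congr_fun hK.measurableSet fun z hz => ?_).trans
    (setIntegral_eq_integral_of_forall_compl_eq_zero fun z hz => ?_)
  · have : g =ᶠ[nhds z] G := by
      filter_upwards [hD.mem_nhds (hKD hz)] with ζ hζ
      exact (Set.indicator_of_mem hζ g).symm
    simp only [this.fderiv_eq (𝕜 := ℝ)]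
  · have : G =ᶠ[nhds z] fun _ => 0 := by
      filter_upwards [hK.isClosed.isOpen_compl.mem_nhds hz] with ζ hζ
      by_contra h
      exact hζ (hsupp h)
    rw [this.fderiv_eq (𝕜 := ℝ)]
    simp

/-- Differentiation under the integral sign over a compact set. -/
theorem hasDerivAt_setIntegral {D K : Set ℂ} {G : ℝ × ℂ → ℝ} (hD : IsOpen D) (hK : IsCompact K)
    (hKD : K ⊆ D) (hG : ContDiffOn ℝ ∞ G (Set.univ ×ˢ D)) :
    HasDerivAt (fun t => ∫ z in K, G (t, z)) (∫ z in K, fderiv ℝ G (0, z) (1, 0)) 0 := by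
  have hΩ : IsOpen ((Set.univ : Set ℝ) ×ˢ D) := isOpen_univ.prod hD
  have hG' := contDiffOn_fderiv_apply hΩ hG ((1, 0) : ℝ × ℂ)
  have hc : ∀ t, ContinuousOn (fun z => G (t, z)) K := fun t =>
    hG.continuousOn.comp (by fun_prop) fun z hz => ⟨Set.mem_univ _, hKD hz⟩
  have hc' : ∀ t, ContinuousOn (fun z => fderiv ℝ G (t, z) (1, 0)) K := fun t =>
    hG'.continuousOn.comp (f := fun z : ℂ => ((t, z) : ℝ × ℂ)) (by fun_prop)
      fun z hz => ⟨Set.mem_univ _, hKD hz⟩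
  -- The t-derivative is continuous on the compact set [-1, 1] × K, so a constant dominates it.
  obtain ⟨C, hC⟩ := ((isCompact_Icc (a := (-1 : ℝ)) (b := 1)).prod hK).exists_bound_of_continuousOn
    (hG'.continuousOn.mono fun p hp => ⟨Set.mem_univ _, hKD hp.2⟩)
  refine (hasDerivAt_integral_of_dominated_loc_of_deriv_le (μ := volume.restrict K)
    (F := fun t z => G (t, z)) (F' := fun t z => fderiv ℝ G (t, z) (1, 0)) (bound := fun _ => C)
    (Icc_mem_nhds (by norm_num : (-1 : ℝ) < 0) (by norm_num : (0 : ℝ) < 1)) ?_ ?_ ?_ ?_ ?_ ?_).2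
  · exact Filter.Eventually.of_forall fun t =>
      (hc t).aestronglyMeasurable hK.measurableSet
  · exact (hc 0).integrableOn_compact hK
  · exact (hc' 0).aestronglyMeasurable hK.measurableSet
  · filter_upwards [ae_restrict_mem hK.measurableSet] with z hz t ht
    exact hC (t, z) ⟨ht, hz⟩
  · have : IsFiniteMeasure (volume.restrict K) :=
      ⟨by rw [Measure.restrict_apply_univ]; exact hK.measure_lt_top⟩
    exact integrable_const C
  · filter_upwards [ae_restrict_mem hK.measurableSet] with z hz t ht
    have h1 := (differentiableAt_of_contDiffOn hΩ hG
      (x := (t, z)) ⟨Set.mem_univ _, hKD hz⟩).hasFDerivAt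
    have h2 : HasDerivAt (fun t : ℝ => ((t, z) : ℝ × ℂ)) (1, 0) t :=
      (hasDerivAt_id t).prodMk (hasDerivAt_const t z)
    exact h1.comp_hasDerivAt t h2

variable {E : Type*} [NormedAddCommGroup E] [NormedSpace ℝ E]

theorem fderiv_slice {g : ℝ × ℂ → E} {t : ℝ} {z : ℂ} (h : DifferentiableAt ℝ g (t, z)) (v : ℂ) :
    fderiv ℝ (fun ζ => g (t, ζ)) z v = fderiv ℝ g (t, z) (0, v) := by
  have h2 : HasFDerivAt (fun ζ : ℂ => ((t, ζ) : ℝ × ℂ)) (ContinuousLinearMap.inr ℝ ℝ ℂ) z :=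
    hasFDerivAt_prodMk_right t z
  have := h.hasFDerivAt.comp z h2
  exact DFunLike.congr_fun this.fderiv v

theorem hasDerivAt_slice {g : ℝ × ℂ → E} {t : ℝ} {z : ℂ} (h : DifferentiableAt ℝ g (t, z)) :
    HasDerivAt (fun τ => g (τ, z)) (fderiv ℝ g (t, z) (1, 0)) t :=
  h.hasFDerivAt.comp_hasDerivAt t ((hasDerivAt_id t).prodMk (hasDerivAt_const t z))

end Analysis

/-- The Laplacian of a matrix valued function, entry by entry. -/
noncomputable def matLap (n : ℂ → Matrix (Fin 2) (Fin 2) ℂ) (z : ℂ) : Matrix (Fin 2) (Fin 2) ℂ :=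
  matDeriv (fun ζ => matDeriv n ζ 1) z 1
    + matDeriv (fun ζ => matDeriv n ζ Complex.I) z Complex.I

/-- The variation field of a variation. -/
noncomputable def variationField (Φ : ℝ → ℂ → Matrix (Fin 2) (Fin 2) ℂ) (z : ℂ) :
    Matrix (Fin 2) (Fin 2) ℂ :=
  Matrix.of fun i j => deriv (fun t => Φ t z i j) 0

section FirstVariation

variable {D K : Set ℂ} {Φ : ℝ → ℂ → Matrix (Fin 2) (Fin 2) ℂ}
  (hD : IsOpen D) (hK : IsCompact K) (hKD : K ⊆ D)
  (hΦ : ∀ i j, ContDiffOn ℝ ∞ (fun p : ℝ × ℂ => Φ p.1 p.2 i j) (Set.univ ×ˢ D))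
include hD hΦ

omit hD in
theorem contDiffOn_slice (t : ℝ) (i j : Fin 2) : ContDiffOn ℝ ∞ (fun z => Φ t z i j) D :=
  (hΦ i j).comp (contDiffOn_const.prodMk contDiffOn_id) fun _ hz => ⟨Set.mem_univ _, hz⟩

theorem variationField_apply {z : ℂ} (hz : z ∈ D) (i j : Fin 2) : variationField Φ z i j
    = fderiv ℝ (fun p : ℝ × ℂ => Φ p.1 p.2 i j) (0, z) (1, 0) :=
  (hasDerivAt_slice (differentiableAt_of_contDiffOn (isOpen_univ.prod hD) (hΦ i j)
    (x := ((0 : ℝ), z)) ⟨Set.mem_univ _, hz⟩)).deriv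

theorem contDiffOn_variationField (i j : Fin 2) :
    ContDiffOn ℝ ∞ (fun z => variationField Φ z i j) D := by
  have h := contDiffOn_fderiv_apply (isOpen_univ.prod hD) (hΦ i j) ((1, 0) : ℝ × ℂ)
  exact (h.comp (contDiffOn_const.prodMk contDiffOn_id)
    fun z hz => ⟨Set.mem_univ (0 : ℝ), hz⟩).congr fun z hz => variationField_apply hD hΦ hz i j

theorem energyDensity_eq (t : ℝ) {z : ℂ} (hz : z ∈ D) : energyDensity (Φ t) z =
    (∑ i, ∑ j, (fderiv ℝ (fun p : ℝ × ℂ => Φ p.1 p.2 i j) (t, z) (0, 1)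
      * fderiv ℝ (fun p : ℝ × ℂ => Φ p.1 p.2 j i) (t, z) (0, 1)
      + fderiv ℝ (fun p : ℝ × ℂ => Φ p.1 p.2 i j) (t, z) (0, Complex.I)
      * fderiv ℝ (fun p : ℝ × ℂ => Φ p.1 p.2 j i) (t, z) (0, Complex.I))).re / 2 := by
  have e := fun (v : ℂ) i j => fderiv_slice (g := fun p : ℝ × ℂ => Φ p.1 p.2 i j) (t := t) (z := z)
    (differentiableAt_of_contDiffOn (isOpen_univ.prod hD) (hΦ i j) ⟨Set.mem_univ _, hz⟩) v
  simp only [energyDensity, matDeriv, Matrix.trace, Matrix.diag, Matrix.mul_apply, Matrix.of_apply,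
    Fin.sum_univ_two, ← e]
  rw [← Complex.add_re]
  congr 2
  ring

/-- The variation parameter and the domain variable may be differentiated in either order. -/
theorem fderiv_fderiv_slice {z : ℂ} (hz : z ∈ D) (v : ℂ) (i j : Fin 2) :
    fderiv ℝ (fun p : ℝ × ℂ => fderiv ℝ (fun p : ℝ × ℂ => Φ p.1 p.2 i j) p (0, v)) (0, z) (1, 0)
      = fderiv ℝ (fun ζ => variationField Φ ζ i j) z v := by
  have hΩ : IsOpen ((Set.univ : Set ℝ) ×ˢ D) := isOpen_univ.prod hD
  have hp : ((0 : ℝ), z) ∈ (Set.univ : Set ℝ) ×ˢ D := ⟨Set.mem_univ _, hz⟩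
  rw [fderiv_fderiv_comm hΩ (hΦ i j) hp, ← fderiv_slice (differentiableAt_of_contDiffOn hΩ
    (contDiffOn_fderiv_apply hΩ (hΦ i j) ((1, 0) : ℝ × ℂ)) hp)]
  have : (fun ζ => variationField Φ ζ i j) =ᶠ[nhds z] fun ζ =>
      fderiv ℝ (fun p : ℝ × ℂ => Φ p.1 p.2 i j) (0, ζ) (1, 0) := by
    filter_upwards [hD.mem_nhds hz] with ζ hζ using variationField_apply hD hΦ hζ i j
  rw [this.fderiv_eq]

include hK hKD

/-- The first variation formula. -/
theorem hasDerivAt_energy (h0 : ∀ z ∈ D \ K, variationField Φ z = 0) :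
    HasDerivAt (fun t => ∫ z in K, energyDensity (Φ t) z)
      (-∫ z in K, (matLap (Φ 0) z * variationField Φ z).trace.re) 0 := by
  have hΩ : IsOpen ((Set.univ : Set ℝ) ×ˢ D) := isOpen_univ.prod hD
  set a : ℂ → Fin 2 → Fin 2 → ℝ × ℂ → ℂ := fun v i j p =>
    fderiv ℝ (fun p : ℝ × ℂ => Φ p.1 p.2 i j) p (0, v) with ha
  have hsa : ∀ v i j, ContDiffOn ℝ ∞ (a v i j) (Set.univ ×ˢ D) := fun v i j =>
    contDiffOn_fderiv_apply hΩ (hΦ i j) _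
  set G : ℝ × ℂ → ℝ := fun p =>
    (∑ i, ∑ j, (a 1 i j p * a 1 j i p + a Complex.I i j p * a Complex.I j i p)).re / 2 with hGdef
  have hGs : ContDiffOn ℝ ∞ (fun p => ∑ i, ∑ j,
      (a 1 i j p * a 1 j i p + a Complex.I i j p * a Complex.I j i p)) (Set.univ ×ˢ D) :=
    ContDiffOn.sum fun i _ => ContDiffOn.sum fun j _ =>
      ((hsa 1 i j).mul (hsa 1 j i)).add ((hsa Complex.I i j).mul (hsa Complex.I j i))
  have hG : ContDiffOn ℝ ∞ G (Set.univ ×ˢ D) :=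
    (Complex.reCLM.contDiff.comp_contDiffOn hGs).div_const 2
  have hder := hasDerivAt_setIntegral hD hK hKD hG
  have he : (fun t => ∫ z in K, energyDensity (Φ t) z) = fun t => ∫ z in K, G (t, z) := by
    ext t
    exact setIntegral_congr_fun hK.measurableSet fun z hz => energyDensity_eq hD hΦ t (hKD hz)
  rw [he]
  convert hder using 1
  have hn := fun i j => contDiffOn_slice hΦ 0 i j
  have hξ := contDiffOn_variationField hD hΦ
  -- With ξ the variation field, b v = Re tr(n_v ξ). The t-derivative of the energy density is b₁
  -- differentiated along 1 plus b_i differentiated along i, minus Re tr(Δn ξ); the divergence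
  -- integrates to zero.
  set b : ℂ → ℂ → ℝ := fun v z => (∑ i, ∑ j,
    fderiv ℝ (fun ζ => Φ 0 ζ i j) z v * variationField Φ z j i).re with hb
  have hbs' : ∀ v, ContDiffOn ℝ ∞ (fun z => ∑ i, ∑ j,
      fderiv ℝ (fun ζ => Φ 0 ζ i j) z v * variationField Φ z j i) D := fun v =>
    ContDiffOn.sum fun i _ => ContDiffOn.sum fun j _ =>
      (contDiffOn_fderiv_apply hD (hn i j) v).mul (hξ j i)
  have hbs : ∀ v, ContDiffOn ℝ ∞ (b v) D := fun v =>
    Complex.reCLM.contDiff.comp_contDiffOn (hbs' v)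
  have hb0 : ∀ v, ∫ z in K, fderiv ℝ (b v) z v = 0 := fun v =>
    setIntegral_fderiv_eq_zero hD hK hKD (hbs v) (fun z hz => by simp [hb, h0 z hz]) v
  have hLs : ContinuousOn (fun z => (matLap (Φ 0) z * variationField Φ z).trace.re) D := by
    have h2 : ∀ v i j, ContDiffOn ℝ ∞
        (fun z => fderiv ℝ (fun ζ => fderiv ℝ (fun ζ => Φ 0 ζ i j) ζ v) z v) D := fun v i j =>
      contDiffOn_fderiv_apply hD (contDiffOn_fderiv_apply hD (hn i j) v) v
    have h3 : ContDiffOn ℝ ∞ (fun z => ∑ i, ∑ j,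
      (fderiv ℝ (fun ζ => fderiv ℝ (fun ζ => Φ 0 ζ i j) ζ 1) z 1
        + fderiv ℝ (fun ζ => fderiv ℝ (fun ζ => Φ 0 ζ i j) ζ Complex.I) z Complex.I)
        * variationField Φ z j i) D :=
      ContDiffOn.sum fun i _ => ContDiffOn.sum fun j _ =>
        ((h2 1 i j).add (h2 Complex.I i j)).mul (hξ j i)
    refine (Complex.continuous_re.comp_continuousOn h3.continuousOn).congr fun z hz => ?_
    simp [matLap, matDeriv, Matrix.trace, Matrix.mul_apply, Fin.sum_univ_two]
  have hi1 := fun v => (((contDiffOn_fderiv_apply hD (hbs v) v).continuousOn.mono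
    hKD).integrableOn_compact (μ := volume) hK)
  have hi2 := (hLs.mono hKD).integrableOn_compact (μ := volume) hK
  have hsum : ∫ z in K, (fderiv ℝ (b 1) z 1 + fderiv ℝ (b Complex.I) z Complex.I
      - (matLap (Φ 0) z * variationField Φ z).trace.re)
      = -∫ z in K, (matLap (Φ 0) z * variationField Φ z).trace.re := by
    have hi3 : Integrable (fun z => fderiv ℝ (b 1) z 1 + fderiv ℝ (b Complex.I) z Complex.I)
      (volume.restrict K) := (hi1 1).add (hi1 Complex.I)
    rw [integral_sub hi3 hi2, integral_add (hi1 1) (hi1 Complex.I), hb0, hb0]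
    ring
  rw [← hsum]
  refine setIntegral_congr_fun hK.measurableSet fun z hz => ?_
  have hzD := hKD hz
  have hp : ((0 : ℝ), z) ∈ (Set.univ : Set ℝ) ×ˢ D := ⟨Set.mem_univ _, hzD⟩
  have hbd : ∀ v, fderiv ℝ (b v) z v = (∑ i, ∑ j,
      (fderiv ℝ (fun ζ => fderiv ℝ (fun ζ => Φ 0 ζ i j) ζ v) z v * variationField Φ z j i
      + fderiv ℝ (fun ζ => Φ 0 ζ i j) z v * fderiv ℝ (fun ζ => variationField Φ ζ j i) z v)).re := by
    intro v
    have k := fun i j => ((differentiableAt_of_contDiffOn hD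
      (contDiffOn_fderiv_apply hD (hn i j) v) hzD).hasFDerivAt).mul
      (differentiableAt_of_contDiffOn hD (hξ j i) hzD).hasFDerivAt
    have k2 := (Complex.reCLM.hasFDerivAt.comp z
      (((k 0 0).add (k 0 1)).add ((k 1 0).add (k 1 1)))).congr_of_eventuallyEq
      (f₁ := b v) (Filter.Eventually.of_forall fun ζ => by simp [hb, Fin.sum_univ_two])
    rw [k2.fderiv]
    simp [Fin.sum_univ_two]
    ring
  have had : ∀ v i j, HasFDerivAt (a v i j) (fderiv ℝ (a v i j) (0, z)) (0, z) := fun v i j =>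
    (differentiableAt_of_contDiffOn hΩ (hsa v i j) hp).hasFDerivAt
  have hGd : fderiv ℝ G (0, z) (1, 0) = (∑ i, ∑ j,
      (a 1 i j (0, z) * fderiv ℝ (a 1 j i) (0, z) (1, 0)
      + a Complex.I i j (0, z) * fderiv ℝ (a Complex.I j i) (0, z) (1, 0))).re := by
    have k := fun i j => ((had 1 i j).mul (had 1 j i)).add
      ((had Complex.I i j).mul (had Complex.I j i))
    have k1 := (Complex.reCLM.hasFDerivAt.comp ((0 : ℝ), z)
      (((k 0 0).add (k 0 1)).add ((k 1 0).add (k 1 1)))).const_mul (1 / 2)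
    have k2 := k1.congr_of_eventuallyEq
      (f₁ := G) (Filter.Eventually.of_forall fun ζ => by simp [hGdef, Fin.sum_univ_two]; ring)
    rw [k2.fderiv]
    simp [Fin.sum_univ_two]
    ring
  have ha0 : ∀ v i j, a v i j (0, z) = fderiv ℝ (fun ζ => Φ 0 ζ i j) z v := fun v i j =>
    (fderiv_slice (g := fun p : ℝ × ℂ => Φ p.1 p.2 i j)
      (differentiableAt_of_contDiffOn hΩ (hΦ i j) hp) v).symm
  have ha1 : ∀ v i j, fderiv ℝ (a v i j) (0, z) (1, 0)
      = fderiv ℝ (fun ζ => variationField Φ ζ i j) z v := fun v i j =>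
    fderiv_fderiv_slice hD hΦ hzD v i j
  simp only [hGd, hbd, ha0, ha1]
  simp [matLap, matDeriv, Matrix.trace, Matrix.mul_apply, Fin.sum_univ_two]
  ring

end FirstVariation

end Nil3

namespace Nil3

open MeasureTheory

/-! ### The Euler-Lagrange equation -/

theorem mul_self_of_mem_symmetricSpace {M : Matrix (Fin 2) (Fin 2) ℂ} (h : M ∈ symmetricSpace) :
    M * M = 1 := by
  obtain ⟨g, rfl⟩ := h
  have h1 : ((g⁻¹ : GL (Fin 2) ℂ) : Matrix (Fin 2) (Fin 2) ℂ) * (g : Matrix (Fin 2) (Fin 2) ℂ) = 1 := by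
    rw [← Units.val_mul, inv_mul_cancel, Units.val_one]
  have h2 : (g : Matrix (Fin 2) (Fin 2) ℂ) * ((g⁻¹ : GL (Fin 2) ℂ) : Matrix (Fin 2) (Fin 2) ℂ) = 1 := by
    rw [← Units.val_mul, mul_inv_cancel, Units.val_one]
  have h3 : sigma3 * sigma3 = 1 := by
    ext i j; fin_cases i <;> fin_cases j <;> simp [sigma3, Matrix.mul_apply, Fin.sum_univ_two]
  calc adSigma3 g * adSigma3 g
      = (g : Matrix (Fin 2) (Fin 2) ℂ) * sigma3
        * (((g⁻¹ : GL (Fin 2) ℂ) : Matrix (Fin 2) (Fin 2) ℂ) * (g : Matrix (Fin 2) (Fin 2) ℂ))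
        * sigma3 * ((g⁻¹ : GL (Fin 2) ℂ) : Matrix (Fin 2) (Fin 2) ℂ) := by
        simp only [adSigma3, mul_assoc]
    _ = 1 := by rw [h1, mul_one, mul_assoc (g : Matrix (Fin 2) (Fin 2) ℂ), h3, mul_one, h2]

/-- Conjugation by the involution n fixes L and negates X but preserves the trace. Thus matrices
commuting with n are orthogonal to the tangent space of the orbit. -/
theorem trace_mul_eq_zero_of_anticommute {n L X : Matrix (Fin 2) (Fin 2) ℂ} (hn : n * n = 1)
    (hL : n * L = L * n) (hX : n * X + X * n = 0) : (L * X).trace = 0 := by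
  have h1 : X * n = -(n * X) := eq_neg_of_add_eq_zero_right hX
  have h2 : (L * X).trace = -(L * X).trace := by
    calc (L * X).trace = (L * X * (n * n)).trace := by rw [hn, mul_one]
      _ = (L * (X * n) * n).trace := by simp only [mul_assoc]
      _ = -((L * n) * X * n).trace := by
        rw [h1, mul_neg, neg_mul, Matrix.trace_neg]; simp only [mul_assoc]
      _ = -(n * (L * X * n)).trace := by rw [← hL]; simp only [mul_assoc]
      _ = -((L * X * n) * n).trace := by rw [Matrix.trace_mul_comm]
      _ = -(L * X).trace := by rw [mul_assoc, hn, mul_one]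
  exact self_eq_neg.1 h2

theorem matDeriv_congr {n m : ℂ → Matrix (Fin 2) (Fin 2) ℂ} {z : ℂ} (h : n =ᶠ[nhds z] m) (v : ℂ) :
    matDeriv n z v = matDeriv m z v := by
  ext i j
  have : (fun ζ => n ζ i j) =ᶠ[nhds z] fun ζ => m ζ i j := h.mono fun ζ hζ => by simp only [hζ]
  simp only [matDeriv, Matrix.of_apply, this.fderiv_eq (𝕜 := ℝ)]

theorem matLap_congr {n m : ℂ → Matrix (Fin 2) (Fin 2) ℂ} {z : ℂ} (h : n =ᶠ[nhds z] m) :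
    matLap n z = matLap m z := by
  have h1 : ∀ v, (fun ζ => matDeriv n ζ v) =ᶠ[nhds z] fun ζ => matDeriv m ζ v := fun v =>
    h.eventually_nhds.mono fun ζ hζ => matDeriv_congr hζ v
  simp only [matLap, matDeriv_congr (h1 _)]

theorem contDiffOn_matLap {D : Set ℂ} {n : ℂ → Matrix (Fin 2) (Fin 2) ℂ} (hD : IsOpen D)
    (hn : ∀ i j, ContDiffOn ℝ ∞ (fun z => n z i j) D) (i j : Fin 2) :
    ContDiffOn ℝ ∞ (fun z => matLap n z i j) D := by
  have h2 : ∀ v, ContDiffOn ℝ ∞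
      (fun z => fderiv ℝ (fun ζ => fderiv ℝ (fun ζ => n ζ i j) ζ v) z v) D := fun v =>
    contDiffOn_fderiv_apply hD (contDiffOn_fderiv_apply hD (hn i j) v) v
  exact (h2 1).add (h2 Complex.I)

section Harmonic

variable {D : Set ℂ} {n : ℂ → Matrix (Fin 2) (Fin 2) ℂ} (hD : IsOpen D)
  (hn : ∀ i j, ContDiffOn ℝ ∞ (fun z => n z i j) D)
include hD

/-- The t-derivative of Φ² = 1 at t = 0. -/
theorem variationField_anticommute {Φ : ℝ → ℂ → Matrix (Fin 2) (Fin 2) ℂ}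
    (hΦ : ∀ i j, ContDiffOn ℝ ∞ (fun p : ℝ × ℂ => Φ p.1 p.2 i j) (Set.univ ×ˢ D))
    (hS : ∀ t, ∀ z ∈ D, Φ t z ∈ symmetricSpace) {z : ℂ} (hz : z ∈ D) :
    Φ 0 z * variationField Φ z + variationField Φ z * Φ 0 z = 0 := by
  have hd : ∀ i j, HasDerivAt (fun t => Φ t z i j) (variationField Φ z i j) 0 := by
    intro i j
    rw [variationField_apply hD hΦ hz]
    exact hasDerivAt_slice (differentiableAt_of_contDiffOn (isOpen_univ.prod hD) (hΦ i j)
      (x := ((0 : ℝ), z)) ⟨Set.mem_univ _, hz⟩)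
  ext i j
  have h1 : HasDerivAt (fun t => (Φ t z * Φ t z) i j)
      ((Φ 0 z * variationField Φ z + variationField Φ z * Φ 0 z) i j) 0 := by
    have k := ((hd i 0).mul (hd 0 j)).add ((hd i 1).mul (hd 1 j))
    refine (k.congr_deriv ?_).congr_of_eventuallyEq (Filter.Eventually.of_forall fun t => ?_)
    · simp only [Matrix.add_apply, Matrix.mul_apply, Fin.sum_univ_two]; ring
    · simp only [Matrix.mul_apply, Fin.sum_univ_two]; rfl
  have h2 : (fun t => (Φ t z * Φ t z) i j) = fun _ => (1 : Matrix (Fin 2) (Fin 2) ℂ) i j := by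
    ext t; rw [mul_self_of_mem_symmetricSpace (hS t z hz)]
  rw [h2] at h1
  exact h1.unique (hasDerivAt_const _ _)

include hn

theorem isHarmonicOn_of_commute (hS : ∀ z ∈ D, n z ∈ symmetricSpace)
    (hc : ∀ z ∈ D, n z * matLap n z = matLap n z * n z) : IsHarmonicOn D n := by
  refine ⟨hn, hS, fun K Φ hV => ?_⟩
  obtain ⟨hK, hKD, hΦ, hΦS, hΦ0, hΦK⟩ := hV
  have h0 : ∀ z ∈ D \ K, variationField Φ z = 0 := by
    intro z hz
    ext i j
    have : (fun t => Φ t z i j) = fun _ => n z i j := by ext t; rw [hΦK t z hz]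
    simp [variationField, this]
  convert hasDerivAt_energy hD hK hKD hΦ h0 using 1
  rw [eq_comm, neg_eq_zero]
  refine setIntegral_eq_zero_of_forall_eq_zero fun z hz => ?_
  have hzD := hKD hz
  have hev : Φ 0 =ᶠ[nhds z] n := by
    filter_upwards [hD.mem_nhds hzD] with ζ hζ using hΦ0 ζ hζ
  have hA := variationField_anticommute hD hΦ hΦS hzD
  rw [hΦ0 z hzD] at hA
  rw [matLap_congr hev, trace_mul_eq_zero_of_anticommute
    (mul_self_of_mem_symmetricSpace (hS z hzD)) (hc z hzD) hA]
  rfl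

/-- Since Z² = 0, the inverse of 1 + cZ is 1 - cZ. Conjugating n by 1 + tχZ therefore stays in the
orbit and is polynomial in t, with variation field χ[Z, n]. As tr(Δn [Z, n]) = tr(Z [n, Δn]), the
first variation formula and arbitrary cutoffs χ give the claim. -/
theorem re_trace_eq_zero_of_isHarmonicOn (hH : IsHarmonicOn D n)
    {Z : Matrix (Fin 2) (Fin 2) ℂ} (hZ : Z * Z = 0) {z : ℂ} (hz : z ∈ D) :
    (Z * (n z * matLap n z - matLap n z * n z)).trace.re = 0 := by
  set g : ℂ → ℝ := fun z => (Z * (n z * matLap n z - matLap n z * n z)).trace.re with hg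
  have hgc : ContinuousOn g D := by
    have hL := fun i j => (contDiffOn_matLap hD hn i j).continuousOn
    have hn' := fun i j => (hn i j).continuousOn
    refine Complex.continuous_re.comp_continuousOn ?_
    simp only [Matrix.trace, Matrix.diag, Matrix.mul_apply, Matrix.sub_apply, Fin.sum_univ_two]
    fun_prop
  have hae : ∀ᵐ z ∂(volume : Measure ℂ), z ∈ D → g z = 0 := by
    refine hD.ae_eq_zero_of_integral_contDiff_smul_eq_zero
      (hgc.locallyIntegrableOn hD.measurableSet) fun χ hχ hχc hχD => ?_
    set Φ : ℝ → ℂ → Matrix (Fin 2) (Fin 2) ℂ := fun t z =>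
      (1 + ((t * χ z : ℝ) : ℂ) • Z) * n z * (1 - ((t * χ z : ℝ) : ℂ) • Z) with hΦdef
    have hinv : ∀ c : ℂ, (1 + c • Z) * (1 - c • Z) = 1 := fun c => by
      simp [add_mul, mul_sub, hZ]
    have hinv' : ∀ c : ℂ, (1 - c • Z) * (1 + c • Z) = 1 := fun c => by
      simp [sub_mul, mul_add, hZ]
    have hχ2 : ContDiffOn ℝ ∞ (fun p : ℝ × ℂ => ((p.1 * χ p.2 : ℝ) : ℂ)) (Set.univ ×ˢ D) :=
      (Complex.ofRealCLM.contDiff.comp (contDiff_fst.mul (hχ.comp contDiff_snd))).contDiffOn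
    have hn2 : ∀ i j, ContDiffOn ℝ ∞ (fun p : ℝ × ℂ => n p.2 i j) (Set.univ ×ˢ D) := fun i j =>
      (hn i j).comp contDiffOn_snd fun p hp => hp.2
    have hΦ : ∀ i j, ContDiffOn ℝ ∞ (fun p : ℝ × ℂ => Φ p.1 p.2 i j) (Set.univ ×ˢ D) := by
      intro i j
      simp only [hΦdef, Matrix.mul_apply, Fin.sum_univ_two, Matrix.add_apply, Matrix.sub_apply,
        Matrix.smul_apply, smul_eq_mul]
      have hp := fun i j => (contDiffOn_const (c := (1 : Matrix (Fin 2) (Fin 2) ℂ) i j)).add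
        (hχ2.mul (contDiffOn_const (c := Z i j)))
      have hm := fun i j => (contDiffOn_const (c := (1 : Matrix (Fin 2) (Fin 2) ℂ) i j)).sub
        (hχ2.mul (contDiffOn_const (c := Z i j)))
      exact ((((hp i 0).mul (hn2 0 0)).add ((hp i 1).mul (hn2 1 0))).mul (hm 0 j)).add
        ((((hp i 0).mul (hn2 0 1)).add ((hp i 1).mul (hn2 1 1))).mul (hm 1 j))
    have hV : IsVariationOn D (tsupport χ) n Φ := by
      refine ⟨hχc, hχD, hΦ, fun t z hz => ?_, fun z hz => by simp [hΦdef], fun t z hz => ?_⟩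
      · obtain ⟨F, hF⟩ := hH.2.1 z hz
        refine ⟨⟨1 + ((t * χ z : ℝ) : ℂ) • Z, 1 - ((t * χ z : ℝ) : ℂ) • Z, hinv _, hinv' _⟩ * F, ?_⟩
        simp only [hΦdef, ← hF, adSigma3, mul_inv_rev, Units.val_mul, Units.inv_mk, mul_assoc]
      · have : χ z = 0 := image_eq_zero_of_notMem_tsupport hz.2
        simp [hΦdef, this]
    have hd : ∀ z ∈ D, variationField Φ z = (χ z : ℂ) • (Z * n z - n z * Z) := by
      intro z hz
      ext i j
      have h1 : HasDerivAt (fun t : ℝ => ((t * χ z : ℝ) : ℂ)) (χ z : ℂ) 0 := by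
        simpa using ((hasDerivAt_id (0 : ℝ)).mul_const (χ z)).ofReal_comp
      have e : (fun t => Φ t z i j) = fun t : ℝ => n z i j
          + ((t * χ z : ℝ) : ℂ) * ((Z * n z - n z * Z) i j)
          - ((t * χ z : ℝ) : ℂ) * (((t * χ z : ℝ) : ℂ) * (Z * n z * Z) i j) := by
        ext t
        simp only [hΦdef]
        have : ∀ c : ℂ, (1 + c • Z) * n z * (1 - c • Z)
            = n z + c • (Z * n z - n z * Z) - c • (c • (Z * n z * Z)) := by
          intro c
          simp only [add_mul, mul_sub, one_mul, mul_one, smul_mul_assoc, mul_smul_comm]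
          module
        rw [this]
        simp
      have h2 := ((h1.mul_const ((Z * n z - n z * Z) i j)).const_add (n z i j)).sub
        (h1.mul (h1.mul_const ((Z * n z * Z) i j)))
      simp only [variationField, Matrix.of_apply, e]
      refine h2.deriv.trans ?_
      simp
    have h0 : ∀ z ∈ D \ tsupport χ, variationField Φ z = 0 := by
      intro z hz
      rw [hd z hz.1, image_eq_zero_of_notMem_tsupport hz.2]
      simp
    have e1 := (hasDerivAt_energy hD hχc hχD hΦ h0).unique (hH.2.2 _ _ hV)
    rw [neg_eq_zero] at e1
    rw [← e1, ← setIntegral_eq_integral_of_forall_compl_eq_zero (s := tsupport χ)]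
    · refine setIntegral_congr_fun hχc.measurableSet fun z hz => ?_
      have hzD := hχD hz
      have hev : Φ 0 =ᶠ[nhds z] n := Filter.Eventually.of_forall fun ζ => by simp [hΦdef]
      simp only [hd z hzD, matLap_congr hev, hg, mul_smul_comm, Matrix.trace_smul, smul_eq_mul,
        mul_sub, Matrix.trace_sub]
      have t1 : (Z * (matLap n z * n z)).trace = (matLap n z * (n z * Z)).trace := by
        rw [Matrix.trace_mul_comm, mul_assoc]
      have t2 : (Z * (n z * matLap n z)).trace = (matLap n z * (Z * n z)).trace := by
        rw [← mul_assoc, Matrix.trace_mul_comm]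
      rw [t1, t2, ← mul_sub, Complex.re_ofReal_mul]
    · intro z hz
      rw [image_eq_zero_of_notMem_tsupport hz, zero_smul]
  -- Continuity upgrades vanishing almost everywhere to vanishing at every point of `D`.
  have := Measure.eqOn_open_of_ae_eq (μ := (volume : Measure ℂ)) (f := g) (g := fun _ => 0)
    ((ae_restrict_iff' hD.measurableSet).2 hae) hD hgc continuousOn_const
  exact this hz

/-- Using both Z and iZ removes the real part from the previous lemma. The commutator is trace free,
and three nilpotent matrices spanning the trace-free matrices detect all its entries. -/
theorem commute_of_isHarmonicOn (hH : IsHarmonicOn D n) {z : ℂ} (hz : z ∈ D) :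
    n z * matLap n z = matLap n z * n z := by
  set M := n z * matLap n z - matLap n z * n z with hM
  have key : ∀ Z : Matrix (Fin 2) (Fin 2) ℂ, Z * Z = 0 → (Z * M).trace = 0 := by
    intro Z hZ
    have h1 := re_trace_eq_zero_of_isHarmonicOn hD hn hH hZ hz
    have h2 := re_trace_eq_zero_of_isHarmonicOn hD hn hH (Z := Complex.I • Z)
      (by rw [smul_mul_smul_comm, hZ, smul_zero]) hz
    rw [smul_mul_assoc, Matrix.trace_smul] at h2
    simp at h2
    exact Complex.ext h1 h2
  have htr : M.trace = 0 := by rw [hM, Matrix.trace_sub, Matrix.trace_mul_comm, sub_self]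
  have k1 := key !![0, 1; 0, 0] (by ext i j; fin_cases i <;> fin_cases j <;> simp)
  have k2 := key !![0, 0; 1, 0] (by ext i j; fin_cases i <;> fin_cases j <;> simp)
  have k3 := key !![1, -1; 1, -1] (by ext i j; fin_cases i <;> fin_cases j <;> simp)
  rw [← sub_eq_zero, ← hM]
  clear_value M
  simp only [Matrix.trace_fin_two, Matrix.mul_apply, Fin.sum_univ_two, Matrix.of_apply,
    Matrix.cons_val', Matrix.cons_val_zero, Matrix.cons_val_one, Matrix.cons_val_fin_one, zero_mul,
    one_mul, zero_add, add_zero, neg_mul] at k1 k2 k3 htr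
  have h11 : M 1 1 = 0 := by linear_combination (1 / 2) * (htr - k3 - k1 + k2)
  have h00 : M 0 0 = 0 := by linear_combination htr - h11
  ext i j
  fin_cases i <;> fin_cases j <;> simp [h00, h11, k1, k2]

end Harmonic

end Nil3

namespace Nil3

/-! ### Harmonicity of `Ad(F) σ₃` -/

/-- The entrywise Wirtinger derivative `∂_z` of a matrix valued function. -/
noncomputable def matDz (M : ℂ → Matrix (Fin 2) (Fin 2) ℂ) (z : ℂ) : Matrix (Fin 2) (Fin 2) ℂ :=
  Matrix.of fun i j => dz (fun ζ => M ζ i j) z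

/-- The entrywise Wirtinger derivative `∂_{\bar z}` of a matrix valued function. -/
noncomputable def matDzbar (M : ℂ → Matrix (Fin 2) (Fin 2) ℂ) (z : ℂ) :
    Matrix (Fin 2) (Fin 2) ℂ :=
  Matrix.of fun i j => dzbar (fun ζ => M ζ i j) z

section

variable {A B : ℂ → Matrix (Fin 2) (Fin 2) ℂ} {z : ℂ}

theorem matDz_mul (hA : ∀ i j, DifferentiableAt ℝ (fun ζ => A ζ i j) z)
    (hB : ∀ i j, DifferentiableAt ℝ (fun ζ => B ζ i j) z) :
    matDz (fun ζ => A ζ * B ζ) z = matDz A z * B z + A z * matDz B z ∧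
    matDzbar (fun ζ => A ζ * B ζ) z = matDzbar A z * B z + A z * matDzbar B z := by
  have k : ∀ i j, HasWirtingerAt (fun ζ => (A ζ * B ζ) i j)
      ((matDz A z * B z + A z * matDz B z) i j) ((matDzbar A z * B z + A z * matDzbar B z) i j) z := by
    intro i j
    have w := fun k => (hasWirtingerAt_of_differentiableAt (hA i k)).mul
      (hasWirtingerAt_of_differentiableAt (hB k j))
    refine (((w 0).add (w 1)).congr_of_eventuallyEq
      (Filter.Eventually.of_forall fun ζ => ?_)).congr_coeff ?_ ?_
    · simp only [Matrix.mul_apply, Fin.sum_univ_two]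
    · simp only [Matrix.add_apply, Matrix.mul_apply, Fin.sum_univ_two, matDz, Matrix.of_apply]; ring
    · simp only [Matrix.add_apply, Matrix.mul_apply, Fin.sum_univ_two, matDzbar, Matrix.of_apply]
      ring
  exact ⟨Matrix.ext fun i j => (k i j).dz_eq, Matrix.ext fun i j => (k i j).dzbar_eq⟩

theorem matDz_congr (h : A =ᶠ[nhds z] B) : matDz A z = matDz B z ∧ matDzbar A z = matDzbar B z := by
  have e : ∀ i j, fderiv ℝ (fun ζ => A ζ i j) z = fderiv ℝ (fun ζ => B ζ i j) z := fun i j =>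
    Filter.EventuallyEq.fderiv_eq (h.mono fun ζ hζ => by simp only [hζ])
  constructor <;> ext i j <;> simp only [matDz, matDzbar, dz, dzbar, Matrix.of_apply, e]

theorem matLap_eq {D : Set ℂ} (hD : IsOpen D) (hA : ∀ i j, ContDiffOn ℝ ∞ (fun z => A z i j) D)
    (hz : z ∈ D) : matLap A z = (4 : ℂ) • matDzbar (matDz A) z := by
  ext i j
  have hg := hA i j
  have h1 := differentiableAt_of_contDiffOn hD (contDiffOn_fderiv_apply hD hg 1) hz
  have h2 := differentiableAt_of_contDiffOn hD (contDiffOn_fderiv_apply hD hg Complex.I) hz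
  have k1 := hasWirtingerAt_of_differentiableAt h1
  have k2 := hasWirtingerAt_of_differentiableAt h2
  have a2 := (((k1.sub (k2.const_mul Complex.I)).const_mul (1 / 2)).congr_of_eventuallyEq
    (k := fun ζ => matDz A ζ i j) (Filter.Eventually.of_forall fun ζ => by
      simp only [matDz, dz, Matrix.of_apply]; ring)).dzbar_eq
  have := fderiv_fderiv_comm hD hg hz 1 Complex.I
  simp only [matLap, Matrix.add_apply, matDeriv, Matrix.of_apply, Matrix.smul_apply, smul_eq_mul]
  rw [matDzbar, Matrix.of_apply, a2]
  simp only [dzbar]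
  rw [this]
  linear_combination
    (fderiv ℝ (fun ζ => fderiv ℝ (fun ζ => A ζ i j) ζ Complex.I) z Complex.I) * Complex.I_sq

end

section Fundamental

variable {D : Set ℂ} {U V : ℂ → Matrix (Fin 2) (Fin 2) ℂ} {F : ℂ → GL (Fin 2) ℂ}
  (hD : IsOpen D)
  (hF : ∀ i j, ContDiffOn ℝ ∞ (fun z => (F z : Matrix (Fin 2) (Fin 2) ℂ) i j) D)
include hD hF

omit hD hF in
theorem adSigma3_mul (g : GL (Fin 2) ℂ) : adSigma3 g * (g : Matrix (Fin 2) (Fin 2) ℂ)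
    = (g : Matrix (Fin 2) (Fin 2) ℂ) * sigma3 := by
  rw [adSigma3, mul_assoc, ← Units.val_mul, inv_mul_cancel, Units.val_one, mul_one]

omit hD in
theorem contDiffOn_units_inv (i j : Fin 2) :
    ContDiffOn ℝ ∞ (fun z => ((F z)⁻¹ : GL (Fin 2) ℂ).val i j) D := by
  have hdet : ContDiffOn ℝ ∞ (fun z => (F z : Matrix (Fin 2) (Fin 2) ℂ).det⁻¹) D := by
    refine ContDiffOn.inv ?_ fun z _ => ((Matrix.isUnit_iff_isUnit_det _).1 (F z).isUnit).ne_zero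
    simp only [Matrix.det_fin_two]
    exact ((hF 0 0).mul (hF 1 1)).sub ((hF 0 1).mul (hF 1 0))
  have e : ∀ z, ((F z)⁻¹ : GL (Fin 2) ℂ).val i j
      = (F z : Matrix (Fin 2) (Fin 2) ℂ).det⁻¹ * (F z).val.adjugate i j := by
    intro z
    rw [Matrix.coe_units_inv, Matrix.inv_def, Matrix.smul_apply, smul_eq_mul,
      Ring.inverse_eq_inv']
  simp only [e, Matrix.adjugate_fin_two]
  refine hdet.mul ?_
  fin_cases i <;> fin_cases j
  · exact hF 1 1
  · exact (hF 0 1).neg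
  · exact (hF 1 0).neg
  · exact hF 0 0

omit hD in
theorem contDiffOn_adSigma3 (i j : Fin 2) : ContDiffOn ℝ ∞ (fun z => adSigma3 (F z) i j) D := by
  have hinv := contDiffOn_units_inv hF
  simp only [adSigma3, sigma3, Matrix.mul_apply, Fin.sum_univ_two]
  exact ((((hF i 0).mul contDiffOn_const).add ((hF i 1).mul contDiffOn_const)).mul (hinv 0 j)).add
    ((((hF i 0).mul contDiffOn_const).add ((hF i 1).mul contDiffOn_const)).mul (hinv 1 j))

variable (hU : ∀ i j, ContDiffOn ℝ ∞ (fun z => U z i j) D)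
  (hFU : ∀ z ∈ D, matDz (fun ζ => (F ζ : Matrix (Fin 2) (Fin 2) ℂ)) z = (F z).val * U z)
  (hFV : ∀ z ∈ D, matDzbar (fun ζ => (F ζ : Matrix (Fin 2) (Fin 2) ℂ)) z = (F z).val * V z)
include hU hFU hFV

omit hD hF hU hFU hFV in
theorem mul_sigma3_sub (X : Matrix (Fin 2) (Fin 2) ℂ) :
    X * sigma3 - sigma3 * X = !![0, -2 * X 0 1; 2 * X 1 0, 0] := by
  ext i j
  fin_cases i <;> fin_cases j <;>
    simp [sigma3, Matrix.mul_apply, Matrix.vecMul, dotProduct, Fin.sum_univ_two] <;> ring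

/-- The tension field of `Ad(F) σ₃` in the frame `F`. -/
theorem matLap_adSigma3_mul {z : ℂ} (hz : z ∈ D) :
    matLap (fun ζ => adSigma3 (F ζ)) z * (F z).val = (4 : ℂ) • ((F z).val *
      (matDzbar (fun ζ => U ζ * sigma3 - sigma3 * U ζ) z
        + (V z * (U z * sigma3 - sigma3 * U z) - (U z * sigma3 - sigma3 * U z) * V z))) := by
  set n : ℂ → Matrix (Fin 2) (Fin 2) ℂ := fun ζ => adSigma3 (F ζ) with hn
  set G : ℂ → Matrix (Fin 2) (Fin 2) ℂ := fun ζ => (F ζ).val with hG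
  set W : ℂ → Matrix (Fin 2) (Fin 2) ℂ := fun ζ => U ζ * sigma3 - sigma3 * U ζ with hW
  have hns := contDiffOn_adSigma3 hF
  have hnd := fun ζ (hζ : ζ ∈ D) i j => differentiableAt_of_contDiffOn hD (hns i j) hζ
  have hGd := fun ζ (hζ : ζ ∈ D) i j => differentiableAt_of_contDiffOn hD (hF i j) hζ
  have hσ : ∀ ζ i j, DifferentiableAt ℝ (fun _ : ℂ => sigma3 i j) ζ := fun ζ i j =>
    differentiableAt_const _
  have hσ0 : ∀ ζ, matDz (fun _ => sigma3) ζ = 0 := fun ζ => by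
    ext i j; exact (HasWirtingerAt.const (sigma3 i j) ζ).dz_eq
  have hnG : (fun ζ => n ζ * G ζ) = fun ζ => G ζ * sigma3 := funext fun ζ => adSigma3_mul (F ζ)
  -- Differentiating nF = Fσ₃ in z gives n_z F = F[U, σ₃]. The same is done to this relation in \bar
  -- z, and Δ = 4∂_{\bar z}∂_z.
  have h1 : ∀ ζ ∈ D, matDz n ζ * G ζ = G ζ * W ζ := by
    intro ζ hζ
    have e1 := (matDz_mul (hnd ζ hζ) (hGd ζ hζ)).1
    have e2 := (matDz_mul (hGd ζ hζ) (hσ ζ)).1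
    change matDz (fun ζ => n ζ * G ζ) ζ = _ at e1
    rw [hnG, e2, hσ0, hFU ζ hζ, mul_zero, add_zero] at e1
    change G ζ * U ζ * sigma3 = matDz n ζ * G ζ + n ζ * (G ζ * U ζ) at e1
    rw [← mul_assoc, congrFun hnG ζ] at e1
    rw [hW, mul_sub, ← mul_assoc, ← mul_assoc, e1, add_sub_cancel_right]
  have hWs : ∀ i j, ContDiffOn ℝ ∞ (fun ζ => W ζ i j) D := by
    intro i j
    simp only [hW, Matrix.sub_apply, Matrix.mul_apply, Fin.sum_univ_two]
    exact (((hU i 0).mul contDiffOn_const).add ((hU i 1).mul contDiffOn_const)).sub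
      ((contDiffOn_const.mul (hU 0 j)).add (contDiffOn_const.mul (hU 1 j)))
  have hn1 : ∀ i j, DifferentiableAt ℝ (fun ζ => matDz n ζ i j) z := fun i j =>
    differentiableAt_of_contDiffOn hD (contDiffOn_dz hD (hns i j)) hz
  have hW1 := fun i j => differentiableAt_of_contDiffOn hD (hWs i j) hz
  have e1 := (matDz_mul hn1 (hGd z hz)).2
  have e2 := (matDz_mul (hGd z hz) hW1).2
  have e3 : matDzbar (fun ζ => matDz n ζ * G ζ) z = matDzbar (fun ζ => G ζ * W ζ) z :=
    (matDz_congr (by filter_upwards [hD.mem_nhds hz] with ζ hζ using h1 ζ hζ)).2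
  change matDzbar (fun ζ => matDz n ζ * G ζ) z = _ at e1
  change matDzbar (fun ζ => G ζ * W ζ) z = _ at e2
  rw [e1, e2, hFV z hz] at e3
  change matDzbar (matDz n) z * G z + matDz n z * (G z * V z)
    = G z * V z * W z + G z * matDzbar W z at e3
  rw [← mul_assoc, h1 z hz] at e3
  rw [matLap_eq hD hns hz, smul_mul_assoc]
  congr 1
  change matDzbar (matDz n) z * G z = G z * (matDzbar W z + (V z * W z - W z * V z))
  generalize W z = X at e3 ⊢
  rw [eq_sub_of_add_eq e3, mul_add, mul_sub]
  simp only [mul_assoc]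
  abel

/-- The harmonic map equation for `Ad(F) σ₃`, in terms of the connection form. -/
theorem isHarmonicOn_adSigma3_iff : IsHarmonicOn D (fun z => adSigma3 (F z)) ↔ ∀ z ∈ D,
    dzbar (fun ζ => U ζ 0 1) z + (V z 0 0 - V z 1 1) * U z 0 1 = 0 ∧
    dzbar (fun ζ => U ζ 1 0) z + (V z 1 1 - V z 0 0) * U z 1 0 = 0 := by
  have hns := contDiffOn_adSigma3 hF
  have hmem : ∀ z ∈ D, adSigma3 (F z) ∈ symmetricSpace := fun z _ => ⟨F z, rfl⟩
  have h1 : IsHarmonicOn D (fun z => adSigma3 (F z)) ↔ ∀ z ∈ D, adSigma3 (F z)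
      * matLap (fun z => adSigma3 (F z)) z = matLap (fun z => adSigma3 (F z)) z * adSigma3 (F z) :=
    ⟨fun h z hz => commute_of_isHarmonicOn hD hns h hz, isHarmonicOn_of_commute hD hns hmem⟩
  rw [h1]
  refine forall₂_congr fun z hz => ?_
  set M := matDzbar (fun ζ => U ζ * sigma3 - sigma3 * U ζ) z
    + (V z * (U z * sigma3 - sigma3 * U z) - (U z * sigma3 - sigma3 * U z) * V z) with hM
  have key := matLap_adSigma3_mul hD hF hU hFU hFV hz
  rw [← hM] at key
  set L := matLap (fun z => adSigma3 (F z)) z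
  have hs := adSigma3_mul (F z)
  -- In the frame F, n becomes σ₃ and Δn becomes 4M; σ₃ commutes exactly with diagonal matrices.
  have h2 : adSigma3 (F z) * L = L * adSigma3 (F z) ↔ sigma3 * M = M * sigma3 := by
    rw [← Units.mul_left_inj (F z), mul_assoc, key, mul_assoc L, hs, ← mul_assoc L, key,
      mul_smul_comm, smul_mul_assoc, ← mul_assoc, hs, mul_assoc, mul_assoc,
      smul_right_inj (by norm_num : (4 : ℂ) ≠ 0), Units.mul_right_inj]
  rw [h2]
  have hUd := fun i j => hasWirtingerAt_of_contDiffOn hD (hU i j) hz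
  have w01 : dzbar (fun ζ => (U ζ * sigma3 - sigma3 * U ζ) 0 1) z
      = -2 * dzbar (fun ζ => U ζ 0 1) z :=
    (((hUd 0 1).const_mul (-2)).congr_of_eventuallyEq (Filter.Eventually.of_forall fun ζ => by
      rw [mul_sigma3_sub]; simp)).dzbar_eq
  have w10 : dzbar (fun ζ => (U ζ * sigma3 - sigma3 * U ζ) 1 0) z
      = 2 * dzbar (fun ζ => U ζ 1 0) z :=
    (((hUd 1 0).const_mul 2).congr_of_eventuallyEq (Filter.Eventually.of_forall fun ζ => by
      rw [mul_sigma3_sub]; simp)).dzbar_eq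
  -- [U, σ₃] is off-diagonal, so only the diagonal of V contributes to these entries.
  have m01 : M 0 1 = -2 * (dzbar (fun ζ => U ζ 0 1) z + (V z 0 0 - V z 1 1) * U z 0 1) := by
    rw [hM, Matrix.add_apply, matDzbar, Matrix.of_apply, w01, mul_sigma3_sub]
    simp [Matrix.mul_apply, Matrix.vecMul, dotProduct, Fin.sum_univ_two]; ring
  have m10 : M 1 0 = 2 * (dzbar (fun ζ => U ζ 1 0) z + (V z 1 1 - V z 0 0) * U z 1 0) := by
    rw [hM, Matrix.add_apply, matDzbar, Matrix.of_apply, w10, mul_sigma3_sub]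
    simp [Matrix.mul_apply, Matrix.vecMul, dotProduct, Fin.sum_univ_two]; ring
  have h3 : sigma3 * M = M * sigma3 ↔ M 0 1 = 0 ∧ M 1 0 = 0 := by
    clear_value M
    constructor
    · intro e
      have e1 := congrFun (congrFun e 0) 1
      have e2 := congrFun (congrFun e 1) 0
      simp [sigma3, Matrix.mul_apply, Fin.sum_univ_two] at e1 e2
      exact ⟨self_eq_neg.1 e1, neg_eq_self.1 e2⟩
    · rintro ⟨e1, e2⟩
      ext i j
      fin_cases i <;> fin_cases j <;>
        simp [sigma3, Matrix.mul_apply, Fin.sum_univ_two, e1, e2]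
  rw [h3, m01, m10]
  simp

end Fundamental

/-- For a fundamental solution `F`, the map `Ad(F) σ₃` is harmonic if and only if the mean
curvature is constant. -/
theorem hasConstantMeanCurvatureOn_iff_isHarmonicOn {D : Set ℂ} {f : ℂ → Nil3} {w : ℂ → ℂ}
    (hD : IsOpen D) (hDc : IsPreconnected D) (hf : IsConformalImmersionOn D f)
    (hw : ContDiffOn ℝ ∞ w D) (hwf : ∀ z ∈ D, Complex.exp (w z / 2) = diracPotential f z)
    {F : ℂ → GL (Fin 2) ℂ} (hF : IsFundamentalSolutionOn D f w F) :
    HasConstantMeanCurvatureOn D f ↔ IsHarmonicOn D (fun z => adSigma3 (F z)) := by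
  rw [isHarmonicOn_adSigma3_iff hD hF.1 (contDiffOn_matU hD hf hw hwf 1)
    (fun z hz => Matrix.ext (hF.2 z hz).1) (fun z hz => Matrix.ext (hF.2 z hz).2)]
  constructor
  · rintro ⟨c, hc⟩ z hz
    have hB := hasWirtingerAt_of_contDiffOn hD (contDiffOn_abreschRosenberg hD hf hw hwf) hz
    rw [(gauss_codazzi hD hf hw hwf hc hz).1] at hB
    have hE := (hasWirtingerAt_exp hD hw hz).neg.dzbar_eq
    have hBk := (hB.mul (hasWirtingerAt_exp_div hD hw hz 2)).dzbar_eq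
    rw [matV_eq hD hc 1 hz]
    simp only [matU, Matrix.of_apply, Matrix.cons_val', Matrix.cons_val_zero, Matrix.cons_val_one,
      Matrix.cons_val_fin_one, inv_one, one_mul]
    rw [hE, hBk]
    constructor <;> ring
  · intro h
    refine hasConstantMeanCurvatureOn_of_dzbar hD hDc (contDiffOn_meanCurvature hD hf hw hwf)
      fun z hz => ?_
    -- This equation alone suffices: the w_{\bar z} terms cancel and H_{\bar z}e^{u/2}/2 = 0
    -- remains.
    have h1 := (h z hz).1
    have hE := (hasWirtingerAt_exp hD hw hz).neg.dzbar_eq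
    simp only [matU, matV, Matrix.of_apply, Matrix.cons_val', Matrix.cons_val_zero,
      Matrix.cons_val_one, Matrix.cons_val_fin_one, inv_one, one_mul] at h1
    rw [hE] at h1
    have hu : (expHalfU f z : ℂ) ≠ 0 := Complex.ofReal_ne_zero.2 (expHalfU_pos hf hz).ne'
    have hmul : dzbar (fun ζ => (meanCurvature f ζ : ℂ)) z
        * (Complex.exp (w z / 2) * Complex.exp (-w z / 2) * expHalfU f z) = 0 := by
      linear_combination 2 * h1
    rw [exp_mul_exp_neg, one_mul] at hmul
    exact (mul_eq_zero.1 hmul).resolve_right hu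

end Nil3

namespace Nil3

/-! ### Existence of fundamental solutions -/

/-- The Poincaré lemma for `a dz + b d\bar z` on a convex domain. -/
theorem exists_primitive {D : Set ℂ} (hD : IsOpen D) (hDc : Convex ℝ D) {a b : ℂ → ℂ}
    (ha : ContDiffOn ℝ ∞ a D) (hb : ContDiffOn ℝ ∞ b D) (hab : ∀ z ∈ D, dzbar a z = dz b z) :
    ∃ m : ℂ → ℂ, ContDiffOn ℝ ∞ m D ∧ ∀ z ∈ D, HasWirtingerAt m (a z) (b z) z := by
  have hω : ContDiffOn ℝ ∞ (fun z => wirtingerCLM (a z) (b z)) D := by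
    unfold wirtingerCLM
    exact (ha.smul contDiffOn_const).add (hb.smul contDiffOn_const)
  have hd : ∀ z ∈ D, ∀ v v', fderiv ℝ (fun z => wirtingerCLM (a z) (b z)) z v v'
      = fderiv ℝ a z v * v' + fderiv ℝ b z v * starRingEnd ℂ v' := by
    intro z hz v v'
    have h := ((differentiableAt_of_contDiffOn hD ha hz).hasFDerivAt.smul_const
      (ContinuousLinearMap.id ℝ ℂ)).add
      ((differentiableAt_of_contDiffOn hD hb hz).hasFDerivAt.smul_const
        (Complex.conjCLE : ℂ →L[ℝ] ℂ))
    rw [show fderiv ℝ (fun z => wirtingerCLM (a z) (b z)) z = _ from h.fderiv]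
    simp
  -- The derivative of a dz + b d\bar z is symmetric precisely because a_{\bar z} = b_z.
  obtain ⟨m, hm⟩ := hDc.exists_forall_hasFDerivAt_of_fderiv_symmetric hD
    (fun z hz => (differentiableAt_of_contDiffOn hD hω hz).differentiableWithinAt)
    fun z hz v v' => by
      have h1 := hasWirtingerAt_of_contDiffOn hD ha hz
      have h2 := hasWirtingerAt_of_contDiffOn hD hb hz
      rw [hd z hz, hd z hz, h1.fderiv_apply, h1.fderiv_apply, h2.fderiv_apply, h2.fderiv_apply,
        hab z hz]
      ring
  refine ⟨m, ?_, hm⟩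
  rw [contDiffOn_infty_iff_fderiv_of_isOpen hD]
  exact ⟨fun z hz => (hm z hz).differentiableAt.differentiableWithinAt,
    hω.congr fun z hz => (hm z hz).fderiv⟩

section Local

variable {D : Set ℂ} {U V : ℂ → Matrix (Fin 2) (Fin 2) ℂ} {r₀ r₁ : ℂ → ℂ}

/-- A nowhere vanishing solution `r` of `dr = r α`, with `α = U dz + V d\bar z` flat and trace free,
is the first row of a solution of determinant one. -/
theorem exists_frame_of_row (hD : IsOpen D) (hDc : Convex ℝ D)
    (hU : ∀ i j, ContDiffOn ℝ ∞ (fun z => U z i j) D)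
    (hV : ∀ i j, ContDiffOn ℝ ∞ (fun z => V z i j) D)
    (hUt : ∀ z ∈ D, U z 0 0 + U z 1 1 = 0) (hVt : ∀ z ∈ D, V z 0 0 + V z 1 1 = 0)
    (hflat : ∀ z ∈ D, ∀ i j, dz (fun ζ => V ζ i j) z - dzbar (fun ζ => U ζ i j) z
      + (U z * V z - V z * U z) i j = 0)
    (h₀ : ContDiffOn ℝ ∞ r₀ D) (h₁ : ContDiffOn ℝ ∞ r₁ D)
    (hr₀ : ∀ z ∈ D, HasWirtingerAt r₀ (r₀ z * U z 0 0 + r₁ z * U z 1 0)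
      (r₀ z * V z 0 0 + r₁ z * V z 1 0) z)
    (hr₁ : ∀ z ∈ D, HasWirtingerAt r₁ (r₀ z * U z 0 1 + r₁ z * U z 1 1)
      (r₀ z * V z 0 1 + r₁ z * V z 1 1) z)
    (hne : ∀ z ∈ D, r₀ z ≠ 0 ∨ r₁ z ≠ 0) :
    ∃ F : ℂ → Matrix (Fin 2) (Fin 2) ℂ, (∀ i j, ContDiffOn ℝ ∞ (fun z => F z i j) D) ∧
      ∀ z ∈ D, (F z).det = 1 ∧ matDz F z = F z * U z ∧ matDzbar F z = F z * V z := by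
  set N : ℂ → ℂ := fun z => r₀ z * starRingEnd ℂ (r₀ z) + r₁ z * starRingEnd ℂ (r₁ z) with hN
  have hNne : ∀ z ∈ D, N z ≠ 0 := by
    intro z hz
    have e : N z = ((Complex.normSq (r₀ z) + Complex.normSq (r₁ z) : ℝ) : ℂ) := by
      simp only [hN, Complex.mul_conj, Complex.ofReal_add]
    rw [e]
    refine Complex.ofReal_ne_zero.2 (ne_of_gt ?_)
    have p0 := Complex.normSq_nonneg (r₀ z)
    have p1 := Complex.normSq_nonneg (r₁ z)
    rcases hne z hz with h | h
    · have := Complex.normSq_pos.2 h; linarith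
    · have := Complex.normSq_pos.2 h; linarith
  have hNs : ContDiffOn ℝ ∞ N D :=
    (h₀.mul (contDiffOn_conj h₀)).add (h₁.mul (contDiffOn_conj h₁))
  set s₀ : ℂ → ℂ := fun z => -starRingEnd ℂ (r₁ z) * (N z)⁻¹ with hs₀
  set s₁ : ℂ → ℂ := fun z => starRingEnd ℂ (r₀ z) * (N z)⁻¹ with hs₁
  have k₀ : ContDiffOn ℝ ∞ s₀ D := (contDiffOn_conj h₁).neg.mul (hNs.inv hNne)
  have k₁ : ContDiffOn ℝ ∞ s₁ D := (contDiffOn_conj h₀).mul (hNs.inv hNne)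
  have hdet : ∀ z ∈ D, r₀ z * s₁ z - r₁ z * s₀ z = 1 := by
    intro z hz
    have := mul_inv_cancel₀ (hNne z hz)
    simp only [hs₀, hs₁]
    linear_combination this
  -- Only smoothness and the determinant condition r₀s₁ - r₁s₀ = 1 are needed of the provisional
  -- second row.
  clear_value s₀ s₁
  clear hs₀ hs₁ hNs hNne hN
  clear N
  -- Since α is trace free and the determinant is constant, ds - sα is proportional to r. The
  -- scalars `a` and `b` are read off with the determinant: ds = sα - (a dz + b d\bar z) r.
  set a : ℂ → ℂ := fun z => s₀ z * (dz s₁ z - (s₀ z * U z 0 1 + s₁ z * U z 1 1))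
    - s₁ z * (dz s₀ z - (s₀ z * U z 0 0 + s₁ z * U z 1 0)) with ha
  set b : ℂ → ℂ := fun z => s₀ z * (dzbar s₁ z - (s₀ z * V z 0 1 + s₁ z * V z 1 1))
    - s₁ z * (dzbar s₀ z - (s₀ z * V z 0 0 + s₁ z * V z 1 0)) with hb
  have has : ContDiffOn ℝ ∞ a D :=
    (k₀.mul ((contDiffOn_dz hD k₁).sub ((k₀.mul (hU 0 1)).add (k₁.mul (hU 1 1))))).sub
      (k₁.mul ((contDiffOn_dz hD k₀).sub ((k₀.mul (hU 0 0)).add (k₁.mul (hU 1 0)))))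
  have hbs : ContDiffOn ℝ ∞ b D :=
    (k₀.mul ((contDiffOn_dzbar hD k₁).sub ((k₀.mul (hV 0 1)).add (k₁.mul (hV 1 1))))).sub
      (k₁.mul ((contDiffOn_dzbar hD k₀).sub ((k₀.mul (hV 0 0)).add (k₁.mul (hV 1 0)))))
  have hs : ∀ z ∈ D, dz s₀ z = s₀ z * U z 0 0 + s₁ z * U z 1 0 - a z * r₀ z ∧
      dz s₁ z = s₀ z * U z 0 1 + s₁ z * U z 1 1 - a z * r₁ z ∧
      dzbar s₀ z = s₀ z * V z 0 0 + s₁ z * V z 1 0 - b z * r₀ z ∧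
      dzbar s₁ z = s₀ z * V z 0 1 + s₁ z * V z 1 1 - b z * r₁ z := by
    intro z hz
    have w₀ := hasWirtingerAt_of_contDiffOn hD k₀ hz
    have w₁ := hasWirtingerAt_of_contDiffOn hD k₁ hz
    have hc : HasWirtingerAt (fun ζ => r₀ ζ * s₁ ζ - r₁ ζ * s₀ ζ) 0 0 z :=
      (HasWirtingerAt.const 1 z).congr_of_eventuallyEq (by
        filter_upwards [hD.mem_nhds hz] with ζ hζ using hdet ζ hζ)
    obtain ⟨e1, e2⟩ := (((hr₀ z hz).mul w₁).sub ((hr₁ z hz).mul w₀)).unique hc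
    have d := hdet z hz
    have tU := hUt z hz
    have tV := hVt z hz
    have x1 : r₀ z * (dz s₁ z - (s₀ z * U z 0 1 + s₁ z * U z 1 1))
        - r₁ z * (dz s₀ z - (s₀ z * U z 0 0 + s₁ z * U z 1 0)) = 0 := by
      linear_combination e1 - (r₀ z * s₁ z - r₁ z * s₀ z) * tU
    have x2 : r₀ z * (dzbar s₁ z - (s₀ z * V z 0 1 + s₁ z * V z 1 1))
        - r₁ z * (dzbar s₀ z - (s₀ z * V z 0 0 + s₁ z * V z 1 0)) = 0 := by
      linear_combination e2 - (r₀ z * s₁ z - r₁ z * s₀ z) * tV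
    simp only [ha, hb]
    refine ⟨?_, ?_, ?_, ?_⟩
    · linear_combination s₀ z * x1 - (dz s₀ z - (s₀ z * U z 0 0 + s₁ z * U z 1 0)) * d
    · linear_combination s₁ z * x1 - (dz s₁ z - (s₀ z * U z 0 1 + s₁ z * U z 1 1)) * d
    · linear_combination s₀ z * x2 - (dzbar s₀ z - (s₀ z * V z 0 0 + s₁ z * V z 1 0)) * d
    · linear_combination s₁ z * x2 - (dzbar s₁ z - (s₀ z * V z 0 1 + s₁ z * V z 1 1)) * d
  clear_value a b
  -- Differentiating once more and using flatness leaves (a_{\bar z} - b_z) r = 0, and r never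
  -- vanishes.
  have hab : ∀ z ∈ D, dzbar a z = dz b z := by
    intro z hz
    have w₀ := hasWirtingerAt_of_contDiffOn hD k₀ hz
    have w₁ := hasWirtingerAt_of_contDiffOn hD k₁ hz
    have wa := hasWirtingerAt_of_contDiffOn hD has hz
    have wb := hasWirtingerAt_of_contDiffOn hD hbs hz
    have wU := fun i j => hasWirtingerAt_of_contDiffOn hD (hU i j) hz
    have wV := fun i j => hasWirtingerAt_of_contDiffOn hD (hV i j) hz
    obtain ⟨q1, q2, q3, q4⟩ := hs z hz
    have c0 := dz_dzbar_comm hD k₀ hz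
    have c1 := dz_dzbar_comm hD k₁ hz
    have nh := hD.mem_nhds hz
    rw [((((w₀.mul (wU 0 0)).add (w₁.mul (wU 1 0))).sub (wa.mul (hr₀ z hz))).congr_of_eventuallyEq
        (k := dz s₀) (by filter_upwards [nh] with ζ hζ using (hs ζ hζ).1)).dzbar_eq,
      ((((w₀.mul (wV 0 0)).add (w₁.mul (wV 1 0))).sub (wb.mul (hr₀ z hz))).congr_of_eventuallyEq
        (k := dzbar s₀) (by filter_upwards [nh] with ζ hζ using (hs ζ hζ).2.2.1)).dz_eq,
      q1, q2, q3, q4] at c0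
    rw [((((w₀.mul (wU 0 1)).add (w₁.mul (wU 1 1))).sub (wa.mul (hr₁ z hz))).congr_of_eventuallyEq
        (k := dz s₁) (by filter_upwards [nh] with ζ hζ using (hs ζ hζ).2.1)).dzbar_eq,
      ((((w₀.mul (wV 0 1)).add (w₁.mul (wV 1 1))).sub (wb.mul (hr₁ z hz))).congr_of_eventuallyEq
        (k := dzbar s₁) (by filter_upwards [nh] with ζ hζ using (hs ζ hζ).2.2.2)).dz_eq,
      q1, q2, q3, q4] at c1
    have f := hflat z hz
    have f00 := f 0 0
    have f01 := f 0 1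
    have f10 := f 1 0
    have f11 := f 1 1
    simp only [Matrix.sub_apply, Matrix.mul_apply, Fin.sum_univ_two] at f00 f01 f10 f11
    have y0 : r₀ z * (dzbar a z - dz b z) = 0 := by
      linear_combination c0 - s₀ z * f00 - s₁ z * f10
    have y1 : r₁ z * (dzbar a z - dz b z) = 0 := by
      linear_combination c1 - s₀ z * f01 - s₁ z * f11
    rcases hne z hz with h | h
    · exact sub_eq_zero.1 ((mul_eq_zero.1 y0).resolve_left h)
    · exact sub_eq_zero.1 ((mul_eq_zero.1 y1).resolve_left h)
  obtain ⟨m, hms, hm⟩ := exists_primitive hD hDc has hbs hab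
  -- If dm = a dz + b d\bar z, adding m r to s cancels the error term without changing the
  -- determinant.
  refine ⟨fun z => !![r₀ z, r₁ z; m z * r₀ z + s₀ z, m z * r₁ z + s₁ z], ?_, fun z hz => ?_⟩
  · intro i j
    fin_cases i <;> fin_cases j
    · exact h₀
    · exact h₁
    · exact (hms.mul h₀).add k₀
    · exact (hms.mul h₁).add k₁
  · have w₀ := hasWirtingerAt_of_contDiffOn hD k₀ hz
    have w₁ := hasWirtingerAt_of_contDiffOn hD k₁ hz
    obtain ⟨q1, q2, q3, q4⟩ := hs z hz
    have g₀ := ((hm z hz).mul (hr₀ z hz)).add w₀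
    have g₁ := ((hm z hz).mul (hr₁ z hz)).add w₁
    refine ⟨?_, ?_, ?_⟩
    · rw [Matrix.det_fin_two_of]
      linear_combination hdet z hz
    · ext i j
      fin_cases i <;> fin_cases j
      · exact (hr₀ z hz).dz_eq.trans (by simp [Matrix.mul_apply, Fin.sum_univ_two])
      · exact (hr₁ z hz).dz_eq.trans (by simp [Matrix.mul_apply, Fin.sum_univ_two])
      · exact g₀.dz_eq.trans (by simp [Matrix.mul_apply, Fin.sum_univ_two, q1]; ring)
      · exact g₁.dz_eq.trans (by simp [Matrix.mul_apply, Fin.sum_univ_two, q2]; ring)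
    · ext i j
      fin_cases i <;> fin_cases j
      · exact (hr₀ z hz).dzbar_eq.trans (by simp [Matrix.mul_apply, Fin.sum_univ_two])
      · exact (hr₁ z hz).dzbar_eq.trans (by simp [Matrix.mul_apply, Fin.sum_univ_two])
      · exact g₀.dzbar_eq.trans (by simp [Matrix.mul_apply, Fin.sum_univ_two, q3]; ring)
      · exact g₁.dzbar_eq.trans (by simp [Matrix.mul_apply, Fin.sum_univ_two, q4]; ring)

end Local

/-- Under constant mean curvature, fundamental solutions exist near every point. -/
theorem exists_local_fundamentalSolution {D : Set ℂ} {f : ℂ → Nil3} {w : ℂ → ℂ}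
    (hD : IsOpen D) (hf : IsConformalImmersionOn D f) (hw : ContDiffOn ℝ ∞ w D)
    (hwf : ∀ z ∈ D, Complex.exp (w z / 2) = diracPotential f z)
    {c : ℝ} (hc : ∀ z ∈ D, meanCurvature f z = c) {z₀ : ℂ} (hz₀ : z₀ ∈ D) :
    ∃ r > 0, Metric.ball z₀ r ⊆ D ∧
      ∃ F : ℂ → GL (Fin 2) ℂ, IsFundamentalSolutionOn (Metric.ball z₀ r) f w F := by
  obtain ⟨r, hr, hsub, s, t, h⟩ := exists_local_spinor hD hf hz₀
  have hB : IsOpen (Metric.ball z₀ r) := Metric.isOpen_ball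
  have hf' : IsConformalImmersionOn (Metric.ball z₀ r) f :=
    ⟨hf.1.mono hsub, fun ζ hζ => hf.2 ζ (hsub hζ)⟩
  have hw' := hw.mono hsub
  have hwf' := fun z hz => hwf z (hsub hz)
  have hc' := fun z hz => hc z (hsub hz)
  have hU := fun z (hz : z ∈ Metric.ball z₀ r) => matU_eq (w := w) hB hc' 1 hz
  have hV := fun z (hz : z ∈ Metric.ball z₀ r) => matV_eq (w := w) hB hc' 1 hz
  obtain ⟨F, hF, hF'⟩ := exists_frame_of_row hB (convex_ball z₀ r)
    (contDiffOn_matU hB hf' hw' hwf' 1) (contDiffOn_matV hB hf' hw' hwf' 1)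
    (fun z hz => by rw [hU z hz]; simp) (fun z hz => by rw [hV z hz]; simp)
    ((isFlatConnectionOn_alpha_iff hB hf' hw' hwf' 1).1
      (isFlatConnectionOn_of_constant hB hf' hw' hwf' hc' one_ne_zero))
    (contDiffOn_gaugedFst hw' h.smooth_fst) (contDiffOn_gaugedSnd hw' h.smooth_snd)
    (fun z hz => (h.hasWirtingerAt_gaugedFst hB hf' hw' hwf' hc' hz).congr_coeff
      (by rw [hU z hz]; simp; ring) (by rw [hV z hz]; simp; ring))
    (fun z hz => (h.hasWirtingerAt_gaugedSnd hB hf' hw' hwf' hc' hz).congr_coeff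
      (by rw [hU z hz]; simp; ring) (by rw [hV z hz]; simp; ring))
    fun z hz => h.gauged_ne_zero hf' (w := w) hz
  have hu : ∀ z ∈ Metric.ball z₀ r, IsUnit (F z) := fun z hz => by
    rw [Matrix.isUnit_iff_isUnit_det, (hF' z hz).1]; exact isUnit_one
  classical
  -- The value 1 is only taken where `F z` is not invertible, which never happens on the ball.
  refine ⟨r, hr, hsub, fun z => if hz : IsUnit (F z) then hz.unit else 1, ?_⟩
  have e : ∀ z ∈ Metric.ball z₀ r,
      ((if hz : IsUnit (F z) then hz.unit else 1 : GL (Fin 2) ℂ) : Matrix (Fin 2) (Fin 2) ℂ)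
        = F z := fun z hz => by rw [dif_pos (hu z hz), IsUnit.unit_spec]
  refine ⟨fun i j => (hF i j).congr fun z hz => by rw [e z hz], fun z hz => ?_⟩
  obtain ⟨e1, e2⟩ := matDz_congr (z := z)
    (by filter_upwards [hB.mem_nhds hz] with ζ hζ using e ζ hζ)
  rw [(hF' z hz).2.1, ← e z hz] at e1
  rw [(hF' z hz).2.2, ← e z hz] at e2
  exact ⟨fun i j => congrFun (congrFun e1 i) j, fun i j => congrFun (congrFun e2 i) j⟩

end Nil3

namespace Nil3

/-! ### Gluing local frames over a simply connected domain -/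

/-- Local frames with locally constant transitions over a simply connected space come from a global
frame. -/
theorem exists_global_frame {X G : Type*} [TopologicalSpace X] [SimplyConnectedSpace X]
    [LocallyPathConnectedSpace X] [Group G] (U : X → Set X) (hU : ∀ x, IsOpen (U x))
    (hmem : ∀ x, x ∈ U x) (g : X → X → G)
    (hg : ∀ i j, ∀ x ∈ U i ∩ U j, ∀ᶠ y in nhds x, g i y * (g j y)⁻¹ = g i x * (g j x)⁻¹) :
    ∃ F : X → G, ∀ i, ∀ x ∈ U i, ∀ᶠ y in nhds x, F y * (g i y)⁻¹ = F x * (g i x)⁻¹ := by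
  -- With the discrete topology on `G`, right multiplication by the locally constant transitions
  -- defines a covering of `X`. Simple connectedness lifts the identity to a global section.
  let _ : TopologicalSpace G := ⊥
  have : DiscreteTopology G := ⟨rfl⟩
  let Z : FiberBundleCore X X G :=
    { baseSet := U
      isOpen_baseSet := hU
      indexAt := id
      mem_baseSet_at := hmem
      coordChange := fun i j x v => v * (g i x * (g j x)⁻¹)
      coordChange_self := fun i x _ v => by simp
      continuousOn_coordChange := fun i j => by
        rintro ⟨x, v⟩ ⟨hx, -⟩
        refine ContinuousAt.continuousWithinAt ?_
        refine (continuousAt_const (y := v * (g i x * (g j x)⁻¹))).congr ?_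
        have h1 := (hg i j x hx).prod_inl_nhds v
        have h2 : ∀ᶠ p : X × G in nhds (x, v), p.2 = v := by
          have : ∀ᶠ u in nhds v, u = v := by rw [nhds_discrete]; exact rfl
          exact this.prod_inr_nhds x
        filter_upwards [h1, h2] with p hp1 hp2
        rw [hp1, hp2]
      coordChange_comp := fun i j k x _ v => by group }
  have hcov : IsCoveringMap Z.proj := FiberBundle.isCoveringMap
  obtain ⟨x₀⟩ : Nonempty X := inferInstance
  obtain ⟨s, ⟨-, hs⟩, -⟩ := hcov.existsUnique_continuousMap_lifts (ContinuousMap.id X) x₀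
    (⟨x₀, (1 : G)⟩ : Z.TotalSpace) rfl
  have hs' : ∀ x, (s x).1 = x := fun x => congrFun hs x
  let v : X → G := fun x => (s x).2
  -- The section has coordinate `v x` in the chart indexed by `x`, hence F(x) g_i(x)⁻¹ in chart i.
  -- That coordinate is continuous with discrete values, so it is locally constant.
  refine ⟨fun x => v x * g x x, fun i x hx => ?_⟩
  have hc : ContinuousAt (fun y => Z.localTriv i (s y)) x := by
    refine ContinuousAt.comp ?_ s.continuous.continuousAt
    refine (Z.localTriv i).continuousOn_toFun.continuousAt
      ((Z.localTriv i).open_source.mem_nhds ?_)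
    rw [Z.mem_localTriv_source, hs']
    exact hx
  have hc2 := hc.snd
  have hev : ∀ᶠ y in nhds x, (Z.localTriv i (s y)).2 = (Z.localTriv i (s x)).2 := by
    have := hc2.eventually (p := fun u => u = (Z.localTriv i (s x)).2)
    rw [nhds_discrete] at this
    exact this rfl
  have e : ∀ y, (Z.localTriv i (s y)).2 = v y * g y y * (g i y)⁻¹ := by
    intro y
    rw [Z.localTriv_apply]
    change v y * (g (s y).1 (s y).1 * (g i (s y).1)⁻¹) = _
    rw [hs', mul_assoc]
  filter_upwards [hev] with y hy
  rwa [e, e] at hy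

section

variable {U V : ℂ → Matrix (Fin 2) (Fin 2) ℂ} {F₁ F₂ : ℂ → GL (Fin 2) ℂ}

/-- Two solutions of `dF = F α` differ by a locally constant left factor. -/
theorem eventually_mul_inv_eq {W : Set ℂ} (hW : IsOpen W)
    (h₁ : ∀ i j, ContDiffOn ℝ ∞ (fun z => (F₁ z : Matrix (Fin 2) (Fin 2) ℂ) i j) W)
    (h₂ : ∀ i j, ContDiffOn ℝ ∞ (fun z => (F₂ z : Matrix (Fin 2) (Fin 2) ℂ) i j) W)
    (k₁ : ∀ z ∈ W, matDz (fun ζ => (F₁ ζ).val) z = (F₁ z).val * U z ∧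
      matDzbar (fun ζ => (F₁ ζ).val) z = (F₁ z).val * V z)
    (k₂ : ∀ z ∈ W, matDz (fun ζ => (F₂ ζ).val) z = (F₂ z).val * U z ∧
      matDzbar (fun ζ => (F₂ ζ).val) z = (F₂ z).val * V z) {z : ℂ} (hz : z ∈ W) :
    ∀ᶠ y in nhds z, F₁ y * (F₂ y)⁻¹ = F₁ z * (F₂ z)⁻¹ := by
  set C : ℂ → Matrix (Fin 2) (Fin 2) ℂ := fun ζ => (F₁ ζ * (F₂ ζ)⁻¹ : GL (Fin 2) ℂ).val with hC
  have hCs : ∀ i j, ContDiffOn ℝ ∞ (fun z => C z i j) W := by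
    intro i j
    simp only [hC, Units.val_mul, Matrix.mul_apply, Fin.sum_univ_two]
    exact ((h₁ i 0).mul (contDiffOn_units_inv h₂ 0 j)).add
      ((h₁ i 1).mul (contDiffOn_units_inv h₂ 1 j))
  have hCF : (fun ζ => C ζ * (F₂ ζ).val) = fun ζ => (F₁ ζ).val := funext fun ζ => by
    rw [hC, ← Units.val_mul, inv_mul_cancel_right]
  -- With C = F₁F₂⁻¹, differentiating CF₂ = F₁ and using both equations leaves dC F₂ = 0.
  have hfd : ∀ ζ ∈ W, ∀ i j, fderiv ℝ (fun ζ => C ζ i j) ζ = 0 := by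
    intro ζ hζ i j
    have hd := fun i j => differentiableAt_of_contDiffOn hW (hCs i j) hζ
    obtain ⟨e1, e2⟩ := matDz_mul hd fun i j => differentiableAt_of_contDiffOn hW (h₂ i j) hζ
    rw [hCF, (k₁ ζ hζ).1, (k₂ ζ hζ).1, ← mul_assoc, congrFun hCF ζ, right_eq_add,
      Units.mul_left_eq_zero] at e1
    rw [hCF, (k₁ ζ hζ).2, (k₂ ζ hζ).2, ← mul_assoc, congrFun hCF ζ, right_eq_add,
      Units.mul_left_eq_zero] at e2
    have := hasWirtingerAt_of_differentiableAt (hd i j)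
    have a1 : dz (fun ζ => C ζ i j) ζ = 0 := congrFun (congrFun e1 i) j
    have a2 : dzbar (fun ζ => C ζ i j) ζ = 0 := congrFun (congrFun e2 i) j
    ext v
    rw [this.fderiv_apply, a1, a2]
    simp
  obtain ⟨r, hr, hball⟩ := Metric.isOpen_iff.1 hW z hz
  filter_upwards [Metric.ball_mem_nhds z hr] with y hy
  refine Units.ext (Matrix.ext fun i j => ?_)
  exact (convex_ball z r).is_const_of_fderivWithin_eq_zero (𝕜 := ℝ) (f := fun ζ => C ζ i j)
    (fun ζ hζ => (differentiableAt_of_contDiffOn hW (hCs i j) (hball hζ)).differentiableWithinAt)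
    (fun ζ hζ => by
      rw [fderivWithin_of_isOpen Metric.isOpen_ball hζ, hfd ζ (hball hζ)]) hy
    (Metric.mem_ball_self hr)

end

theorem IsFundamentalSolutionOn.matDz_eq {D : Set ℂ} {f : ℂ → Nil3} {w : ℂ → ℂ}
    {F : ℂ → GL (Fin 2) ℂ} (h : IsFundamentalSolutionOn D f w F) {z : ℂ} (hz : z ∈ D) :
    matDz (fun ζ => (F ζ).val) z = (F z).val * matU f w 1 z ∧
      matDzbar (fun ζ => (F ζ).val) z = (F z).val * matV f w 1 z :=
  ⟨Matrix.ext (h.2 z hz).1, Matrix.ext (h.2 z hz).2⟩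

/-- Under constant mean curvature, a fundamental solution exists on a simply connected domain. -/
theorem exists_fundamentalSolution {D : Set ℂ} {f : ℂ → Nil3} {w : ℂ → ℂ}
    (hD : IsOpen D) (hDs : IsSimplyConnected D) (hf : IsConformalImmersionOn D f)
    (hw : ContDiffOn ℝ ∞ w D) (hwf : ∀ z ∈ D, Complex.exp (w z / 2) = diracPotential f z)
    {c : ℝ} (hc : ∀ z ∈ D, meanCurvature f z = c) :
    ∃ F : ℂ → GL (Fin 2) ℂ, IsFundamentalSolutionOn D f w F := by
  choose r hr hsub E hE using
    fun p : D => exists_local_fundamentalSolution hD hf hw hwf hc p.2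
  have := hDs.simplyConnectedSpace
  have : LocallyPathConnectedSpace D := hD.locallyPathConnectedSpace
  obtain ⟨F, hF⟩ := exists_global_frame (X := D) (fun p => (↑) ⁻¹' Metric.ball (p : ℂ) (r p))
    (fun p => Metric.isOpen_ball.preimage continuous_subtype_val)
    (fun p => Metric.mem_ball_self (hr p)) (fun p q => E p q) fun i j x hx => by
      have := eventually_mul_inv_eq (F₁ := E i) (F₂ := E j)
        (Metric.isOpen_ball.inter Metric.isOpen_ball)
        (fun k l => ((hE i).1 k l).mono Set.inter_subset_left)
        (fun k l => ((hE j).1 k l).mono Set.inter_subset_right)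
        (fun z hz => (hE i).matDz_eq hz.1) (fun z hz => (hE j).matDz_eq hz.2) (z := x) hx
      exact continuous_subtype_val.continuousAt.eventually this
  classical
  set G : ℂ → GL (Fin 2) ℂ := fun z => if h : z ∈ D then F ⟨z, h⟩ else 1 with hG
  -- Near each point the glued map is a constant matrix times a local fundamental solution, and left
  -- multiplication by constants preserves dF = Fα.
  have key : ∀ z (hz : z ∈ D), ∃ C : Matrix (Fin 2) (Fin 2) ℂ,
      (fun ζ => (G ζ).val) =ᶠ[nhds z] fun ζ => C * (E ⟨z, hz⟩ ζ).val := by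
    intro z hz
    refine ⟨(F ⟨z, hz⟩ * (E ⟨z, hz⟩ z)⁻¹ : GL (Fin 2) ℂ).val, ?_⟩
    have h1 := hF ⟨z, hz⟩ ⟨z, hz⟩ (Metric.mem_ball_self (hr _))
    rw [nhds_subtype_eq_comap, Filter.eventually_comap] at h1
    filter_upwards [h1, hD.mem_nhds hz] with y hy hyD
    have := hy ⟨y, hyD⟩ rfl
    rw [← Units.val_mul, ← this, inv_mul_cancel_right, hG]
    simp only [dif_pos hyD]
  have key2 : ∀ z (hz : z ∈ D), z ∈ Metric.ball z (r ⟨z, hz⟩) := fun z hz =>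
    Metric.mem_ball_self (hr _)
  refine ⟨G, fun i j z hz => ?_, fun z hz => ?_⟩
  · obtain ⟨C, hCe⟩ := key z hz
    have hs := fun i j => ((hE ⟨z, hz⟩).1 i j).contDiffAt (Metric.isOpen_ball.mem_nhds (key2 z hz))
    refine ContDiffAt.contDiffWithinAt ?_
    refine (((contDiffAt_const (c := C i 0)).mul (hs 0 j)).add
      ((contDiffAt_const (c := C i 1)).mul (hs 1 j))).congr_of_eventuallyEq ?_
    filter_upwards [hCe] with ζ hζ
    rw [hζ, Matrix.mul_apply, Fin.sum_univ_two]
  · obtain ⟨C, hCe⟩ := key z hz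
    obtain ⟨e1, e2⟩ := matDz_congr hCe
    obtain ⟨d1, d2⟩ := matDz_mul (A := fun _ => C) (z := z)
      (fun i j => differentiableAt_const (𝕜 := ℝ) (C i j))
      fun i j => differentiableAt_of_contDiffOn Metric.isOpen_ball ((hE ⟨z, hz⟩).1 i j) (key2 z hz)
    have c1 : matDz (fun _ => C) z = 0 := by
      ext i j; exact (HasWirtingerAt.const (C i j) z).dz_eq
    have c2 : matDzbar (fun _ => C) z = 0 := by
      ext i j; exact (HasWirtingerAt.const (C i j) z).dzbar_eq
    obtain ⟨m1, m2⟩ := (hE ⟨z, hz⟩).matDz_eq (key2 z hz)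
    rw [d1, c1, zero_mul, zero_add, m1, ← mul_assoc, ← hCe.eq_of_nhds] at e1
    rw [d2, c2, zero_mul, zero_add, m2, ← mul_assoc, ← hCe.eq_of_nhds] at e2
    exact ⟨fun i j => congrFun (congrFun e1 i) j, fun i j => congrFun (congrFun e2 i) j⟩

end Nil3

/-! ### The equivalences. -/

theorem theorem4p1 (D : Set ℂ) (hDo : IsOpen D) (hDs : IsSimplyConnected D)
    (f : ℂ → Nil3) (hf : Nil3.IsConformalImmersionOn D f)
    (w : ℂ → ℂ) (hw : ContDiffOn ℝ ∞ w D)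
    (hwf : ∀ z ∈ D, Complex.exp (w z / 2) = Nil3.diracPotential f z) :
    List.TFAE [
      Nil3.HasConstantMeanCurvatureOn D f,
      ∀ l : ℂ, l ≠ 0 → Nil3.IsFlatConnectionOn D (Nil3.alpha f w l),
      ∃ F : ℂ → GL (Fin 2) ℂ, Nil3.IsFundamentalSolutionOn D f w F ∧
        Nil3.IsHarmonicOn D (fun z => Nil3.adSigma3 (F z))] ∧
    ∀ F : ℂ → GL (Fin 2) ℂ, Nil3.IsFundamentalSolutionOn D f w F →
      (Nil3.HasConstantMeanCurvatureOn D f ↔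
        Nil3.IsHarmonicOn D (fun z => Nil3.adSigma3 (F z))) := by
  have hDc : IsPreconnected D := hDs.isPathConnected.isConnected.isPreconnected
  have key := fun (F : ℂ → GL (Fin 2) ℂ) (hF : Nil3.IsFundamentalSolutionOn D f w F) =>
    Nil3.hasConstantMeanCurvatureOn_iff_isHarmonicOn hDo hDc hf hw hwf hF
  refine ⟨?_, key⟩
  tfae_have 1 → 2 := by
    rintro ⟨c, hc⟩ l hl
    exact Nil3.isFlatConnectionOn_of_constant hDo hf hw hwf hc hl
  tfae_have 2 → 1 := fun h => Nil3.hasConstantMeanCurvatureOn_of_flat hDo hf hw hwf hDc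
    (h 1 one_ne_zero) (h 2 two_ne_zero)
  -- Simple connectedness beyond mere connectedness is used only here, for the global frame.
  tfae_have 1 → 3 := by
    rintro ⟨c, hc⟩
    obtain ⟨F, hF⟩ := Nil3.exists_fundamentalSolution hDo hDs hf hw hwf hc
    exact ⟨F, hF, (key F hF).1 ⟨c, hc⟩⟩
  tfae_have 3 → 1 := by
    rintro ⟨F, hF, h⟩
    exact (key F hF).2 h
  tfae_finish
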